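/- For $g\ge 0$, $n\ge 1$ and $b_1,\dots,b_n\ge 1$ put $m=2g-2+n+\sum_i b_i$, and let the simple Hurwitz number $h_{g;b_1,\dots,b_n}$ be the number of isomorphism classes, each weighted by the inverse of the order of its automorphism group, of connected ramified coverings of the sphere of genus $g$ and degree $d=\sum_i b_i$ that have $n$ marked preimages of $\infty$ of multiplicities $b_1,\dots,b_n$ (and no other ones) and $m$ further simple branch points at fixed positions. The coverings are described by their monodromy: permutations $\sigma,\tau_1,\dots,\tau_m\in S_d$ with $\tau_1\cdots\tau_m\sigma=1$ that generate a transitive group, where the $\tau_i$ are transpositions and the cycles of $\sigma$ are marked by $1,\dots,n$, the $i$-th of them having length $b_i$, all up to simultaneous conjugation in $S_d$. Let $$H(\beta;p_1,p_2,\dots)=\sum_{n\ge1}\frac1{n!}\sum_{g,b_1,\dots,b_n}h_{g;b_1,\dots,b_n}\frac{\beta^m}{m!}\,p_{b_1}\cdots p_{b_n}\in\mathbb Q[[\beta]][[p_1,p_2,\dots]].$$ Then $$e^H=e^{\beta M_0}e^{p_1},\qquad M_0=\frac12\sum_{i,j\ge1}\Bigl((i+j)\,p_ip_j\frac{\partial}{\partial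 p_{i+j}}+i\,j\,p_{i+j}\frac{\partial^2}{\partial p_i\,\partial p_j}\Bigr),$$ and $H$ is a solution of the KP hierarchy in the variables $p_i$, identically in the formal parameter $\beta$. That is, $\tau=e^H$ satisfies the Hirota bilinear equations $$\operatorname{Res}_{z}\ \exp\Bigl(\sum_{k\ge1}\frac{p_k-p_k'}{k}z^k\Bigr)\,\tau(p-[z^{-1}])\,\tau(p'+[z^{-1}])\,dz=0,$$ where $p\pm[u]=(p_1\pm u,\,p_2\pm u^2,\,p_3\pm u^3,\dots)$ and $\operatorname{Res}_z$ denotes the coefficient of $z^{-1}dz$; this is an identity of formal power series over $\mathbb Q[[\beta]]$ in the independent variables $p_1,p_1',p_2,p_2',\dots$. -/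

import Mathlib

open scoped BigOperators

noncomputable section

namespace KPHurwitz

/-! ### Simple Hurwitz numbers

A ramified covering of degree `d` of the sphere with fixed critical values is described, after a
labelling of its sheets by `Fin d`, by its monodromy around the critical values.
Isomorphisms of coverings are relabellings of the sheets. -/

/-- A connected ramified covering of the sphere, with sheets labelled by `Fin (∑ i, b i)`, that has
`m` simple finite critical values (one simple critical point over each of them) and whose preimages
over infinity are marked by `Fin n`, the `i`-th one having multiplicity `b i`. -/
@[ext]
structure MarkedCovering {n : ℕ} (m : ℕ) (b : Fin n → ℕ+) where
  /-- the monodromy around infinity; its cycles are the preimages of infinity -/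
  atInfty : Equiv.Perm (Fin (∑ i, (b i : ℕ)))
  /-- the monodromy around the finite critical values -/
  atCrit : Fin m → Equiv.Perm (Fin (∑ i, (b i : ℕ)))
  /-- the marked point over infinity at which a sheet arrives -/
  mark : Fin (∑ i, (b i : ℕ)) → Fin n
  /-- simple ramification over the finite critical values -/
  isSwap_atCrit : ∀ i, (atCrit i).IsSwap
  /-- the relation of the fundamental group of the punctured sphere -/
  prod_eq_one : (List.ofFn atCrit).prod * atInfty = 1
  /-- the covering surface is connected -/
  connected : ∀ x y, ∃ g ∈ Subgroup.closure (insert atInfty (Set.range atCrit)), g x = y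
  /-- the marks are the names of the cycles of `atInfty` -/
  mark_eq_iff : ∀ x y, mark x = mark y ↔ atInfty.SameCycle x y
  /-- the `i`-th cycle has length `b i` -/
  card_mark : ∀ i, (Finset.univ.filter fun x => mark x = i).card = (b i : ℕ)

namespace MarkedCovering

variable {n m : ℕ} {b : Fin n → ℕ+}

/-- Relabelling of the sheets. -/
def relabel (g : Equiv.Perm (Fin (∑ i, (b i : ℕ)))) (c : MarkedCovering m b) :
    MarkedCovering m b where
  atInfty := MulAut.conj g c.atInfty
  atCrit i := MulAut.conj g (c.atCrit i)
  mark x := c.mark (g⁻¹ x)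
  isSwap_atCrit i := by
    obtain ⟨x, y, hxy, h⟩ := c.isSwap_atCrit i
    refine ⟨g x, g y, g.injective.ne hxy, ?_⟩
    rw [h, MulAut.conj_apply, Equiv.swap_apply_apply]
  prod_eq_one := by
    have h : (List.ofFn fun i => MulAut.conj g (c.atCrit i)).prod
        = MulAut.conj g (List.ofFn c.atCrit).prod := by
      rw [map_list_prod, List.map_ofFn]; rfl
    rw [h, ← map_mul, c.prod_eq_one, map_one]
  connected x y := by
    obtain ⟨k, hk, hxy⟩ := c.connected (g⁻¹ x) (g⁻¹ y)
    refine ⟨MulAut.conj g k, ?_, by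
      rw [MulAut.conj_apply, Equiv.Perm.mul_apply, Equiv.Perm.mul_apply, hxy]
      exact g.apply_symm_apply y⟩
    have h := Subgroup.mem_map_of_mem (MulAut.conj g).toMonoidHom hk
    rw [MonoidHom.map_closure, Set.image_insert_eq, ← Set.range_comp] at h
    exact h
  mark_eq_iff x y := by
    rw [c.mark_eq_iff, MulAut.conj_apply, Equiv.Perm.sameCycle_conj]
  card_mark i := by
    rw [← c.card_mark i]
    refine Finset.card_bij' (fun x _ => g⁻¹ x) (fun x _ => g x) ?_ ?_ ?_ ?_ <;> simp

/-- The group of all relabellings acts: its orbits are the isomorphism classes of coverings, and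
the stabilizer of a covering is its automorphism group. -/
instance : MulAction (Equiv.Perm (Fin (∑ i, (b i : ℕ)))) (MarkedCovering m b) where
  smul := relabel
  one_smul c := by
    refine MarkedCovering.ext ?_ ?_ ?_
    · change MulAut.conj 1 c.atInfty = _
      simp
    · funext i
      change MulAut.conj 1 (c.atCrit i) = _
      simp
    · funext x
      change c.mark ((1 : Equiv.Perm (Fin (∑ i, (b i : ℕ))))⁻¹ x) = _
      simp
  mul_smul g h c := by
    refine MarkedCovering.ext ?_ ?_ ?_
    · change MulAut.conj (g * h) c.atInfty = MulAut.conj g (MulAut.conj h c.atInfty)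
      simp
    · funext i
      change MulAut.conj (g * h) (c.atCrit i) = MulAut.conj g (MulAut.conj h (c.atCrit i))
      simp
    · funext x
      change c.mark ((g * h)⁻¹ x) = c.mark (h⁻¹ (g⁻¹ x))
      simp

instance : Finite (MarkedCovering m b) :=
  Finite.of_injective (fun c => (c.atInfty, c.atCrit, c.mark)) fun c c' h => by
    simp only [Prod.mk.injEq] at h
    exact MarkedCovering.ext h.1 h.2.1 h.2.2

end MarkedCovering

/-- The number `2g - 2 + n + ∑ bᵢ` of simple critical values given by the Riemann-Hurwitz formula
(for `n ≥ 1` the subtraction is a true one). -/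
def numCrit {n : ℕ} (g : ℕ) (b : Fin n → ℕ+) : ℕ := 2 * g + n + ∑ i, (b i : ℕ) - 2

/-- The Hurwitz number `h_{g; b₁, …, bₙ}`: the number of isomorphism classes of coverings, each
weighted by the inverse of the order of its automorphism group. -/
def hurwitzNumber {n : ℕ} (g : ℕ) (b : Fin n → ℕ+) : ℚ :=
  ∑ᶠ ω : MulAction.orbitRel.Quotient (Equiv.Perm (Fin (∑ i, (b i : ℕ))))
      (MarkedCovering (numCrit g b) b),
    1 / (Nat.card (MulAction.stabilizer (Equiv.Perm (Fin (∑ i, (b i : ℕ)))) ω.out) : ℚ)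

/-- The monomial `p_{b₁} ⋯ p_{bₙ}` as an exponent vector. -/
def monomialOf {n : ℕ} (b : Fin n → ℕ+) : ℕ+ →₀ ℕ := ∑ i, Finsupp.single (b i) 1

/-- The generating series
`H(β; p) = ∑_{n ≥ 1} 1/n! ∑_{g, b₁, …, bₙ} h_{g; b} β^m / m! p_{b₁} ⋯ p_{bₙ}`, `m = 2g-2+n+∑ bᵢ`,
as a power series in the `p_i` over `ℚ⟦β⟧`. A monomial `α` of degree `n` occurs for the finitely
many tuples `b` with `p_{b₁} ⋯ p_{bₙ} = p^α`, and `β^m` occurs only for genera `g ≤ m`. -/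
def hurwitzSeries : MvPowerSeries ℕ+ (PowerSeries ℚ) := fun α =>
  if α = 0 then 0 else
    PowerSeries.mk fun m =>
      (1 / (α.degree.factorial : ℚ)) *
        ∑ b ∈ (Fintype.piFinset fun _ : Fin α.degree => α.support).filter
            (fun b => monomialOf b = α),
          ∑ g ∈ (Finset.range (m + 1)).filter (fun g => numCrit g b = m),
            hurwitzNumber g b / (m.factorial : ℚ)

/-! ### The cut-and-join operator -/

/-- The `(i, j)`-th summand
`(i + j) p_i p_j ∂/∂p_{i+j} + i j p_{i+j} ∂²/∂p_i∂p_j` of the cut-and-join operator. -/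
def cutJoinTerm (f : MvPowerSeries ℕ+ ℚ) (i j : ℕ+) : MvPowerSeries ℕ+ ℚ :=
  ((i : ℚ) + (j : ℚ)) •
      (MvPowerSeries.X i * MvPowerSeries.X j * MvPowerSeries.pderiv ℚ (i + j) f)
    + ((i : ℚ) * (j : ℚ)) •
      (MvPowerSeries.X (i + j) * MvPowerSeries.pderiv ℚ i (MvPowerSeries.pderiv ℚ j f))

/-- Only finitely many summands contribute to a given coefficient. -/
theorem cutJoinTerm_finite (f : MvPowerSeries ℕ+ ℚ) (α : ℕ+ →₀ ℕ) :
    (Function.support fun ij : ℕ+ × ℕ+ =>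
      MvPowerSeries.coeff α (cutJoinTerm f ij.1 ij.2)).Finite := by
  classical
  have hX : ∀ (k : ℕ+) (g : MvPowerSeries ℕ+ ℚ), α k = 0 →
      MvPowerSeries.coeff α (MvPowerSeries.X k * g) = 0 := fun k g hk =>
    MvPowerSeries.X_dvd_iff.mp (dvd_mul_right _ g) α hk
  refine (Set.Finite.prod (Set.finite_Iic (α.support.sup id : ℕ+))
    (Set.finite_Iic (α.support.sup id : ℕ+))).subset ?_
  rintro ⟨i, j⟩ hij
  by_contra hout
  refine hij ?_
  have hle : ∀ k : ℕ+, α k ≠ 0 → k ≤ α.support.sup id := fun k hk =>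
    Finset.le_sup (f := id) (Finsupp.mem_support_iff.mpr hk)
  have h0 : α i = 0 ∨ α j = 0 := by
    by_contra! h
    exact hout ⟨hle i h.1, hle j h.2⟩
  have h1 : α (i + j) = 0 := by
    by_contra h
    have := hle _ h
    exact hout ⟨(PNat.lt_add_right i j).le.trans this, (PNat.lt_add_left j i).le.trans this⟩
  have h2 : MvPowerSeries.coeff α
      (MvPowerSeries.X i * MvPowerSeries.X j * MvPowerSeries.pderiv ℚ (i + j) f) = 0 := by
    rcases h0 with h | h
    · rw [mul_assoc]
      exact hX i _ h
    · rw [mul_comm (MvPowerSeries.X i), mul_assoc]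
      exact hX j _ h
  simp only [cutJoinTerm, map_add, map_smul, h2, hX _ _ h1, smul_zero, add_zero]

/-- The cut-and-join operator
`M₀ = 1/2 ∑_{i,j ≥ 1} ((i + j) p_i p_j ∂/∂p_{i+j} + i j p_{i+j} ∂²/∂p_i∂p_j)`. -/
def cutJoin (f : MvPowerSeries ℕ+ ℚ) : MvPowerSeries ℕ+ ℚ := fun α =>
  (1 / 2 : ℚ) * ∑ᶠ ij : ℕ+ × ℕ+, MvPowerSeries.coeff α (cutJoinTerm f ij.1 ij.2)

/-- `e^{β M₀} f = ∑_m β^m / m! M₀^m f`, for a formal parameter `β`. -/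
def expCutJoin (f : MvPowerSeries ℕ+ ℚ) : MvPowerSeries ℕ+ (PowerSeries ℚ) := fun α =>
  PowerSeries.mk fun m => MvPowerSeries.coeff α (cutJoin^[m] f) / (m.factorial : ℚ)

/-! ### The KP hierarchy -/

section KP

variable {R : Type*} [CommRing R] [Algebra ℚ R]

/-- The exponential `e^F` of a power series without constant term. -/
def expSeries {σ : Type*} (F : MvPowerSeries σ R) : MvPowerSeries σ R :=
  (PowerSeries.exp ℚ).subst F

/-- `h_j(x)`, defined by `exp (∑_{k ≥ 1} x_k z^k / k) = ∑_j h_j(x) z^j`. -/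
def completeHom {A : Type*} [CommRing A] [Algebra ℚ A] (x : ℕ+ → A) (j : ℕ) : A :=
  PowerSeries.coeff j ((PowerSeries.exp ℚ).subst
    (PowerSeries.mk fun k => if hk : 0 < k then (1 / (k : ℚ)) • x ⟨k, hk⟩ else 0))

/-- Two copies `p`, `p'` of the sequence of variables: `Sum.inl k` is `p_k`, `Sum.inr k` is
`p'_k`. -/
abbrev TwoCopies := ℕ+ ⊕ ℕ+

/-- `τ(p - [u]) τ(p' + [u])`, where `p ∓ [u] = (p_1 ∓ u, p_2 ∓ u², p_3 ∓ u³, …)`, as a power series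
in `p`, `p'` and `u` (the variable `none`). -/
def shiftedProduct (τ : MvPowerSeries ℕ+ R) : MvPowerSeries (Option TwoCopies) R :=
  MvPowerSeries.subst (fun k : ℕ+ =>
      (MvPowerSeries.X (some (Sum.inl k)) - MvPowerSeries.X none ^ (k : ℕ) :
        MvPowerSeries (Option TwoCopies) R)) τ
    * MvPowerSeries.subst (fun k : ℕ+ =>
      (MvPowerSeries.X (some (Sum.inr k)) + MvPowerSeries.X none ^ (k : ℕ) :
        MvPowerSeries (Option TwoCopies) R)) τ

/-- The coefficient of `u^n` in a power series in `p`, `p'`, `u`. -/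
def uCoeff (n : ℕ) (A : MvPowerSeries (Option TwoCopies) R) : MvPowerSeries TwoCopies R := fun γ =>
  MvPowerSeries.coeff (γ.embDomain Function.Embedding.some + Finsupp.single none n) A

/-- The quasihomogeneous degree of a monomial in `p`, `p'`, where `deg p_k = deg p'_k = k`. -/
def wt (γ : TwoCopies →₀ ℕ) : ℕ := γ.sum fun v e => e * (Sum.elim id id v : ℕ+)

/-- The residue
`Res_z exp (∑_k (p_k - p'_k) z^k / k) τ(p - [z⁻¹]) τ(p' + [z⁻¹]) dz
  = ∑_{j ≥ 0} h_j(p - p') · [u^{j+1}] (τ(p - [u]) τ(p' + [u]))`.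
As `h_j` is quasihomogeneous of degree `j`, only `j ≤ wt γ` contribute to the coefficient at `γ`. -/
def bilinearResidue (τ : MvPowerSeries ℕ+ R) : MvPowerSeries TwoCopies R := fun γ =>
  ∑ j ∈ Finset.range (wt γ + 1), MvPowerSeries.coeff γ
    (completeHom (fun k : ℕ+ =>
        (MvPowerSeries.X (Sum.inl k) - MvPowerSeries.X (Sum.inr k) : MvPowerSeries TwoCopies R)) j
      * uCoeff (j + 1) (shiftedProduct τ))

/-- `F` is a solution of the KP hierarchy in the variables `p_1, p_2, …` (the usual times being
`t_k = p_k / k`): its exponential `τ = e^F` satisfies the Hirota bilinear equations. The constant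
term of `F`, which does not enter the equations, is removed before exponentiation. -/
def IsKPSolution (F : MvPowerSeries ℕ+ R) : Prop :=
  bilinearResidue (expSeries (F - MvPowerSeries.C (MvPowerSeries.constantCoeff F))) = 0

end KP

end KPHurwitz

end

/-!
The proof has two independent halves, one combinatorial and one algebraic.

**The cut-and-join formula.** The relation `τ₁ ⋯ τₘ σ = 1` determines the monodromy around infinity
by the word `τ₁ ⋯ τₘ` of transpositions of the `d` sheets, so that a covering is such a word
together with a marking; it is connected exactly when the word acts transitively. So `h_{g;b}` is
`1/d!` times a number of transitive words with a product of given cycle type, the markings of the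
cycles accounting for the factor `n!` (`coeff_hurwitzSeries`). That the number of transpositions is
the one of the Riemann-Hurwitz formula is proved by linear algebra (`exists_genus`): the functions
on the sheets invariant under a word form a space whose dimension drops by at most one with each
letter, and not at all when the letter cuts a cycle. Without transitivity the count is easy: a
transposition either cuts a cycle of a permutation or joins two of them, which is what `M₀` does to
the monomial of the cycle type (`cutJoin_monomial`), so that `e^{β M₀} e^{p₁}` is the exponential
generating function of all words (`coeff_expCutJoin`). Finally a word is a shuffle of transitive
words on the orbits it generates. Singling out the orbit of a marked sheet gives a recursion
(`card_smul_discSeries`), which says that `e^{β M₀} e^{p₁}` and `e^H` satisfy the same differential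
equation with respect to the Euler operator (`euler_expCutJoin`), hence agree.

**The Hirota equations.** In terms of the vertex operators `V^±_n` (`vertexOp`), the coefficients of
`exp (±∑ p_k z^k / k) exp (∓∑ z^{-k} ∂/∂p_k)`, the Hirota residue of `τ` is
`∑_n V⁺_n τ ⊗ V⁻_{-1-n} τ`. The point is that `M₀` is an infinitesimal symmetry of the equations.
With the Euler operator `E`, one has `(M₀ ± E) V^±_n - V^±_n M₀ = ± n (n + 1) / 2 V^±_n`
(`vertexOp_cutJoinFock`), which follows from `V^±_n p_k = p_k V^±_n ∓ V^±_{n+k}` by induction on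
polynomials, starting from the fact that the complete homogeneous polynomials are eigenvectors of
`M₀` (`cutJoinFock_completeHom`). As `n (n + 1)` is invariant under `n ↦ -1 - n`, the scalars cancel
in the bilinear expression, which therefore intertwines `M₀ ⊗ 1 + 1 ⊗ M₀` with an operator on the
tensor square (`semiconjBy_vertexPairing`). Hence `e^{β M₀}` preserves solutions. The initial value
`e^{p₁}` is a solution because `e^{p₁ - u} e^{p'₁ + u}` does not depend on `u`
(`vertexPairing_expPart`). All series involved are quasihomogeneous, so each coefficient of the
equations involves finitely many monomials of `τ` only (`coeff_bilinearResidue`), and the argument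
takes place in polynomials over `ℚ`.
-/

noncomputable section

namespace KPHurwitz

/-! ### Exponentials of power series and the Euler operator -/

section Euler

variable {σ : Type*} {R : Type*} [CommRing R]

/-- The Euler operator `∑ᵢ wᵢ Xᵢ ∂/∂Xᵢ`: it multiplies a monomial by its weight. -/
def euler (w : σ → ℕ) : Derivation R (MvPowerSeries σ R) (MvPowerSeries σ R) :=
  Derivation.mk'
    { toFun := fun f α => Finsupp.weight w α • MvPowerSeries.coeff α f
      map_add' := fun f g => by
        ext α
        exact smul_add _ _ _
      map_smul' := fun r f => by
        ext α
        change Finsupp.weight w α • (r * MvPowerSeries.coeff α f)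
          = r * (Finsupp.weight w α • MvPowerSeries.coeff α f)
        rw [mul_smul_comm] }
    fun f g => by
      classical
      ext α
      change Finsupp.weight w α • MvPowerSeries.coeff α (f * g) = MvPowerSeries.coeff α (_ + _)
      rw [map_add, smul_eq_mul, smul_eq_mul, mul_comm g, MvPowerSeries.coeff_mul,
        MvPowerSeries.coeff_mul, MvPowerSeries.coeff_mul, Finset.smul_sum,
        ← Finset.sum_add_distrib]
      refine Finset.sum_congr rfl fun p hp => ?_
      rw [← Finset.HasAntidiagonal.mem_antidiagonal.mp hp, map_add, add_smul]
      change _ = MvPowerSeries.coeff p.1 f * (Finsupp.weight w p.2 • MvPowerSeries.coeff p.2 g)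
        + Finsupp.weight w p.1 • MvPowerSeries.coeff p.1 f * MvPowerSeries.coeff p.2 g
      rw [mul_smul_comm, smul_mul_assoc, add_comm]

theorem coeff_euler (w : σ → ℕ) (f : MvPowerSeries σ R) (α : σ →₀ ℕ) :
    MvPowerSeries.coeff α (euler w f) = Finsupp.weight w α • MvPowerSeries.coeff α f :=
  rfl

/-- The derivation `z d/dz` of formal power series. -/
def theta : Derivation R (PowerSeries R) (PowerSeries R) := euler (σ := Unit) fun _ => 1

theorem coeff_theta (f : PowerSeries R) (n : ℕ) :
    PowerSeries.coeff n (theta f) = (n : R) * PowerSeries.coeff n f := by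
  have h := coeff_euler (σ := Unit) (fun _ => 1) f (Finsupp.single () n)
  rw [Finsupp.weight_single, smul_eq_mul, mul_one, nsmul_eq_mul] at h
  exact h

variable [Algebra ℚ R]

theorem coeff_expSeries {F : MvPowerSeries σ R} (hF : MvPowerSeries.constantCoeff F = 0)
    {α : σ →₀ ℕ} {N : ℕ} (hN : α.degree < N) :
    MvPowerSeries.coeff α (expSeries F)
      = ∑ n ∈ Finset.range N, (1 / (n.factorial : ℚ)) • MvPowerSeries.coeff α (F ^ n) := by
  rw [expSeries, PowerSeries.coeff_subst (PowerSeries.HasSubst.of_constantCoeff_zero hF),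
    finsum_eq_sum_of_support_subset (s := Finset.range N)]
  · refine Finset.sum_congr rfl fun n _ => ?_
    rw [PowerSeries.coeff_exp]
    simp
  · intro n hn
    by_contra h
    refine hn ?_
    have : MvPowerSeries.coeff α (F ^ n) = 0 :=
      MvPowerSeries.coeff_eq_zero_of_constantCoeff_nilpotent (m := 1) (by simpa using hF)
        (by simp at h; omega)
    simp [this]

theorem constantCoeff_expSeries {F : MvPowerSeries σ R}
    (hF : MvPowerSeries.constantCoeff F = 0) :
    MvPowerSeries.constantCoeff (expSeries F) = 1 := by
  rw [← MvPowerSeries.coeff_zero_eq_constantCoeff_apply,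
    coeff_expSeries hF (N := 1) (by simp)]
  simp

/-- The exponential series satisfies the differential equation of the exponential function. -/
theorem euler_expSeries (w : σ → ℕ) {F : MvPowerSeries σ R}
    (hF : MvPowerSeries.constantCoeff F = 0) :
    euler w (expSeries F) = euler w F * expSeries F := by
  classical
  ext α
  set N := α.degree + 1 with hN
  have h1 : MvPowerSeries.coeff α (euler w F * expSeries F)
      = MvPowerSeries.coeff α (euler w F *
          ∑ n ∈ Finset.range N, (1 / (n.factorial : ℚ)) • F ^ n) := by
    rw [MvPowerSeries.coeff_mul, MvPowerSeries.coeff_mul]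
    refine Finset.sum_congr rfl fun p hp => ?_
    have hdeg : p.2.degree < N := by
      rw [hN, ← Finset.HasAntidiagonal.mem_antidiagonal.mp hp, map_add]
      omega
    rw [coeff_expSeries hF hdeg, map_sum]
    rfl
  rw [h1, coeff_euler, coeff_expSeries hF (N := N + 1) (by omega), Finset.sum_range_succ',
    Finset.mul_sum, map_sum, smul_add, Finset.smul_sum]
  have h0 : Finsupp.weight w α • ((1 / ((0 : ℕ).factorial : ℚ)) • MvPowerSeries.coeff α (F ^ 0))
      = 0 := by
    have h : MvPowerSeries.coeff α (euler w (1 : MvPowerSeries σ R)) = 0 := by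
      rw [Derivation.map_one_eq_zero, map_zero]
    rw [smul_comm, pow_zero, ← coeff_euler, h, smul_zero]
  rw [h0]
  rw [add_zero]
  refine Finset.sum_congr rfl fun n _ => ?_
  rw [smul_comm, ← coeff_euler, Derivation.leibniz_pow, mul_smul_comm, Nat.add_sub_cancel,
    smul_eq_mul, mul_comm (F ^ n)]
  change _ • MvPowerSeries.coeff α (_ : MvPowerSeries σ R)
    = (1 / (n.factorial : ℚ)) • MvPowerSeries.coeff α (_ : MvPowerSeries σ R)
  rw [map_nsmul, ← Nat.cast_smul_eq_nsmul ℚ, smul_smul]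
  congr 1
  rw [Nat.factorial_succ]
  push_cast
  have := Nat.cast_add_one_ne_zero (R := ℚ) n
  have := Nat.cast_ne_zero (R := ℚ).mpr n.factorial_ne_zero
  field_simp

/-- A first order linear differential equation has at most one solution with given constant
term. -/
theorem eq_of_euler_eq {w : σ → ℕ} (hw : ∀ i, w i ≠ 0) {G Y Z : MvPowerSeries σ R}
    (hG : MvPowerSeries.constantCoeff G = 0) (hY : euler w Y = G * Y) (hZ : euler w Z = G * Z)
    (h : MvPowerSeries.constantCoeff Y = MvPowerSeries.constantCoeff Z) : Y = Z := by
  classical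
  have key : ∀ n : ℕ, ∀ α : σ →₀ ℕ, Finsupp.weight w α = n →
      MvPowerSeries.coeff α Y = MvPowerSeries.coeff α Z := by
    intro n
    induction n using Nat.strong_induction_on with
    | _ n ih =>
      intro α hα
      rcases Nat.eq_zero_or_pos n with hn | hn
      · have hα0 : α = 0 := by
          ext i
          have := Finsupp.le_weight w (hw i) α
          simp only [Finsupp.coe_zero, Pi.zero_apply]
          omega
        subst hα0
        simpa using h
      · have e : ∀ T : MvPowerSeries σ R, euler w T = G * T →
            n • MvPowerSeries.coeff α T
              = ∑ p ∈ Finset.HasAntidiagonal.antidiagonal α, MvPowerSeries.coeff p.1 G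
                * MvPowerSeries.coeff p.2 T := by
          intro T hT
          rw [← hα, ← coeff_euler, hT, MvPowerSeries.coeff_mul]
        have e2 : n • MvPowerSeries.coeff α Y = n • MvPowerSeries.coeff α Z := by
          rw [e Y hY, e Z hZ]
          refine Finset.sum_congr rfl fun p hp => ?_
          by_cases hp0 : p.1 = 0
          · rw [hp0, MvPowerSeries.coeff_zero_eq_constantCoeff_apply, hG, zero_mul, zero_mul]
          · rw [ih (Finsupp.weight w p.2) ?_ p.2 rfl]
            rw [← hα, ← Finset.HasAntidiagonal.mem_antidiagonal.mp hp, map_add]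
            have : Finsupp.weight w p.1 ≠ 0 := by
              intro h0
              refine hp0 ?_
              ext i
              have := Finsupp.le_weight w (hw i) p.1
              simp only [Finsupp.coe_zero, Pi.zero_apply]
              omega
            omega
        have e3 := congrArg (fun t => (1 / (n : ℚ)) • t) e2
        simp only [← Nat.cast_smul_eq_nsmul ℚ, smul_smul] at e3
        rw [one_div_mul_cancel (by positivity), one_smul, one_smul] at e3
        exact e3
  ext α
  exact key _ α rfl

theorem eq_expSeries {w : σ → ℕ} (hw : ∀ i, w i ≠ 0) {F Z : MvPowerSeries σ R}
    (hF : MvPowerSeries.constantCoeff F = 0) (hZ : euler w Z = euler w F * Z)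
    (h : MvPowerSeries.constantCoeff Z = 1) : Z = expSeries F := by
  refine eq_of_euler_eq hw ?_ hZ (euler_expSeries w hF)
    (h.trans (constantCoeff_expSeries hF).symm)
  rw [← MvPowerSeries.coeff_zero_eq_constantCoeff_apply, coeff_euler]
  simp

theorem expSeries_add {F G : MvPowerSeries σ R} (hF : MvPowerSeries.constantCoeff F = 0)
    (hG : MvPowerSeries.constantCoeff G = 0) :
    expSeries (F + G) = expSeries F * expSeries G := by
  symm
  refine eq_expSeries (w := fun _ => 1) (by simp) (by simp [hF, hG]) ?_ ?_
  · rw [Derivation.leibniz, euler_expSeries _ hF, euler_expSeries _ hG, map_add, smul_eq_mul,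
      smul_eq_mul]
    ring
  · rw [map_mul, constantCoeff_expSeries hF, constantCoeff_expSeries hG, one_mul]

end Euler

/-! ### The complete homogeneous polynomials -/

section CompleteHom

variable {A : Type*} [CommRing A] [Algebra ℚ A]

/-- The series `∑_{k ≥ 1} x_k z^k / k`. -/
def potential (x : ℕ+ → A) : PowerSeries A :=
  PowerSeries.mk fun k => if hk : 0 < k then (1 / (k : ℚ)) • x ⟨k, hk⟩ else 0

/-- The series `∑_{k ≥ 1} x_k z^k`. -/
def powerSumSeries (x : ℕ+ → A) : PowerSeries A :=
  PowerSeries.mk fun k => if hk : 0 < k then x ⟨k, hk⟩ else 0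

/-- The series `∑_j h_j(x) z^j`. -/
def completeSeries (x : ℕ+ → A) : PowerSeries A :=
  PowerSeries.mk (completeHom x)

theorem constantCoeff_potential (x : ℕ+ → A) :
    MvPowerSeries.constantCoeff (potential x) = 0 := by
  change PowerSeries.constantCoeff (potential x) = 0
  rw [← PowerSeries.coeff_zero_eq_constantCoeff_apply, potential, PowerSeries.coeff_mk]
  simp

theorem completeSeries_eq (x : ℕ+ → A) : completeSeries x = expSeries (potential x) := by
  ext j
  rw [completeSeries, PowerSeries.coeff_mk]
  rfl

theorem completeHom_zero (x : ℕ+ → A) : completeHom x 0 = 1 := by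
  have h := constantCoeff_expSeries (constantCoeff_potential x)
  rw [← completeSeries_eq] at h
  change PowerSeries.constantCoeff (completeSeries x) = 1 at h
  rwa [← PowerSeries.coeff_zero_eq_constantCoeff_apply, completeSeries, PowerSeries.coeff_mk] at h

theorem completeSeries_add (x y : ℕ+ → A) :
    completeSeries (x + y) = completeSeries x * completeSeries y := by
  rw [completeSeries_eq, completeSeries_eq, completeSeries_eq,
    ← expSeries_add (constantCoeff_potential x) (constantCoeff_potential y)]
  congr 1
  ext k
  rw [potential, potential, potential, map_add, PowerSeries.coeff_mk, PowerSeries.coeff_mk,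
    PowerSeries.coeff_mk]
  split_ifs
  · exact smul_add _ _ _
  · simp

theorem completeHom_add (x y : ℕ+ → A) (j : ℕ) :
    completeHom (x + y) j
      = ∑ p ∈ Finset.HasAntidiagonal.antidiagonal j, completeHom x p.1 * completeHom y p.2 := by
  have h := congrArg (PowerSeries.coeff j) (completeSeries_add x y)
  rw [PowerSeries.coeff_mul] at h
  simpa only [completeSeries, PowerSeries.coeff_mk] using h

theorem theta_potential (x : ℕ+ → A) : theta (potential x) = powerSumSeries x := by
  ext n
  rw [coeff_theta, potential, powerSumSeries, PowerSeries.coeff_mk, PowerSeries.coeff_mk]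
  split_ifs with hn
  · rw [← nsmul_eq_mul, ← Nat.cast_smul_eq_nsmul ℚ, smul_smul, mul_one_div_cancel, one_smul]
    positivity
  · simp

/-- Newton's identities in terms of generating series. -/
theorem theta_completeSeries (x : ℕ+ → A) :
    theta (completeSeries x) = powerSumSeries x * completeSeries x := by
  rw [completeSeries_eq, ← theta_potential]
  exact euler_expSeries _ (constantCoeff_potential x)

theorem completeHom_newton (x : ℕ+ → A) (n : ℕ) :
    (n : A) * completeHom x n = ∑ p ∈ Finset.HasAntidiagonal.antidiagonal n,
      (if h : 0 < p.1 then x ⟨p.1, h⟩ else 0) * completeHom x p.2 := by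
  have h := congrArg (PowerSeries.coeff n) (theta_completeSeries x)
  rw [PowerSeries.coeff_mul, coeff_theta] at h
  simpa only [completeSeries, powerSumSeries, PowerSeries.coeff_mk] using h

theorem eq_of_natCast_mul_eq {n : ℕ} (hn : n ≠ 0) {a b : A} (h : (n : A) * a = n * b) : a = b := by
  have e3 := congrArg (fun t => (1 / (n : ℚ)) • t) h
  simp only [← nsmul_eq_mul, ← Nat.cast_smul_eq_nsmul ℚ, smul_smul] at e3
  rwa [one_div_mul_cancel (by positivity), one_smul, one_smul] at e3

/-- The complete homogeneous polynomials commute with homomorphisms of algebras. -/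
theorem map_completeHom {B : Type*} [CommRing B] [Algebra ℚ B] (f : A →+* B) (x : ℕ+ → A)
    (n : ℕ) : f (completeHom x n) = completeHom (fun k => f (x k)) n := by
  induction n using Nat.strong_induction_on with
  | _ n ih =>
    rcases Nat.eq_zero_or_pos n with rfl | hn
    · rw [completeHom_zero, completeHom_zero, map_one]
    · refine eq_of_natCast_mul_eq hn.ne' ?_
      rw [← map_natCast f, ← map_mul, completeHom_newton, map_natCast, completeHom_newton, map_sum]
      refine Finset.sum_congr rfl fun p hp => ?_
      rw [map_mul]
      split_ifs with h
      · rw [ih p.2]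
        have := Finset.HasAntidiagonal.mem_antidiagonal.mp hp
        omega
      · simp

end CompleteHom

/-! ### Cycle types and multiplication by a transposition -/

section Cycles

open Function Equiv

variable {X : Type*}

theorem iterate_congr_of_mapsTo {f g : X → X} {S : Set X} (hS : ∀ x ∈ S, f x ∈ S)
    (h : ∀ x ∈ S, f x = g x) {x : X} (hx : x ∈ S) (n : ℕ) : f^[n] x = g^[n] x := by
  have h2 : ∀ n : ℕ, f^[n] x ∈ S ∧ f^[n] x = g^[n] x := by
    intro n
    induction n with
    | zero => exact ⟨hx, rfl⟩
    | succ n ih =>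
      rw [iterate_succ_apply', iterate_succ_apply', ← ih.2]
      exact ⟨hS _ ih.1, h _ ih.1⟩
  exact (h2 n).2

theorem minimalPeriod_congr_of_mapsTo {f g : X → X} {S : Set X} (hS : ∀ x ∈ S, f x ∈ S)
    (h : ∀ x ∈ S, f x = g x) {x : X} (hx : x ∈ S) : minimalPeriod f x = minimalPeriod g x := by
  rw [minimalPeriod_eq_minimalPeriod_iff]
  intro n
  rw [IsPeriodicPt, IsPeriodicPt, IsFixedPt, IsFixedPt, iterate_congr_of_mapsTo hS h hx]

theorem mapsTo_iterate {f : X → X} {S : Set X} (hS : ∀ x ∈ S, f x ∈ S) {x : X} (hx : x ∈ S)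
    (n : ℕ) : f^[n] x ∈ S := by
  induction n with
  | zero => exact hx
  | succ n ih =>
    rw [iterate_succ_apply']
    exact hS _ ih

theorem minimalPeriod_eq_of_forall_lt {f : X → X} {x : X} {n : ℕ} (hn : 0 < n)
    (h : f^[n] x = x) (h' : ∀ t, 0 < t → t < n → f^[t] x ≠ x) : minimalPeriod f x = n := by
  refine le_antisymm (IsPeriodicPt.minimalPeriod_le hn h) ?_
  by_contra! hlt
  exact h' _ (IsPeriodicPt.minimalPeriod_pos hn h) hlt iterate_minimalPeriod

/-- Cycle type of `σ` on a finite set `S` of points that is a union of cycles: the number of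
cycles of length `k`. The quotient is exact as soon as `σ` preserves `S`. -/
def cycOn (σ : Perm X) (S : Finset X) : ℕ+ →₀ ℕ := by
  classical
  exact Finsupp.ofSupportFinite
    (fun k => (S.filter fun x => minimalPeriod σ x = k).card / (k : ℕ)) <| by
      refine (S.image fun x => (minimalPeriod σ x).toPNat').finite_toSet.subset ?_
      intro k hk
      have h1 : (S.filter fun x => minimalPeriod σ x = k).card ≠ 0 := by
        intro h0
        refine hk ?_
        change (S.filter fun x => minimalPeriod σ x = k).card / (k : ℕ) = 0
        rw [h0, Nat.zero_div]
      obtain ⟨x, hx⟩ := Finset.card_ne_zero.mp h1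
      rw [Finset.mem_filter] at hx
      rw [Finset.mem_coe, Finset.mem_image]
      exact ⟨x, hx.1, by rw [hx.2, PNat.coe_toPNat']⟩

theorem cycOn_apply [DecidableEq X] (σ : Perm X) (S : Finset X) (k : ℕ+) :
    cycOn σ S k = (S.filter fun x => minimalPeriod σ x = k).card / (k : ℕ) := by
  rw [cycOn, Finsupp.ofSupportFinite_coe]

theorem sameCycle_iterate (σ : Perm X) (x : X) (n : ℕ) : σ.SameCycle x (σ^[n] x) :=
  ⟨n, by rw [Perm.iterate_eq_pow, zpow_natCast]⟩

theorem injOn_iterate (σ : Perm X) (x : X) :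
    Set.InjOn (fun n => σ^[n] x) (Finset.range (minimalPeriod σ x)) := by
  rw [Finset.coe_range]
  exact iterate_injOn_Iio_minimalPeriod

theorem minimalPeriod_perm_pos [Finite X] (σ : Perm X) (x : X) : 0 < minimalPeriod σ x :=
  minimalPeriod_pos_of_mem_periodicPts
    (Function.Injective.mem_periodicPts σ.injective x)

theorem exists_iterate_of_sameCycle [Finite X] {σ : Perm X} {x y : X} (h : σ.SameCycle x y) :
    ∃ n < minimalPeriod σ x, σ^[n] x = y := by
  obtain ⟨n, -, hn⟩ := h.exists_pow_eq'
  refine ⟨n % minimalPeriod σ x, Nat.mod_lt _ (minimalPeriod_perm_pos σ x), ?_⟩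
  rw [iterate_mod_minimalPeriod_eq, Perm.iterate_eq_pow, hn]

theorem minimalPeriod_eq_of_sameCycle [Finite X] {σ : Perm X} {x y : X} (h : σ.SameCycle x y) :
    minimalPeriod σ y = minimalPeriod σ x := by
  obtain ⟨n, -, rfl⟩ := exists_iterate_of_sameCycle h
  exact minimalPeriod_apply_iterate
    (minimalPeriod_pos_iff_mem_periodicPts.mp (minimalPeriod_perm_pos σ x)) n

variable [DecidableEq X]

theorem cycOn_congr {σ τ : Perm X} {S : Finset X} (hS : ∀ x ∈ S, σ x ∈ S)
    (h : ∀ x ∈ S, σ x = τ x) : cycOn σ S = cycOn τ S := by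
  ext k
  rw [cycOn_apply, cycOn_apply]
  congr 2
  refine Finset.filter_congr fun x hx => ?_
  rw [minimalPeriod_congr_of_mapsTo (S := (S : Set X)) hS h hx]

/-- As long as the `σ`-orbit of `x` avoids `x` and `y`, the orbit under `swap x y * σ` is the
same. -/
theorem iterate_swap_mul {σ : Perm X} {x y : X} {k : ℕ} (hk : 0 < k)
    (h : ∀ t, 0 < t → t < k → σ^[t] x ≠ x ∧ σ^[t] x ≠ y) :
    (∀ t < k, (swap x y * σ)^[t] x = σ^[t] x) ∧ (swap x y * σ)^[k] x = swap x y (σ^[k] x) := by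
  have h1 : ∀ t < k, (swap x y * σ)^[t] x = σ^[t] x := by
    intro t
    induction t with
    | zero => intro _; rfl
    | succ t ih =>
      intro ht
      rw [iterate_succ_apply', ih (by omega), iterate_succ_apply', Perm.mul_apply,
        ← iterate_succ_apply' σ]
      exact swap_apply_of_ne_of_ne (h _ (by omega) ht).1 (h _ (by omega) ht).2
  refine ⟨h1, ?_⟩
  obtain ⟨t, rfl⟩ := Nat.exists_eq_succ_of_ne_zero hk.ne'
  rw [iterate_succ_apply', h1 t (by omega), iterate_succ_apply', Perm.mul_apply]

variable [Fintype X]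

/-- The cycle of `x`, listed by the iterates of the permutation. -/
theorem filter_sameCycle_eq (σ : Perm X) (x : X) :
    (Finset.univ.filter fun y => σ.SameCycle x y)
      = (Finset.range (minimalPeriod σ x)).image fun n => σ^[n] x := by
  ext y
  simp only [Finset.mem_filter, Finset.mem_univ, true_and, Finset.mem_image, Finset.mem_range]
  constructor
  · exact exists_iterate_of_sameCycle
  · rintro ⟨n, -, rfl⟩
    exact sameCycle_iterate σ x n

theorem card_filter_sameCycle (σ : Perm X) (x : X) :
    (Finset.univ.filter fun y => σ.SameCycle x y).card = minimalPeriod σ x := by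
  rw [filter_sameCycle_eq, Finset.card_image_of_injOn (injOn_iterate σ x), Finset.card_range]

theorem dvd_card_filter_minimalPeriod {σ : Perm X} {S : Finset X} (hS : ∀ x ∈ S, σ x ∈ S)
    (k : ℕ) : k ∣ (S.filter fun x => minimalPeriod σ x = k).card := by
  classical
  rw [Finset.card_eq_sum_card_image (Quotient.mk (Perm.SameCycle.setoid σ))]
  refine Finset.dvd_sum fun q hq => ?_
  obtain ⟨x, hx, rfl⟩ := Finset.mem_image.mp hq
  rw [Finset.mem_filter] at hx
  have : (Finset.filter (fun y => (Quotient.mk (Perm.SameCycle.setoid σ) y)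
      = Quotient.mk (Perm.SameCycle.setoid σ) x) (S.filter fun x => minimalPeriod σ x = k))
      = Finset.univ.filter fun y => σ.SameCycle x y := by
    ext y
    simp only [Finset.mem_filter, Finset.mem_univ, true_and]
    constructor
    · rintro ⟨-, h⟩
      exact (Quotient.exact h).symm
    · intro h
      refine ⟨⟨?_, (minimalPeriod_eq_of_sameCycle h).trans hx.2⟩, Quotient.sound h.symm⟩
      obtain ⟨n, -, rfl⟩ := exists_iterate_of_sameCycle h
      exact mapsTo_iterate (S := (S : Set X)) hS hx.1 n
  rw [this, card_filter_sameCycle, hx.2]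

theorem mul_cycOn {σ : Perm X} {S : Finset X} (hS : ∀ x ∈ S, σ x ∈ S) (k : ℕ+) :
    (k : ℕ) * cycOn σ S k = (S.filter fun x => minimalPeriod σ x = k).card := by
  rw [cycOn_apply]
  exact Nat.mul_div_cancel' (dvd_card_filter_minimalPeriod hS k)

theorem cycOn_union {σ : Perm X} {S T : Finset X} (hST : Disjoint S T) (hS : ∀ x ∈ S, σ x ∈ S)
    (hT : ∀ x ∈ T, σ x ∈ T) : cycOn σ (S ∪ T) = cycOn σ S + cycOn σ T := by
  ext k
  have hU : ∀ x ∈ S ∪ T, σ x ∈ S ∪ T := by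
    intro x hx
    rcases Finset.mem_union.mp hx with h | h
    · exact Finset.mem_union_left _ (hS x h)
    · exact Finset.mem_union_right _ (hT x h)
  refine Nat.eq_of_mul_eq_mul_left k.pos ?_
  rw [mul_cycOn hU, Finsupp.add_apply, mul_add, mul_cycOn hS, mul_cycOn hT, Finset.filter_union,
    Finset.card_union_of_disjoint (Finset.disjoint_filter_filter hST)]

/-- The weight `∑ k αₖ` of an exponent vector, the size of the partition it encodes. -/
def pweight : (ℕ+ →₀ ℕ) →+ ℕ := Finsupp.weight fun k : ℕ+ => (k : ℕ)

theorem pweight_apply (α : ℕ+ →₀ ℕ) : pweight α = α.sum fun k e => e * (k : ℕ) := rfl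

theorem pweight_single (k : ℕ+) (e : ℕ) : pweight (Finsupp.single k e) = e * k := by
  rw [pweight, Finsupp.weight_single, smul_eq_mul]

theorem pweight_cycOn {σ : Perm X} {S : Finset X} (hS : ∀ x ∈ S, σ x ∈ S) :
    pweight (cycOn σ S) = S.card := by
  rw [pweight_apply, Finsupp.sum]
  have h : ∀ x ∈ S, (minimalPeriod σ x).toPNat' ∈ (cycOn σ S).support := by
    intro x hx
    have hpos := minimalPeriod_perm_pos σ x
    have hk : (((minimalPeriod σ x).toPNat' : ℕ+) : ℕ) = minimalPeriod σ x :=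
      (Nat.toPNat'_coe _).trans (if_pos hpos)
    rw [Finsupp.mem_support_iff]
    intro h0
    have h1 := mul_cycOn hS (minimalPeriod σ x).toPNat'
    rw [h0, mul_zero, eq_comm, Finset.card_eq_zero, Finset.filter_eq_empty_iff] at h1
    exact h1 hx hk.symm
  rw [Finset.card_eq_sum_card_fiberwise h]
  refine Finset.sum_congr rfl fun k _ => ?_
  rw [mul_comm, mul_cycOn hS]
  congr 1
  refine Finset.filter_congr fun x _ => ?_
  have hpos := minimalPeriod_perm_pos σ x
  rw [← PNat.coe_inj, Nat.toPNat'_coe, if_pos hpos]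

/-- Multiplication by a transposition of two points of the same cycle cuts the cycle. -/
theorem cycOn_cut {σ : Perm X} {x : X} {i j : ℕ+} (hx : minimalPeriod σ x = i + j) :
    cycOn (swap x (σ^[i] x) * σ) Finset.univ + Finsupp.single (i + j) 1
      = cycOn σ Finset.univ + Finsupp.single i 1 + Finsupp.single j 1 := by
  set y := σ^[i] x with hy
  set τ := swap x y * σ with hτ
  have hi := i.pos
  have hj := j.pos
  have hxy : x ≠ y := by
    intro h
    exact not_isPeriodicPt_of_pos_of_lt_minimalPeriod (f := σ) (x := x) hi.ne' (by omega)
      (hy.symm.trans h.symm)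
  have hinj : ∀ a b, a < (i : ℕ) + j → b < (i : ℕ) + j → σ^[a] x = σ^[b] x → a = b := by
    intro a b ha hb hab
    rw [← hx] at ha hb
    exact (iterate_eq_iterate_iff_of_lt_minimalPeriod ha hb).mp hab
  have hyx : σ^[(j : ℕ)] y = x := by
    rw [hy, ← iterate_add_apply, add_comm, ← hx]
    exact iterate_minimalPeriod
  have hcx := iterate_swap_mul (σ := σ) (x := x) (y := y) hi fun t h1 h2 =>
    ⟨fun h => by have := hinj t 0 (by omega) (by omega) h; omega,
      fun h => by have := hinj t i (by omega) (by omega) h; omega⟩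
  have hcy := iterate_swap_mul (σ := σ) (x := y) (y := x) hj fun t h1 h2 => by
    rw [hy, ← iterate_add_apply, ← hy]
    exact ⟨fun h => by have := hinj (t + i) i (by omega) (by omega) h; omega,
      fun h => by have := hinj (t + i) 0 (by omega) (by omega) h; omega⟩
  rw [← hy, swap_apply_right, ← hτ] at hcx
  rw [hyx, swap_apply_right, swap_comm, ← hτ] at hcy
  have hpx : minimalPeriod τ x = i := minimalPeriod_eq_of_forall_lt hi hcx.2 fun t h1 h2 h => by
    rw [hcx.1 t h2] at h
    have := hinj t 0 (by omega) (by omega) h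
    omega
  have hpy : minimalPeriod τ y = j := minimalPeriod_eq_of_forall_lt hj hcy.2 fun t h1 h2 h => by
    rw [hcy.1 t h2, hy, ← iterate_add_apply] at h
    have := hinj (t + i) i (by omega) (by omega) h
    omega
  have hper1 : ∀ t < (i : ℕ), minimalPeriod τ (σ^[t] x) = i := by
    intro t ht
    rw [← hcx.1 t ht, minimalPeriod_eq_of_sameCycle (sameCycle_iterate τ x t), hpx]
  have hper2 : ∀ t < (j : ℕ), minimalPeriod τ (σ^[i + t] x) = j := by
    intro t ht
    rw [add_comm, iterate_add_apply, ← hy, ← hcy.1 t ht,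
      minimalPeriod_eq_of_sameCycle (sameCycle_iterate τ y t), hpy]
  have hout : ∀ z, ¬ σ.SameCycle x z → minimalPeriod τ z = minimalPeriod σ z := by
    intro z hz
    refine (minimalPeriod_congr_of_mapsTo (f := σ) (g := τ) (S := {z | ¬ σ.SameCycle x z})
      ?_ ?_ hz).symm
    · intro w hw h
      exact hw (Perm.sameCycle_apply_right.mp h)
    · intro w hw
      rw [hτ, Perm.mul_apply, swap_apply_of_ne_of_ne]
      · rintro h
        exact hw (Perm.sameCycle_apply_right.mp (by rw [h]))
      · rintro h
        exact hw (Perm.sameCycle_apply_right.mp (by rw [h]; exact sameCycle_iterate σ x i))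
  have hsplit : ∀ f : X → ℕ, ∑ z, f z
      = (∑ t ∈ Finset.range i, f (σ^[t] x) + ∑ t ∈ Finset.range j, f (σ^[i + t] x))
        + ∑ z ∈ Finset.univ.filter (fun z => ¬ σ.SameCycle x z), f z := by
    intro f
    rw [← Finset.sum_filter_add_sum_filter_not Finset.univ (fun z => σ.SameCycle x z),
      filter_sameCycle_eq, Finset.sum_image (injOn_iterate σ x), hx, Finset.sum_range_add]
  ext κ
  refine Nat.eq_of_mul_eq_mul_left κ.pos ?_
  have h1 : ∀ t ∈ Finset.range i, (if minimalPeriod τ (σ^[t] x) = κ then 1 else 0)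
      = if (i : ℕ) = κ then 1 else 0 := fun t ht => by rw [hper1 t (Finset.mem_range.mp ht)]
  have h2 : ∀ t ∈ Finset.range j, (if minimalPeriod τ (σ^[i + t] x) = κ then 1 else 0)
      = if (j : ℕ) = κ then 1 else 0 := fun t ht => by rw [hper2 t (Finset.mem_range.mp ht)]
  have h4 : ∀ z ∈ Finset.univ.filter (fun z => ¬ σ.SameCycle x z),
      (if minimalPeriod τ z = κ then 1 else 0) = if minimalPeriod σ z = κ then 1 else 0 :=
    fun z hz => by rw [hout z (Finset.mem_filter.mp hz).2]
  rw [Finsupp.add_apply, Finsupp.add_apply, Finsupp.add_apply, mul_add, mul_add, mul_add,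
    mul_cycOn (fun _ _ => Finset.mem_univ _), mul_cycOn (fun _ _ => Finset.mem_univ _),
    Finset.card_filter, Finset.card_filter, hsplit, hsplit,
    Finset.sum_congr rfl h1, Finset.sum_congr rfl h2, Finset.sum_congr rfl h4]
  have hσ : ∀ t, minimalPeriod σ (σ^[t] x) = ((i + j : ℕ+) : ℕ) := fun t => by
    rw [minimalPeriod_eq_of_sameCycle (sameCycle_iterate σ x t), hx, PNat.add_coe]
  simp only [hσ, Finset.sum_const, Finset.card_range, smul_eq_mul, Finsupp.single_apply,
    PNat.coe_inj]
  have h3 : ∀ a : ℕ+, ((κ : ℕ) * if a = κ then 1 else 0) = a * if a = κ then 1 else 0 := by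
    intro a
    split_ifs with h
    · rw [h]
    · simp
  rw [h3, h3, h3, PNat.add_coe]
  ring

/-- Multiplication by a transposition of points of different cycles joins the cycles. -/
theorem cycOn_join {σ : Perm X} {x y : X} {i j : ℕ+} (hx : minimalPeriod σ x = i)
    (hy : minimalPeriod σ y = j) (hxy : ¬ σ.SameCycle x y) :
    cycOn (swap x y * σ) Finset.univ + Finsupp.single i 1 + Finsupp.single j 1
      = cycOn σ Finset.univ + Finsupp.single (i + j) 1 := by
  set τ := swap x y * σ with hτ
  have hi := i.pos
  have hj := j.pos
  have hne : x ≠ y := fun h => hxy (by rw [h])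
  have hxt : ∀ t, 0 < t → t < (i : ℕ) → σ^[t] x ≠ x := fun t h1 h2 =>
    not_isPeriodicPt_of_pos_of_lt_minimalPeriod h1.ne' (by omega)
  have hyt : ∀ t, 0 < t → t < (j : ℕ) → σ^[t] y ≠ y := fun t h1 h2 =>
    not_isPeriodicPt_of_pos_of_lt_minimalPeriod h1.ne' (by omega)
  have hyx : ∀ t, σ^[t] y ≠ x := fun t h => hxy (by
    rw [← h]; exact (sameCycle_iterate σ y t).symm)
  have hcx := iterate_swap_mul (σ := σ) (x := x) (y := y) hi fun t h1 h2 =>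
    ⟨hxt t h1 h2, fun h => hxy (by rw [← h]; exact sameCycle_iterate σ x t)⟩
  have hcy := iterate_swap_mul (σ := σ) (x := y) (y := x) hj fun t h1 h2 =>
    ⟨hyt t h1 h2, hyx t⟩
  rw [← hτ, ← hx, iterate_minimalPeriod, swap_apply_left, hx] at hcx
  rw [swap_comm, ← hτ, ← hy, iterate_minimalPeriod, swap_comm, swap_apply_left, hy] at hcy
  have hpx : minimalPeriod τ x = i + j := by
    refine minimalPeriod_eq_of_forall_lt (by omega) ?_ fun t h1 h2 h => ?_
    · rw [add_comm, iterate_add_apply, hcx.2, hcy.2]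
    · rcases lt_or_ge t i with hti | hti
      · rw [hcx.1 t hti] at h
        exact hxt t h1 hti h
      · obtain ⟨s, rfl⟩ := Nat.exists_eq_add_of_le hti
        rw [add_comm, iterate_add_apply, hcx.2, hcy.1 s (by omega)] at h
        exact hyx s h
  have h := cycOn_cut hpx
  rw [hcx.2] at h
  have h2 : swap x y * τ = σ := by
    rw [hτ, ← mul_assoc, swap_mul_self, one_mul]
  rw [h2] at h
  exact h.symm

end Cycles

/-! ### Exponential generating functions of words -/

section Words

variable {Λ : Type*} {M : Type*} [AddCommMonoid M]

/-- The sum of `F` over all words of length `m` in the alphabet `E`. -/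
def wordSum (E : Finset Λ) (m : ℕ) (F : List Λ → M) : M :=
  ∑ w ∈ Fintype.piFinset fun _ : Fin m => E, F (List.ofFn w)

/-- The exponential generating function of a weight `F` of words in the alphabet `E`. -/
def egf (E : Finset Λ) (F : List Λ → ℚ) : PowerSeries ℚ :=
  PowerSeries.mk fun m => wordSum E m F / (m.factorial : ℚ)

theorem coeff_egf (E : Finset Λ) (F : List Λ → ℚ) (m : ℕ) :
    PowerSeries.coeff m (egf E F) = wordSum E m F / (m.factorial : ℚ) := by
  rw [egf, PowerSeries.coeff_mk]

theorem wordSum_zero (E : Finset Λ) (F : List Λ → M) : wordSum E 0 F = F [] := by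
  simp [wordSum]

theorem wordSum_succ (E : Finset Λ) (m : ℕ) (F : List Λ → M) :
    wordSum E (m + 1) F = ∑ a ∈ E, wordSum E m fun w => F (a :: w) := by
  simp only [wordSum]
  rw [← Finset.sum_product']
  refine Finset.sum_bij' (fun w _ => (w 0, Fin.tail w)) (fun p _ => Fin.cons p.1 p.2) ?_ ?_ ?_ ?_ ?_
  · intro w hw
    rw [Fintype.mem_piFinset] at hw
    rw [Finset.mem_product, Fintype.mem_piFinset]
    exact ⟨hw 0, fun i => hw i.succ⟩
  · intro p hp
    rw [Finset.mem_product, Fintype.mem_piFinset] at hp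
    rw [Fintype.mem_piFinset]
    intro i
    refine Fin.cases ?_ ?_ i
    · exact hp.1
    · exact hp.2
  · intro w _
    exact Fin.cons_self_tail w
  · intro p _
    simp
  · intro w _
    rw [List.ofFn_succ]
    rfl

theorem wordSum_congr {E : Finset Λ} {m : ℕ} {F G : List Λ → M}
    (h : ∀ w : List Λ, w.length = m → (∀ t ∈ w, t ∈ E) → F w = G w) :
    wordSum E m F = wordSum E m G := by
  refine Finset.sum_congr rfl fun w hw => h _ (List.length_ofFn) fun t ht => ?_
  obtain ⟨i, rfl⟩ := List.mem_ofFn.mp ht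
  exact Fintype.mem_piFinset.mp hw i

theorem egf_congr {E : Finset Λ} {F G : List Λ → ℚ}
    (h : ∀ w : List Λ, (∀ t ∈ w, t ∈ E) → F w = G w) : egf E F = egf E G := by
  ext m
  rw [coeff_egf, coeff_egf, wordSum_congr fun w _ => h w]

theorem egf_sum {ι : Type*} (s : Finset ι) (E : Finset Λ) (F : ι → List Λ → ℚ) :
    egf E (fun w => ∑ i ∈ s, F i w) = ∑ i ∈ s, egf E (F i) := by
  ext m
  simp only [map_sum, coeff_egf, wordSum]
  rw [Finset.sum_comm, Finset.sum_div]

theorem egf_of_subset {E E' : Finset Λ} (hE : E' ⊆ E) {F : List Λ → ℚ}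
    (h : ∀ w : List Λ, (∃ t ∈ w, t ∉ E') → F w = 0) : egf E F = egf E' F := by
  ext m
  rw [coeff_egf, coeff_egf]
  congr 1
  refine (Finset.sum_subset (Fintype.piFinset_subset _ _ fun _ => hE) ?_).symm
  intro w _ hw
  rw [Fintype.mem_piFinset, not_forall] at hw
  obtain ⟨i, hi⟩ := hw
  exact h _ ⟨w i, List.mem_ofFn.mpr ⟨i, rfl⟩, hi⟩

theorem egf_image {Λ' : Type*} [DecidableEq Λ'] {g : Λ → Λ'} (hg : Function.Injective g)
    (E : Finset Λ) (F : List Λ' → ℚ) : egf (E.image g) F = egf E fun w => F (w.map g) := by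
  ext m
  rw [coeff_egf, coeff_egf]
  congr 1
  induction m generalizing F with
  | zero => rw [wordSum_zero, wordSum_zero, List.map_nil]
  | succ m ih =>
    rw [wordSum_succ, wordSum_succ, Finset.sum_image (fun a _ b _ h => hg h)]
    exact Finset.sum_congr rfl fun a _ => ih _

theorem derivative_egf (E : Finset Λ) (F : List Λ → ℚ) :
    PowerSeries.derivative ℚ (egf E F) = ∑ a ∈ E, egf E fun w => F (a :: w) := by
  ext m
  rw [PowerSeries.coeff_derivative, coeff_egf, wordSum_succ, map_sum, Nat.factorial_succ]
  simp only [coeff_egf]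
  rw [← Finset.sum_div]
  push_cast
  have := Nat.cast_add_one_ne_zero (R := ℚ) m
  have := Nat.cast_ne_zero (R := ℚ).mpr m.factorial_ne_zero
  field_simp

/-- A word in an alphabet that is split into two parts is a shuffle of two words. -/
theorem egf_shuffle (E : Finset Λ) (p : Λ → Prop) [DecidablePred p] (F G : List Λ → ℚ) :
    egf E (fun w => F (w.filter p) * G (w.filter fun t => ¬ p t))
      = egf (E.filter p) F * egf (E.filter fun t => ¬ p t) G := by
  have key : ∀ m : ℕ, ∀ F G : List Λ → ℚ,
      PowerSeries.coeff m (egf E (fun w => F (w.filter p) * G (w.filter fun t => ¬ p t)))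
        = PowerSeries.coeff m (egf (E.filter p) F * egf (E.filter fun t => ¬ p t) G) := by
    intro m
    induction m with
    | zero =>
      intro F G
      rw [PowerSeries.coeff_mul]
      simp [coeff_egf, wordSum_zero]
    | succ m ih =>
      intro F G
      have hm := Nat.cast_add_one_ne_zero (R := ℚ) m
      refine mul_right_cancel₀ hm ?_
      rw [← PowerSeries.coeff_derivative, ← PowerSeries.coeff_derivative, derivative_egf,
        Derivation.leibniz, derivative_egf, derivative_egf, smul_eq_mul, smul_eq_mul,
        Finset.mul_sum, Finset.mul_sum, map_sum, map_add, map_sum, map_sum,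
        ← Finset.sum_filter_add_sum_filter_not E p, add_comm]
      congr 1
      · refine Finset.sum_congr rfl fun a ha => ?_
        have hp := (Finset.mem_filter.mp ha).2
        rw [← ih]
        simp [hp]
      · refine Finset.sum_congr rfl fun a ha => ?_
        have hp := (Finset.mem_filter.mp ha).2
        rw [mul_comm, ← ih]
        simp [hp]
  ext m
  exact key m F G

end Words

/-! ### Words of transpositions and their connected components -/

section Components

open Equiv

variable {X : Type*}

/-- All letters of the word `w` map `T` to itself. -/
def Stable (T : Finset X) (w : List (Perm X)) : Prop := ∀ t ∈ w, ∀ x ∈ T, t x ∈ T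

theorem stable_prod {T : Finset X} {w : List (Perm X)} (h : Stable T w) {x : X} (hx : x ∈ T) :
    w.prod x ∈ T := by
  induction w with
  | nil => simpa using hx
  | cons t w ih =>
    rw [List.prod_cons, Perm.mul_apply]
    exact h t List.mem_cons_self _ (ih fun s hs => h s (List.mem_cons_of_mem _ hs))

/-- The letters of the word `w` act transitively on `S`: no smaller nonempty set is stable. -/
def Conn (S : Finset X) (w : List (Perm X)) : Prop :=
  ∀ T ⊆ S, T.Nonempty → Stable T w → T = S

/-- Letters that fix `T` pointwise may be dropped. -/
theorem prod_filter_apply {T : Finset X} {w : List (Perm X)} (p : Perm X → Prop)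
    [DecidablePred p] (h : Stable T w) (hp : ∀ t ∈ w, ¬ p t → ∀ x ∈ T, t x = x) {x : X}
    (hx : x ∈ T) : w.prod x = (w.filter p).prod x := by
  induction w with
  | nil => rfl
  | cons t w ih =>
    have hst : Stable T w := fun s hs => h s (List.mem_cons_of_mem _ hs)
    have ih' := ih hst fun s hs => hp s (List.mem_cons_of_mem _ hs)
    rw [List.filter_cons, List.prod_cons, Perm.mul_apply]
    split_ifs with hpt
    · rw [List.prod_cons, Perm.mul_apply, ih']
    · rw [hp t List.mem_cons_self (by simpa using hpt) _ (stable_prod hst hx), ih']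

theorem stable_map {Y : Type*} (f : Y ↪ X) (T : Finset Y) (w : List (Perm Y)) :
    Stable (T.map f) (w.map (Perm.viaEmbeddingHom f)) ↔ Stable T w := by
  constructor
  · intro h t ht y hy
    have := h _ (List.mem_map_of_mem ht) _ (Finset.mem_map_of_mem f hy)
    rw [Perm.viaEmbeddingHom_apply, Perm.viaEmbedding_apply] at this
    simpa using this
  · intro h t ht x hx
    obtain ⟨s, hs, rfl⟩ := List.mem_map.mp ht
    obtain ⟨y, hy, rfl⟩ := Finset.mem_map.mp hx
    rw [Perm.viaEmbeddingHom_apply, Perm.viaEmbedding_apply]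
    exact Finset.mem_map_of_mem f (h s hs y hy)

theorem conn_map {Y : Type*} (f : Y ↪ X) (S : Finset Y) (w : List (Perm Y)) :
    Conn (S.map f) (w.map (Perm.viaEmbeddingHom f)) ↔ Conn S w := by
  constructor
  · intro h T hT hne hst
    exact Finset.map_injective f
      (h (T.map f) (Finset.map_subset_map.mpr hT) (hne.map) ((stable_map f T w).mpr hst))
  · intro h T hT hne hst
    obtain ⟨T, hTS, rfl⟩ := Finset.subset_map_iff.mp hT
    rw [h T hTS (by simpa using hne) ((stable_map f T w).mp hst)]

theorem exists_map_fin_eq (S : Finset X) :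
    ∃ f : Fin S.card ↪ X, (Finset.univ : Finset (Fin S.card)).map f = S := by
  refine ⟨S.equivFin.symm.toEmbedding.trans (Function.Embedding.subtype _), ?_⟩
  rw [← Finset.map_map, Finset.map_univ_equiv, Finset.univ_eq_attach, Finset.attach_map_val]

variable [DecidableEq X]

/-- The transpositions of two points of `S`. -/
def swapsIn (S : Finset X) : Finset (Perm X) := by
  classical
  exact S.offDiag.image fun p => swap p.1 p.2

theorem mem_swapsIn {S : Finset X} {t : Perm X} :
    t ∈ swapsIn S ↔ ∃ x ∈ S, ∃ y ∈ S, x ≠ y ∧ t = swap x y := by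
  classical
  simp only [swapsIn, Finset.mem_image, Finset.mem_offDiag, Prod.exists]
  constructor
  · rintro ⟨x, y, ⟨hx, hy, hxy⟩, rfl⟩
    exact ⟨x, hx, y, hy, hxy, rfl⟩
  · rintro ⟨x, hx, y, hy, hxy, rfl⟩
    exact ⟨x, y, ⟨hx, hy, hxy⟩, rfl⟩

theorem swapsIn_mono {S T : Finset X} (h : T ⊆ S) : swapsIn T ⊆ swapsIn S := by
  intro t ht
  obtain ⟨x, hx, y, hy, hxy, rfl⟩ := mem_swapsIn.mp ht
  exact mem_swapsIn.mpr ⟨x, h hx, y, h hy, hxy, rfl⟩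

theorem apply_mem_of_mem_swapsIn {S : Finset X} {t : Perm X} (ht : t ∈ swapsIn S) {x : X}
    (hx : x ∈ S) : t x ∈ S := by
  obtain ⟨a, ha, b, hb, -, rfl⟩ := mem_swapsIn.mp ht
  rw [swap_apply_def]
  split_ifs
  exacts [hb, ha, hx]

theorem apply_eq_of_mem_swapsIn {S : Finset X} {t : Perm X} (ht : t ∈ swapsIn S) {x : X}
    (hx : x ∉ S) : t x = x := by
  obtain ⟨a, ha, b, hb, -, rfl⟩ := mem_swapsIn.mp ht
  exact swap_apply_of_ne_of_ne (fun h => hx (h ▸ ha)) (fun h => hx (h ▸ hb))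

theorem disjoint_swapsIn {S T : Finset X} (h : Disjoint S T) {t : Perm X} (hS : t ∈ swapsIn S) :
    t ∉ swapsIn T := by
  intro hT
  obtain ⟨x, hx, y, hy, hxy, rfl⟩ := mem_swapsIn.mp hS
  have := apply_eq_of_mem_swapsIn hT (Finset.disjoint_left.mp h hx)
  rw [swap_apply_left] at this
  exact hxy this.symm

/-- A transposition that stabilizes `T` is one of two points of `T` or of two points outside. -/
theorem mem_swapsIn_of_stable {S T : Finset X} {t : Perm X} (ht : t ∈ swapsIn S)
    (h : ∀ x ∈ T, t x ∈ T) : t ∈ swapsIn T ∨ t ∈ swapsIn (S \ T) := by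
  obtain ⟨x, hx, y, hy, hxy, rfl⟩ := mem_swapsIn.mp ht
  rw [mem_swapsIn, mem_swapsIn]
  by_cases hxT : x ∈ T
  · left
    exact ⟨x, hxT, y, by simpa using h x hxT, hxy, rfl⟩
  · right
    have hyT : y ∉ T := fun hyT => hxT (by simpa using h y hyT)
    exact ⟨x, Finset.mem_sdiff.mpr ⟨hx, hxT⟩, y, Finset.mem_sdiff.mpr ⟨hy, hyT⟩, hxy, rfl⟩

/-- Every point lies in exactly one connected component. -/
theorem existsUnique_component {S : Finset X} {w : List (Perm X)} (hw : Stable S w) {x : X}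
    (hx : x ∈ S) : ∃! T, T ⊆ S ∧ x ∈ T ∧ Stable T w ∧ Conn T w := by
  classical
  have hinter : ∀ T T' : Finset X, Stable T w → Stable T' w → Stable (T ∩ T') w := by
    intro T T' h h' t ht y hy
    rw [Finset.mem_inter] at hy ⊢
    exact ⟨h t ht y hy.1, h' t ht y hy.2⟩
  -- the component is the smallest stable set that contains `x`
  obtain ⟨T, hT, hmin⟩ := (S.powerset.filter fun T => x ∈ T ∧ Stable T w).exists_min_image
    Finset.card ⟨S, by simp [hx, hw]⟩
  rw [Finset.mem_filter, Finset.mem_powerset] at hT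
  obtain ⟨hTS, hxT, hst⟩ := hT
  have hmin' : ∀ T' ⊆ T, x ∈ T' → Stable T' w → T' = T := by
    intro T' h1 h2 h3
    refine Finset.eq_of_subset_of_card_le h1 (hmin T' ?_)
    rw [Finset.mem_filter, Finset.mem_powerset]
    exact ⟨h1.trans hTS, h2, h3⟩
  have hconn : Conn T w := by
    intro T' h1 h2 h3
    by_cases hxT' : x ∈ T'
    · exact hmin' T' h1 hxT' h3
    · exfalso
      have hsd : Stable (T \ T') w := by
        intro t ht y hy
        rw [Finset.mem_sdiff] at hy ⊢
        refine ⟨hst t ht y hy.1, fun hty => hy.2 ?_⟩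
        have himg : T'.image t = T' := by
          refine Finset.eq_of_subset_of_card_le ?_ ?_
          · intro z hz
            obtain ⟨u, hu, rfl⟩ := Finset.mem_image.mp hz
            exact h3 t ht u hu
          · rw [Finset.card_image_of_injective _ t.injective]
        rw [← himg] at hty
        obtain ⟨u, hu, hut⟩ := Finset.mem_image.mp hty
        rwa [← t.injective hut]
      have h4 := hmin' _ Finset.sdiff_subset (Finset.mem_sdiff.mpr ⟨hxT, hxT'⟩) hsd
      obtain ⟨z, hz⟩ := h2
      have h5 : z ∈ T \ T' := by rw [h4]; exact h1 hz
      exact (Finset.mem_sdiff.mp h5).2 hz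
  refine ⟨T, ⟨hTS, hxT, hst, hconn⟩, ?_⟩
  rintro T' ⟨-, h2, h3, h4⟩
  have e1 := hconn (T ∩ T') Finset.inter_subset_left ⟨x, Finset.mem_inter.mpr ⟨hxT, h2⟩⟩
    (hinter _ _ hst h3)
  have e2 := h4 (T ∩ T') Finset.inter_subset_right ⟨x, Finset.mem_inter.mpr ⟨hxT, h2⟩⟩
    (hinter _ _ hst h3)
  exact e2.symm.trans e1

/-- Generating function of the words of transpositions of points of `S` whose product has cycle
type `α`. -/
def discSeries (α : ℕ+ →₀ ℕ) (S : Finset X) : PowerSeries ℚ := by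
  classical
  exact egf (swapsIn S) fun w => if cycOn w.prod S = α then 1 else 0

/-- Generating function of the words of transpositions that act transitively on `S` and whose
product has cycle type `α`. -/
def connSeries (α : ℕ+ →₀ ℕ) (S : Finset X) : PowerSeries ℚ := by
  classical
  exact egf (swapsIn S) fun w => if cycOn w.prod S = α ∧ Conn S w then 1 else 0

section Transport

variable {Y : Type*} [DecidableEq Y] (f : Y ↪ X)

theorem viaEmbedding_swap (x y : Y) :
    Perm.viaEmbeddingHom f (swap x y) = swap (f x) (f y) := by
  ext z
  rw [Perm.viaEmbeddingHom_apply]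
  by_cases hz : z ∈ Set.range f
  · obtain ⟨u, rfl⟩ := hz
    rw [Perm.viaEmbedding_apply, f.injective.swap_apply]
  · rw [Perm.viaEmbedding_apply_of_notMem _ _ _ hz, swap_apply_of_ne_of_ne]
    · rintro rfl
      exact hz ⟨x, rfl⟩
    · rintro rfl
      exact hz ⟨y, rfl⟩

theorem swapsIn_map [DecidableEq (Perm X)] (S : Finset Y) :
    swapsIn (S.map f) = (swapsIn S).image (Perm.viaEmbeddingHom f) := by
  ext t
  rw [mem_swapsIn, Finset.mem_image]
  constructor
  · rintro ⟨_, hx', _, hy', hxy, rfl⟩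
    obtain ⟨x, hx, rfl⟩ := Finset.mem_map.mp hx'
    obtain ⟨y, hy, rfl⟩ := Finset.mem_map.mp hy'
    exact ⟨swap x y, mem_swapsIn.mpr ⟨x, hx, y, hy, fun h => hxy (by rw [h]), rfl⟩,
      viaEmbedding_swap f x y⟩
  · rintro ⟨s, hs, rfl⟩
    obtain ⟨x, hx, y, hy, hxy, rfl⟩ := mem_swapsIn.mp hs
    exact ⟨f x, Finset.mem_map_of_mem _ hx, f y, Finset.mem_map_of_mem _ hy,
      f.injective.ne hxy, viaEmbedding_swap f x y⟩

theorem cycOn_map (σ : Perm Y) (S : Finset Y) :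
    cycOn (Perm.viaEmbeddingHom f σ) (S.map f) = cycOn σ S := by
  have hper : ∀ y, Function.minimalPeriod (Perm.viaEmbeddingHom f σ) (f y)
      = Function.minimalPeriod σ y := by
    intro y
    rw [Function.minimalPeriod_eq_minimalPeriod_iff]
    intro n
    have : Function.Semiconj f σ (Perm.viaEmbeddingHom f σ) := fun z =>
      (Perm.viaEmbedding_apply _ _ z).symm
    rw [Function.IsPeriodicPt, Function.IsPeriodicPt, Function.IsFixedPt, Function.IsFixedPt,
      ← (this.iterate_right n).eq, f.injective.eq_iff]
  ext k
  rw [cycOn_apply, cycOn_apply, Finset.filter_map, Finset.card_map]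
  congr 2
  refine Finset.filter_congr fun y _ => ?_
  rw [Function.comp_apply, hper]

theorem discSeries_map (α : ℕ+ →₀ ℕ) (S : Finset Y) :
    discSeries α (S.map f) = discSeries α S := by
  classical
  rw [discSeries, discSeries, swapsIn_map, egf_image (Perm.viaEmbeddingHom_injective f)]
  refine egf_congr fun w _ => ?_
  rw [← map_list_prod, cycOn_map]

theorem connSeries_map (α : ℕ+ →₀ ℕ) (S : Finset Y) :
    connSeries α (S.map f) = connSeries α S := by
  classical
  rw [connSeries, connSeries, swapsIn_map, egf_image (Perm.viaEmbeddingHom_injective f)]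
  refine egf_congr fun w _ => ?_
  rw [← map_list_prod, cycOn_map, conn_map]

end Transport

/-- The generating functions depend only on the number of points. -/
theorem discSeries_eq_fin (α : ℕ+ →₀ ℕ) (S : Finset X) :
    discSeries α S = discSeries α (Finset.univ : Finset (Fin S.card)) := by
  obtain ⟨f, hf⟩ := exists_map_fin_eq S
  rw [← discSeries_map f, hf]

theorem connSeries_eq_fin (α : ℕ+ →₀ ℕ) (S : Finset X) :
    connSeries α S = connSeries α (Finset.univ : Finset (Fin S.card)) := by
  obtain ⟨f, hf⟩ := exists_map_fin_eq S
  rw [← connSeries_map f, hf]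

variable [Fintype X]

open Classical in
/-- The words for which `T` is a connected component are shuffles of transitive words on `T` and
arbitrary words on the complement. -/
theorem egf_component {S T : Finset X} (hT : T ⊆ S) (α : ℕ+ →₀ ℕ) :
    (egf (swapsIn S) fun w => if cycOn w.prod S = α ∧ Stable T w ∧ Conn T w then (1 : ℚ) else 0)
      = ∑ p ∈ Finset.HasAntidiagonal.antidiagonal α,
          connSeries p.1 T * discSeries p.2 (S \ T) := by
  classical
  have hdisj : Disjoint T (S \ T) := Finset.disjoint_sdiff
  have hsub : swapsIn T ∪ swapsIn (S \ T) ⊆ swapsIn S :=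
    Finset.union_subset (swapsIn_mono hT) (swapsIn_mono Finset.sdiff_subset)
  set E := (swapsIn S).filter fun t => t ∈ swapsIn T ∪ swapsIn (S \ T) with hE
  have hE' : E = swapsIn T ∪ swapsIn (S \ T) := by
    ext t
    rw [hE, Finset.mem_filter]
    exact ⟨fun h => h.2, fun h => ⟨hsub h, h⟩⟩
  set p : Perm X → Prop := fun t => t ∈ swapsIn T with hp
  have hE1 : E.filter p = swapsIn T := by
    ext t
    rw [hE', Finset.mem_filter, Finset.mem_union, hp]
    exact ⟨fun h => h.2, fun h => ⟨Or.inl h, h⟩⟩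
  have hE2 : (E.filter fun t => ¬ p t) = swapsIn (S \ T) := by
    ext t
    rw [hE', Finset.mem_filter, Finset.mem_union, hp]
    exact ⟨fun h => h.1.resolve_left h.2, fun h => ⟨Or.inr h, disjoint_swapsIn hdisj.symm h⟩⟩
  have h1 : (egf (swapsIn S) fun w =>
      if cycOn w.prod S = α ∧ Stable T w ∧ Conn T w then (1 : ℚ) else 0)
      = egf (swapsIn S) fun w => if (∀ t ∈ w, t ∈ E) then
        (if cycOn w.prod S = α ∧ Conn T w then (1 : ℚ) else 0) else 0 := by
    refine egf_congr fun w hw => ?_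
    by_cases hst : Stable T w
    · have : ∀ t ∈ w, t ∈ E := fun t ht => by
        rw [hE', Finset.mem_union]
        exact mem_swapsIn_of_stable (hw t ht) (hst t ht)
      simp [hst, if_pos this]
    · have : ¬ ∀ t ∈ w, t ∈ E := fun h => hst fun t ht x hx => by
        have := h t ht
        rw [hE', Finset.mem_union] at this
        rcases this with h2 | h2
        · exact apply_mem_of_mem_swapsIn h2 hx
        · rwa [apply_eq_of_mem_swapsIn h2 (Finset.disjoint_left.mp hdisj hx)]
      simp [hst, if_neg this]
  rw [h1, egf_of_subset (E' := E) (hE' ▸ hsub)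
    (fun w hw => if_neg (by push Not; exact hw))]
  simp only [connSeries, discSeries]
  conv_rhs =>
    enter [2, q]
    rw [← hE1, ← hE2, ← egf_shuffle E p]
  rw [← egf_sum]
  refine egf_congr fun w hw => ?_
  rw [if_pos hw]
  have hcase : ∀ t ∈ w, t ∈ swapsIn T ∨ t ∈ swapsIn (S \ T) := fun t ht => by
    have := hw t ht
    rwa [hE', Finset.mem_union] at this
  have hfixT : ∀ t ∈ w, ¬ p t → ∀ x ∈ T, t x = x := fun t ht hpt x hx =>
    apply_eq_of_mem_swapsIn ((hcase t ht).resolve_left hpt) (Finset.disjoint_left.mp hdisj hx)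
  have hfixS : ∀ t ∈ w, ¬ ¬ p t → ∀ x ∈ S \ T, t x = x := fun t ht hpt x hx =>
    apply_eq_of_mem_swapsIn (not_not.mp hpt) (Finset.disjoint_right.mp hdisj hx)
  have hstT : Stable T w := fun t ht x hx => by
    by_cases hpt : p t
    · exact apply_mem_of_mem_swapsIn hpt hx
    · rwa [hfixT t ht hpt x hx]
  have hstS : Stable (S \ T) w := fun t ht x hx => by
    by_cases hpt : p t
    · rwa [hfixS t ht (not_not.mpr hpt) x hx]
    · exact apply_mem_of_mem_swapsIn ((hcase t ht).resolve_left hpt) hx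
  have hcyc : cycOn w.prod S
      = cycOn (w.filter p).prod T + cycOn (w.filter fun t => ¬ p t).prod (S \ T) := by
    rw [← cycOn_congr (fun x hx => stable_prod hstT hx)
        (fun x hx => prod_filter_apply p hstT hfixT hx),
      ← cycOn_congr (fun x hx => stable_prod hstS hx)
        (fun x hx => prod_filter_apply (fun t => ¬ p t) hstS hfixS hx),
      ← cycOn_union hdisj (fun x hx => stable_prod hstT hx) (fun x hx => stable_prod hstS hx),
      Finset.union_sdiff_of_subset hT]
  have hconn : Conn T w ↔ Conn T (w.filter p) := by
    have : ∀ T' ⊆ T, (Stable T' w ↔ Stable T' (w.filter p)) := by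
      intro T' hT'
      constructor
      · intro h t ht
        exact h t (List.mem_of_mem_filter ht)
      · intro h t ht x hx
        by_cases hpt : p t
        · exact h t (List.mem_filter.mpr ⟨ht, by simpa using hpt⟩) x hx
        · rwa [hfixT t ht hpt x (hT' hx)]
    constructor
    · intro h T' h1 h2 h3
      exact h T' h1 h2 ((this T' h1).mpr h3)
    · intro h T' h1 h2 h3
      exact h T' h1 h2 ((this T' h1).mp h3)
  rw [hcyc, hconn]
  set a := cycOn (w.filter p).prod T
  set b := cycOn (w.filter fun t => ¬ p t).prod (S \ T)
  by_cases hab : a + b = α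
  · rw [Finset.sum_eq_single (a, b)]
    · simp [hab]
    · intro q _ hq
      by_cases hq1 : a = q.1
      · have hq2 : b ≠ q.2 := fun h => hq (by rw [hq1, h])
        simp [hq2]
      · simp [hq1]
    · intro h
      exact absurd (Finset.HasAntidiagonal.mem_antidiagonal.mpr hab) h
  · rw [if_neg (fun h => hab h.1), Finset.sum_eq_zero]
    intro q hq
    have hq' := Finset.HasAntidiagonal.mem_antidiagonal.mp hq
    by_cases hq1 : a = q.1
    · have hq2 : b ≠ q.2 := fun h => hab (by rw [hq1, h, hq'])
      simp [hq2]
    · simp [hq1]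

/-- Splitting a word into the component of a marked point and the rest. -/
theorem card_smul_discSeries (α : ℕ+ →₀ ℕ) (S : Finset X) :
    S.card • discSeries α S = ∑ T ∈ S.powerset, T.card •
      ∑ p ∈ Finset.HasAntidiagonal.antidiagonal α,
        connSeries p.1 T * discSeries p.2 (S \ T) := by
  classical
  have h1 : ∀ x ∈ S, discSeries α S = ∑ T ∈ S.powerset, if x ∈ T then
      ∑ p ∈ Finset.HasAntidiagonal.antidiagonal α,
        connSeries p.1 T * discSeries p.2 (S \ T) else 0 := by
    intro x hx
    have h2 : discSeries α S = ∑ T ∈ S.powerset, egf (swapsIn S) fun w => if x ∈ T then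
        (if cycOn w.prod S = α ∧ Stable T w ∧ Conn T w then 1 else 0) else 0 := by
      rw [← egf_sum, discSeries]
      refine egf_congr fun w hw => ?_
      obtain ⟨T, ⟨hTS, hxT, hst, hc⟩, huniq⟩ := existsUnique_component (w := w)
        (fun t ht y hy => apply_mem_of_mem_swapsIn (hw t ht) hy) hx
      rw [Finset.sum_eq_single T]
      · simp [hxT, hst, hc]
      · intro T' hT' hne
        split_ifs with h3 h4
        · exact absurd (huniq T' ⟨Finset.mem_powerset.mp hT', h3, h4.2⟩) hne
        · rfl
        · rfl
      · intro h
        exact absurd (Finset.mem_powerset.mpr hTS) h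
    rw [h2]
    refine Finset.sum_congr rfl fun T hT => ?_
    split_ifs with hxT
    · exact egf_component (Finset.mem_powerset.mp hT) α
    · ext m
      rw [coeff_egf, wordSum]
      simp
  rw [← Finset.sum_const, Finset.sum_congr rfl h1, Finset.sum_comm]
  refine Finset.sum_congr rfl fun T hT => ?_
  rw [← Finset.sum_filter, Finset.sum_const]
  congr 2
  ext x
  rw [Finset.mem_filter]
  exact ⟨fun h => h.2, fun h => ⟨Finset.mem_powerset.mp hT h, h⟩⟩

end Components

/-! ### The Riemann-Hurwitz formula -/

section RiemannHurwitz

open Equiv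

variable {X : Type*}

/-- The functions that are invariant under all letters of a word, that is, constant on its
connected components. -/
def invariantFunctions (w : List (Perm X)) : Submodule ℚ (X → ℚ) where
  carrier := {f | ∀ t ∈ w, ∀ x, f (t x) = f x}
  add_mem' := fun hf hg t ht x => by
    rw [Pi.add_apply, Pi.add_apply, hf t ht, hg t ht]
  zero_mem' := fun _ _ _ => rfl
  smul_mem' := fun c f hf t ht x => by
    rw [Pi.smul_apply, Pi.smul_apply, hf t ht]

theorem mem_invariantFunctions {w : List (Perm X)} {f : X → ℚ} :
    f ∈ invariantFunctions w ↔ ∀ t ∈ w, ∀ x, f (t x) = f x := Iff.rfl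

theorem invariantFunctions_prod {w : List (Perm X)} {f : X → ℚ} (hf : f ∈ invariantFunctions w)
    (x : X) : f (w.prod x) = f x := by
  induction w with
  | nil => rfl
  | cons t w ih =>
    rw [List.prod_cons, Perm.mul_apply, hf t List.mem_cons_self]
    exact ih fun s hs => hf s (List.mem_cons_of_mem _ hs)

variable [DecidableEq X]

theorem mem_invariantFunctions_cons {x y : X} {w : List (Perm X)} {f : X → ℚ} :
    f ∈ invariantFunctions (swap x y :: w) ↔ f ∈ invariantFunctions w ∧ f x = f y := by
  rw [mem_invariantFunctions, List.forall_mem_cons, and_comm, ← mem_invariantFunctions]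
  refine and_congr_right fun _ => ⟨fun h => ?_, fun h z => ?_⟩
  · simpa using (h x).symm
  · rw [swap_apply_def]
    split_ifs with h1 h2
    · rw [h1, h]
    · rw [h2, h]
    · rfl

variable [Fintype X]

theorem cycOn_one (S : Finset X) : cycOn (1 : Perm X) S = Finsupp.single 1 S.card := by
  ext k
  refine Nat.eq_of_mul_eq_mul_left k.pos ?_
  rw [mul_cycOn (fun x hx => hx)]
  have h : ∀ x, Function.minimalPeriod (1 : Perm X) x = 1 := fun x => Function.minimalPeriod_id
  simp only [h, Finsupp.single_apply]
  by_cases hk : 1 = k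
  · subst hk
    simp
  · rw [if_neg hk, mul_zero, Finset.card_eq_zero, Finset.filter_eq_empty_iff]
    intro x _ h1
    exact hk (PNat.coe_inj.mp (by simpa using h1))

/-- A letter imposes a single linear condition, so it lowers the dimension by at most one. -/
theorem finrank_invariantFunctions_cons (x y : X) (w : List (Perm X)) :
    Module.finrank ℚ (invariantFunctions (swap x y :: w))
        ≤ Module.finrank ℚ (invariantFunctions w) ∧
      Module.finrank ℚ (invariantFunctions w)
        ≤ Module.finrank ℚ (invariantFunctions (swap x y :: w)) + 1 := by
  set φ : (X → ℚ) →ₗ[ℚ] ℚ := LinearMap.proj (R := ℚ) (φ := fun _ : X => ℚ) x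
    - LinearMap.proj (R := ℚ) (φ := fun _ : X => ℚ) y with hφ
  have h : invariantFunctions (swap x y :: w) = invariantFunctions w ⊓ LinearMap.ker φ := by
    ext f
    rw [mem_invariantFunctions_cons, Submodule.mem_inf, LinearMap.mem_ker, hφ]
    simp [sub_eq_zero]
  constructor
  · rw [h]
    exact Submodule.finrank_mono inf_le_left
  · have h1 := Submodule.finrank_sup_add_finrank_inf_eq (invariantFunctions w) (LinearMap.ker φ)
    have h2 := LinearMap.finrank_range_add_finrank_ker φ
    have h3 := Submodule.finrank_le (LinearMap.range φ)
    have h4 := Submodule.finrank_le (invariantFunctions w ⊔ LinearMap.ker φ)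
    rw [Module.finrank_self] at h3
    rw [h]
    omega

/-- Multiplying by a letter changes the number of cycles by one. A letter that joins two components
also joins two cycles. The number `j` counts the letters that join two cycles within one
component; it is the genus when the word is transitive. -/
theorem length_add_finrank {w : List (Perm X)} (hw : ∀ t ∈ w, t.IsSwap) :
    ∃ j, w.length + 2 * Module.finrank ℚ (invariantFunctions w)
      = Fintype.card X + (cycOn w.prod Finset.univ).degree + 2 * j := by
  induction w with
  | nil =>
    refine ⟨0, ?_⟩
    have h : invariantFunctions ([] : List (Perm X)) = ⊤ := by
      ext f
      simp [mem_invariantFunctions]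
    rw [h, finrank_top, Module.finrank_fintype_fun_eq_card, List.prod_nil, cycOn_one,
      Finsupp.degree_single, Finset.card_univ, List.length_nil]
    ring
  | cons t w ih =>
    obtain ⟨j, hj⟩ := ih fun s hs => hw s (List.mem_cons_of_mem _ hs)
    obtain ⟨x, y, hxy, rfl⟩ := hw t List.mem_cons_self
    obtain ⟨h1, h2⟩ := finrank_invariantFunctions_cons x y w
    rw [List.prod_cons, List.length_cons]
    by_cases hc : w.prod.SameCycle x y
    · obtain ⟨k, hk, hky⟩ := exists_iterate_of_sameCycle hc
      have hk0 : 0 < k := by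
        rcases Nat.eq_zero_or_pos k with rfl | h
        · exact absurd hky hxy
        · exact h
      obtain ⟨i, hi⟩ : ∃ i : ℕ+, (i : ℕ) = k := ⟨⟨k, hk0⟩, rfl⟩
      obtain ⟨l, hl⟩ : ∃ l : ℕ+, (l : ℕ) = Function.minimalPeriod w.prod x - k :=
        ⟨⟨_, Nat.sub_pos_of_lt hk⟩, rfl⟩
      have hcut := cycOn_cut (σ := w.prod) (x := x) (i := i) (j := l) (by omega)
      rw [hi, hky] at hcut
      have hdeg := congrArg Finsupp.degree hcut
      simp only [map_add, Finsupp.degree_single] at hdeg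
      have hV : invariantFunctions (swap x y :: w) = invariantFunctions w := by
        -- an invariant function is constant on the cycles, hence already agrees at `x` and `y`
        ext f
        rw [mem_invariantFunctions_cons]
        refine ⟨fun h => h.1, fun h => ⟨h, ?_⟩⟩
        rw [← hky]
        clear hky hk hcut hk0 hi hl
        induction k with
        | zero => rfl
        | succ k ih => rw [Function.iterate_succ_apply', invariantFunctions_prod h, ih]
      rw [hV]
      exact ⟨j, by omega⟩
    · obtain ⟨i, hi⟩ : ∃ i : ℕ+, (i : ℕ) = Function.minimalPeriod w.prod x :=
        ⟨⟨_, minimalPeriod_perm_pos w.prod x⟩, rfl⟩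
      obtain ⟨l, hl⟩ : ∃ l : ℕ+, (l : ℕ) = Function.minimalPeriod w.prod y :=
        ⟨⟨_, minimalPeriod_perm_pos w.prod y⟩, rfl⟩
      have hjoin := cycOn_join hi.symm hl.symm hc
      have hdeg := congrArg Finsupp.degree hjoin
      simp only [map_add, Finsupp.degree_single] at hdeg
      rcases Nat.lt_or_ge (Module.finrank ℚ (invariantFunctions (swap x y :: w)))
        (Module.finrank ℚ (invariantFunctions w)) with h3 | h3
      · exact ⟨j, by omega⟩
      · exact ⟨j + 1, by omega⟩

/-- The Riemann-Hurwitz formula for transitive words: the genus is a natural number. -/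
theorem exists_genus [Nonempty X] {w : List (Perm X)} (hw : ∀ t ∈ w, t.IsSwap)
    (hc : Conn Finset.univ w) :
    ∃ g, w.length + 2 = 2 * g + (cycOn w.prod Finset.univ).degree + Fintype.card X := by
  obtain ⟨j, hj⟩ := length_add_finrank hw
  have h : invariantFunctions w = ℚ ∙ (fun _ => 1 : X → ℚ) := by
    ext f
    rw [Submodule.mem_span_singleton]
    constructor
    · intro hf
      obtain ⟨x⟩ := ‹Nonempty X›
      refine ⟨f x, ?_⟩
      have := hc (Finset.univ.filter fun z => f z = f x) (Finset.subset_univ _)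
        ⟨x, by simp⟩ fun t ht z hz => by
          rw [Finset.mem_filter] at hz ⊢
          exact ⟨Finset.mem_univ _, (hf t ht z).trans hz.2⟩
      ext z
      have hz := Finset.mem_univ z
      rw [← this, Finset.mem_filter] at hz
      simp [hz.2]
    · rintro ⟨a, rfl⟩ t _ x
      rfl
  have hne : (fun _ => 1 : X → ℚ) ≠ 0 := by
    obtain ⟨x⟩ := ‹Nonempty X›
    intro h0
    exact one_ne_zero (congrFun h0 x)
  rw [h, finrank_span_singleton hne] at hj
  exact ⟨j, by omega⟩

end RiemannHurwitz

/-! ### Hurwitz numbers as numbers of transitive words -/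

section Hurwitz

open Equiv

/-- The multiplicities of the marked points. -/
theorem monomialOf_eq_cycOn {X : Type*} [Fintype X] [DecidableEq X] {n : ℕ} {σ : Perm X}
    {mark : X → Fin n} (hmark : ∀ x y, mark x = mark y ↔ σ.SameCycle x y) {b : Fin n → ℕ+}
    (hb : ∀ i, (Finset.univ.filter fun x => mark x = i).card = (b i : ℕ)) :
    monomialOf b = cycOn σ Finset.univ := by
  ext k
  refine Nat.eq_of_mul_eq_mul_left k.pos ?_
  rw [mul_cycOn (fun _ _ => Finset.mem_univ _), monomialOf, Finsupp.finsetSum_apply,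
    Finset.mul_sum, Finset.card_eq_sum_card_fiberwise (f := mark) (t := Finset.univ)
      (fun _ _ => Finset.mem_coe.mpr (Finset.mem_univ _))]
  refine Finset.sum_congr rfl fun i _ => ?_
  have hper : ∀ x, mark x = i → Function.minimalPeriod σ x = b i := by
    intro x hx
    rw [← card_filter_sameCycle, ← hb i]
    congr 1
    refine Finset.filter_congr fun y _ => ?_
    rw [← hmark, hx, eq_comm]
  rw [Finsupp.single_apply, Finset.filter_filter]
  split_ifs with h
  · rw [mul_one, ← h, ← hb i]
    congr 1
    refine Finset.filter_congr fun x _ => ?_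
    rw [hb i]
    exact ⟨fun hx => ⟨hper x hx, hx⟩, fun hx => hx.2⟩
  · rw [mul_zero, eq_comm, Finset.card_eq_zero, Finset.filter_eq_empty_iff]
    rintro x _ ⟨h1, h2⟩
    exact h (PNat.coe_inj.mp ((hper x h2).symm.trans h1))

theorem degree_monomialOf {n : ℕ} (b : Fin n → ℕ+) : (monomialOf b).degree = n := by
  simp [monomialOf, map_sum]

theorem pweight_monomialOf {n : ℕ} (b : Fin n → ℕ+) :
    pweight (monomialOf b) = ∑ i, (b i : ℕ) := by
  simp [monomialOf, map_sum, pweight_single]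

theorem card_quotient_sameCycle {X : Type*} [Fintype X] [DecidableEq X] (σ : Perm X) :
    Nat.card (Quotient (Perm.SameCycle.setoid σ)) = (cycOn σ Finset.univ).degree := by
  classical
  set e := Finite.equivFin (Quotient (Perm.SameCycle.setoid σ))
  set mark : X → Fin _ := fun x => e (Quotient.mk _ x)
  have hmark : ∀ x y, mark x = mark y ↔ σ.SameCycle x y := fun x y => by
    rw [e.injective.eq_iff]
    exact Quotient.eq
  have hpos : ∀ i, ∃ b : ℕ+, (Finset.univ.filter fun x => mark x = i).card = (b : ℕ) := fun i => by
    obtain ⟨x, hx⟩ := Quotient.exists_rep (e.symm i)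
    refine ⟨⟨_, Finset.card_pos.mpr ⟨x, Finset.mem_filter.mpr ⟨Finset.mem_univ _, ?_⟩⟩⟩, rfl⟩
    exact (congrArg e hx).trans (e.apply_symm_apply i)
  choose b hb using hpos
  rw [← monomialOf_eq_cycOn hmark hb, degree_monomialOf]

open Classical in
/-- The number of ways to mark the cycles of a permutation. -/
theorem card_markings {X : Type*} [Fintype X] [DecidableEq X] {n : ℕ} {σ : Perm X}
    (hn : (cycOn σ Finset.univ).degree = n) {s : Finset (X → Fin n)}
    (hs : ∀ mark, mark ∈ s ↔
      (∀ x y, mark x = mark y ↔ σ.SameCycle x y) ∧ Function.Surjective mark) :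
    s.card = n.factorial := by
  rw [← card_quotient_sameCycle] at hn
  have e0 : Quotient (Perm.SameCycle.setoid σ) ≃ Fin n :=
    (Finite.equivFin _).trans (finCongr hn)
  rw [← Nat.card_eq_finsetCard, Nat.card_congr (Equiv.subtypeEquivRight hs)]
  have e : {mark : X → Fin n //
      (∀ x y, mark x = mark y ↔ σ.SameCycle x y) ∧ Function.Surjective mark}
      ≃ (Quotient (Perm.SameCycle.setoid σ) ≃ Fin n) :=
    { toFun := fun f => Equiv.ofBijective
        (Quotient.lift f.1 fun x y h => (f.2.1 x y).mpr h) (by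
          constructor
          · intro p q
            refine Quotient.inductionOn₂ p q fun x y h => ?_
            exact Quotient.sound ((f.2.1 x y).mp h)
          · intro i
            obtain ⟨x, hx⟩ := f.2.2 i
            exact ⟨Quotient.mk _ x, hx⟩)
      invFun := fun e => ⟨fun x => e (Quotient.mk _ x), fun x y => by
          rw [e.injective.eq_iff]
          exact Quotient.eq, e.surjective.comp Quotient.mk_surjective⟩
      left_inv := fun f => rfl
      right_inv := fun e => by
        ext q
        refine Quotient.inductionOn q fun x => rfl }
  rw [Nat.card_congr e, Nat.card_eq_fintype_card, Fintype.card_equiv e0, Fintype.card_congr e0,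
    Fintype.card_fin]

theorem isSwap_iff_mem_swapsIn {X : Type*} [Fintype X] [DecidableEq X] {t : Perm X} :
    t.IsSwap ↔ t ∈ swapsIn Finset.univ := by
  rw [mem_swapsIn]
  simp [Perm.IsSwap]

/-- The connectedness of a covering in terms of the monodromy around the finite critical values. -/
theorem connected_iff_conn {X : Type*} [Fintype X] [DecidableEq X] {m : ℕ} {σ : Perm X}
    {w : Fin m → Perm X} (hw : ∀ i, (w i).IsSwap) (hσ : (List.ofFn w).prod * σ = 1) :
    (∀ x y, ∃ g ∈ Subgroup.closure (insert σ (Set.range w)), g x = y)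
      ↔ Conn Finset.univ (List.ofFn w) := by
  classical
  constructor
  · rintro h T - ⟨x, hx⟩ hst
    have h1 : ∀ i z, w i z ∈ T ↔ z ∈ T := by
      intro i z
      have h2 : ∀ z ∈ T, w i z ∈ T := hst _ (List.mem_ofFn.mpr ⟨i, rfl⟩)
      refine ⟨fun hz => ?_, h2 z⟩
      obtain ⟨a, b, -, hab⟩ := hw i
      have := h2 _ hz
      rwa [hab, swap_apply_self] at this
    have h2 : ∀ l : List (Perm X), (∀ t ∈ l, ∀ z, t z ∈ T ↔ z ∈ T) →
        ∀ z, l.prod z ∈ T ↔ z ∈ T := by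
      intro l
      induction l with
      | nil => intro _ z; rfl
      | cons t l ih =>
        intro hl z
        rw [List.prod_cons, Perm.mul_apply, hl t List.mem_cons_self,
          ih fun s hs => hl s (List.mem_cons_of_mem _ hs)]
    have h3 : ∀ g ∈ Subgroup.closure (insert σ (Set.range w)), ∀ z, g z ∈ T ↔ z ∈ T := by
      intro g hg
      induction hg using Subgroup.closure_induction with
      | mem g hg =>
        rcases hg with rfl | ⟨i, rfl⟩
        · intro z
          rw [← h2 (List.ofFn w) (fun t ht => by
            obtain ⟨i, rfl⟩ := List.mem_ofFn.mp ht
            exact h1 i), ← Perm.mul_apply, hσ, Perm.one_apply]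
        · exact h1 i
      | one => intro z; rfl
      | mul a b _ _ ha hb => intro z; rw [Perm.mul_apply, ha, hb]
      | inv a _ ha =>
        intro z
        rw [← ha, ← Perm.mul_apply, mul_inv_cancel, Perm.one_apply]
    refine Finset.eq_univ_of_forall fun y => ?_
    obtain ⟨g, hg, rfl⟩ := h x y
    exact (h3 g hg x).mpr hx
  · intro h x y
    have := h (Finset.univ.filter fun y =>
        ∃ g ∈ Subgroup.closure (insert σ (Set.range w)), g x = y)
      (Finset.subset_univ _) ⟨x, Finset.mem_filter.mpr
        ⟨Finset.mem_univ _, 1, Subgroup.one_mem _, rfl⟩⟩ (by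
        intro t ht z hz
        obtain ⟨i, rfl⟩ := List.mem_ofFn.mp ht
        rw [Finset.mem_filter] at hz ⊢
        obtain ⟨-, g, hg, rfl⟩ := hz
        exact ⟨Finset.mem_univ _, w i * g, Subgroup.mul_mem _
          (Subgroup.subset_closure (Set.mem_insert_of_mem _ ⟨i, rfl⟩)) hg, rfl⟩)
    have hy := Finset.mem_univ y
    rw [← this, Finset.mem_filter] at hy
    exact hy.2

open Classical in
/-- The transitive words of length `m` with cycle type `α`. -/
def transitiveWords (d m : ℕ) (α : ℕ+ →₀ ℕ) : Finset (Fin m → Perm (Fin d)) :=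
  (Fintype.piFinset fun _ : Fin m => swapsIn Finset.univ).filter fun w =>
    cycOn (List.ofFn w).prod Finset.univ = α ∧ Conn Finset.univ (List.ofFn w)

theorem coeff_connSeries (d m : ℕ) (α : ℕ+ →₀ ℕ) :
    PowerSeries.coeff m (connSeries α (Finset.univ : Finset (Fin d)))
      = ((transitiveWords d m α).card : ℚ) / (m.factorial : ℚ) := by
  classical
  rw [connSeries, coeff_egf, wordSum, transitiveWords, Finset.card_filter]
  push_cast
  rfl

open Classical in
/-- Transitive words together with a marking of the cycles of the product by cycles of lengths
`b`. -/
def markedWords {n : ℕ} (d m : ℕ) (b : Fin n → ℕ+) :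
    Finset ((Fin m → Perm (Fin d)) × (Fin d → Fin n)) :=
  Finset.univ.filter fun p => p.1 ∈ transitiveWords d m (monomialOf b) ∧
    (∀ x y, p.2 x = p.2 y ↔ (List.ofFn p.1).prod.SameCycle x y) ∧
    ∀ i, (Finset.univ.filter fun x => p.2 x = i).card = (b i : ℕ)

theorem card_markedCovering {n : ℕ} {d : ℕ} (m : ℕ) (b : Fin n → ℕ+) (hd : ∑ i, (b i : ℕ) = d) :
    Nat.card (MarkedCovering m b) = (markedWords d m b).card := by
  classical
  subst hd
  have hword : ∀ c : MarkedCovering m b, ∀ x y,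
      c.mark x = c.mark y ↔ (List.ofFn c.atCrit).prod.SameCycle x y := by
    intro c x y
    rw [c.mark_eq_iff, eq_inv_of_mul_eq_one_right c.prod_eq_one, Perm.sameCycle_inv]
  rw [← Nat.card_eq_finsetCard]
  refine Nat.card_congr (Equiv.ofBijective (fun c => ⟨(c.atCrit, c.mark), ?_⟩) ⟨?_, ?_⟩)
  · rw [markedWords, transitiveWords, Finset.mem_filter, Finset.mem_filter, Fintype.mem_piFinset]
    exact ⟨Finset.mem_univ _, ⟨fun i => isSwap_iff_mem_swapsIn.mp (c.isSwap_atCrit i),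
      (monomialOf_eq_cycOn (hword c) (fun i => by rw [← c.card_mark i])).symm,
      (connected_iff_conn c.isSwap_atCrit c.prod_eq_one).mp c.connected⟩, hword c,
      fun i => by rw [← c.card_mark i]⟩
  · intro c c' h
    have h1 := congrArg (fun p => p.1.1) h
    have h2 := congrArg (fun p => p.1.2) h
    simp only at h1 h2
    refine MarkedCovering.ext ?_ h1 h2
    rw [eq_inv_of_mul_eq_one_right c.prod_eq_one, eq_inv_of_mul_eq_one_right c'.prod_eq_one, h1]
  · rintro ⟨⟨w, mark⟩, hw⟩
    rw [markedWords, transitiveWords, Finset.mem_filter, Finset.mem_filter,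
      Fintype.mem_piFinset] at hw
    obtain ⟨-, ⟨h1, h2, h3⟩, h4, h5⟩ := hw
    have hs : ∀ i, (w i).IsSwap := fun i => isSwap_iff_mem_swapsIn.mpr (h1 i)
    exact ⟨{ atInfty := (List.ofFn w).prod⁻¹
             atCrit := w
             mark := mark
             isSwap_atCrit := hs
             prod_eq_one := mul_inv_cancel _
             connected := (connected_iff_conn hs (mul_inv_cancel _)).mpr h3
             mark_eq_iff := fun x y => by rw [Perm.sameCycle_inv]; exact h4 x y
             card_mark := fun i => by rw [← h5 i] }, rfl⟩

/-- Every transitive word of cycle type `α` has as many markings as the cycles have numberings. -/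
theorem sum_card_markedWords (d m : ℕ) (α : ℕ+ →₀ ℕ) :
    ∑ b ∈ (Fintype.piFinset fun _ : Fin α.degree => α.support).filter (fun b => monomialOf b = α),
        (markedWords d m b).card
      = α.degree.factorial * (transitiveWords d m α).card := by
  classical
  set P : Finset ((Fin m → Perm (Fin d)) × (Fin d → Fin α.degree)) :=
    Finset.univ.filter fun p => p.1 ∈ transitiveWords d m α ∧
      (∀ x y, p.2 x = p.2 y ↔ (List.ofFn p.1).prod.SameCycle x y) ∧ Function.Surjective p.2
    with hP
  have h1 : P.card = α.degree.factorial * (transitiveWords d m α).card := by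
    rw [Finset.card_eq_sum_card_fiberwise (f := Prod.fst) (t := transitiveWords d m α)
      (fun p hp => (Finset.mem_filter.mp hp).2.1), mul_comm, ← smul_eq_mul, ← Finset.sum_const]
    refine Finset.sum_congr rfl fun w hw => ?_
    have hα : (cycOn (List.ofFn w).prod Finset.univ).degree = α.degree := by
      rw [transitiveWords, Finset.mem_filter] at hw
      rw [hw.2.1]
    rw [← card_markings hα (s := Finset.univ.filter fun f =>
      (∀ x y, f x = f y ↔ (List.ofFn w).prod.SameCycle x y) ∧ Function.Surjective f)
      (fun f => by rw [Finset.mem_filter, and_iff_right (Finset.mem_univ f)])]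
    refine Finset.card_bij' (fun p _ => p.2) (fun f _ => (w, f)) ?_ ?_ ?_ ?_
    · intro p hp
      rw [Finset.mem_filter, hP, Finset.mem_filter] at hp
      rw [Finset.mem_filter, ← hp.2]
      exact ⟨Finset.mem_univ _, hp.1.2.2⟩
    · intro f hf
      rw [Finset.mem_filter] at hf
      rw [Finset.mem_filter, hP, Finset.mem_filter]
      exact ⟨⟨Finset.mem_univ _, hw, hf.2⟩, rfl⟩
    · intro p hp
      rw [Finset.mem_filter] at hp
      rw [← hp.2]
    · intro f _
      rfl
  rw [← h1]
  set fib : (Fin d → Fin α.degree) → Fin α.degree → ℕ+ := fun mark i =>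
    (Finset.univ.filter fun x => mark x = i).card.toPNat' with hfib
  have hfibpos : ∀ mark : Fin d → Fin α.degree, Function.Surjective mark → ∀ i,
      (Finset.univ.filter fun x => mark x = i).card = (fib mark i : ℕ) := by
    intro mark hs i
    obtain ⟨x, hx⟩ := hs i
    rw [hfib, Nat.toPNat'_coe, if_pos (Finset.card_pos.mpr ⟨x, by simp [hx]⟩)]
  have hmono : ∀ p ∈ P, monomialOf (fib p.2) = α := by
    intro p hp
    rw [hP, Finset.mem_filter, transitiveWords, Finset.mem_filter] at hp
    rw [monomialOf_eq_cycOn hp.2.2.1 (hfibpos _ hp.2.2.2), hp.2.1.2.1]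
  have hmem : ∀ b : Fin α.degree → ℕ+, monomialOf b = α →
      b ∈ (Fintype.piFinset fun _ : Fin α.degree => α.support).filter
        (fun b => monomialOf b = α) := by
    intro b hb
    rw [Finset.mem_filter, Fintype.mem_piFinset]
    refine ⟨fun i => ?_, hb⟩
    rw [← hb, Finsupp.mem_support_iff, monomialOf, Finsupp.finsetSum_apply]
    intro h0
    have := Finset.sum_eq_zero_iff.mp h0 i (Finset.mem_univ _)
    simp at this
  have hmaps : Set.MapsTo (fun p : (Fin m → Perm (Fin d)) × (Fin d → Fin α.degree) => fib p.2) P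
      ((Fintype.piFinset fun _ : Fin α.degree => α.support).filter
        (fun b => monomialOf b = α) : Finset (Fin α.degree → ℕ+)) := by
    intro p hp
    rw [Finset.mem_coe] at hp ⊢
    exact hmem _ (hmono p hp)
  rw [Finset.card_eq_sum_card_fiberwise hmaps]
  refine Finset.sum_congr rfl fun b hb => ?_
  have hb' := (Finset.mem_filter.mp hb).2
  congr 1
  ext p
  rw [markedWords, Finset.mem_filter, Finset.mem_filter, hP, Finset.mem_filter, hb']
  constructor
  · rintro ⟨-, h1, h2, h3⟩
    refine ⟨⟨Finset.mem_univ _, h1, h2, fun i => ?_⟩, ?_⟩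
    · obtain ⟨x, hx⟩ := Finset.card_pos.mp (lt_of_lt_of_eq (b i).pos (h3 i).symm)
      exact ⟨x, (Finset.mem_filter.mp hx).2⟩
    · funext i
      change (Finset.univ.filter fun x => p.2 x = i).card.toPNat' = b i
      rw [h3 i, PNat.coe_toPNat']
  · rintro ⟨⟨-, h1, h2, h3⟩, rfl⟩
    exact ⟨Finset.mem_univ _, h1, h2, hfibpos _ h3⟩

/-- The class formula for the action of the relabellings. -/
theorem hurwitzNumber_eq {n : ℕ} (g : ℕ) (b : Fin n → ℕ+) :
    hurwitzNumber g b = (Nat.card (MarkedCovering (numCrit g b) b) : ℚ)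
      / ((∑ i, (b i : ℕ)).factorial : ℚ) := by
  classical
  have : Fintype (MarkedCovering (numCrit g b) b) := Fintype.ofFinite _
  rw [hurwitzNumber, finsum_eq_sum_of_fintype, Nat.card_eq_fintype_card,
    MulAction.card_eq_sum_card_group_div_card_stabilizer (Perm (Fin (∑ i, (b i : ℕ)))),
    Nat.cast_sum,
    Finset.sum_div]
  refine Finset.sum_congr rfl fun ω _ => ?_
  rw [← Nat.card_eq_fintype_card, ← Nat.card_eq_fintype_card,
    Nat.cast_div (Subgroup.card_subgroup_dvd_card _)
      (Nat.cast_ne_zero.mpr Nat.card_pos.ne'), Nat.card_eq_fintype_card (α := Perm (Fin _)),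
    Fintype.card_perm, Fintype.card_fin]
  have := Nat.cast_ne_zero (R := ℚ).mpr (∑ i, (b i : ℕ)).factorial_ne_zero
  field_simp

theorem transitiveWords_eq_empty {d m : ℕ} {α : ℕ+ →₀ ℕ} (hd : 0 < d)
    (h : ∀ g, m + 2 ≠ 2 * g + α.degree + d) : transitiveWords d m α = ∅ := by
  classical
  rw [Finset.eq_empty_iff_forall_notMem]
  intro w hw
  rw [transitiveWords, Finset.mem_filter, Fintype.mem_piFinset] at hw
  have : Nonempty (Fin d) := ⟨⟨0, hd⟩⟩
  obtain ⟨g, hg⟩ := exists_genus (fun t ht => by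
    obtain ⟨i, rfl⟩ := List.mem_ofFn.mp ht
    exact isSwap_iff_mem_swapsIn.mpr (hw.1 i)) hw.2.2
  rw [List.length_ofFn, hw.2.1, Fintype.card_fin] at hg
  exact h g hg

/-- The generating series of the Hurwitz numbers counts transitive words. -/
theorem coeff_hurwitzSeries {α : ℕ+ →₀ ℕ} (hα : α ≠ 0) :
    MvPowerSeries.coeff α hurwitzSeries
      = (1 / ((pweight α).factorial : ℚ)) •
        connSeries α (Finset.univ : Finset (Fin (pweight α))) := by
  classical
  ext m
  set d := pweight α with hd
  have hn : 0 < α.degree := by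
    rw [Nat.pos_iff_ne_zero, Ne, Finsupp.degree_eq_zero_iff]
    exact hα
  change PowerSeries.coeff m (if α = 0 then 0 else _) = _
  rw [if_neg hα, PowerSeries.coeff_mk, PowerSeries.coeff_smul, coeff_connSeries]
  have hdpos : 0 < d := by
    rw [Nat.pos_iff_ne_zero]
    intro h0
    refine hα ?_
    ext k
    have := Finsupp.le_weight (fun k : ℕ+ => (k : ℕ)) k.pos.ne' α
    change α k ≤ pweight α at this
    rw [Finsupp.coe_zero, Pi.zero_apply]
    omega
  have hb : ∀ b ∈ (Fintype.piFinset fun _ : Fin α.degree => α.support).filter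
      (fun b => monomialOf b = α),
      ∑ g ∈ (Finset.range (m + 1)).filter (fun g => numCrit g b = m),
        hurwitzNumber g b / (m.factorial : ℚ)
      = ((markedWords d m b).card : ℚ) / (d.factorial : ℚ) / (m.factorial : ℚ) := by
    intro b hb
    have hbα := (Finset.mem_filter.mp hb).2
    have hbd : ∑ i, (b i : ℕ) = d :=
      (pweight_monomialOf b).symm.trans (by rw [hbα])
    have h1 : ∀ g ∈ (Finset.range (m + 1)).filter (fun g => numCrit g b = m),
        hurwitzNumber g b / (m.factorial : ℚ)
          = ((markedWords d m b).card : ℚ) / (d.factorial : ℚ) / (m.factorial : ℚ) := by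
      intro g hg
      rw [hurwitzNumber_eq, (Finset.mem_filter.mp hg).2, card_markedCovering m b hbd, hbd]
    rw [Finset.sum_congr rfl h1, Finset.sum_const]
    by_cases hg : ∃ g, m + 2 = 2 * g + α.degree + d
    · obtain ⟨g, hg⟩ := hg
      have : (Finset.range (m + 1)).filter (fun g => numCrit g b = m) = {g} := by
        ext g'
        rw [Finset.mem_filter, Finset.mem_singleton, numCrit, hbd, Finset.mem_range]
        omega
      rw [this, Finset.card_singleton, one_smul]
    · rw [markedWords, hbα, transitiveWords_eq_empty hdpos (fun g h => hg ⟨g, h⟩)]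
      simp
  rw [Finset.sum_congr rfl hb, ← Finset.sum_div, ← Finset.sum_div, ← Nat.cast_sum,
    sum_card_markedWords, smul_eq_mul]
  push_cast
  have h1 := Nat.cast_ne_zero (R := ℚ).mpr α.degree.factorial_ne_zero
  have h2 := Nat.cast_ne_zero (R := ℚ).mpr d.factorial_ne_zero
  have h3 := Nat.cast_ne_zero (R := ℚ).mpr m.factorial_ne_zero
  field_simp

end Hurwitz

/-! ### The cut-and-join operator on power series -/

section CutJoin

open Equiv

theorem cutJoinTerm_add (f g : MvPowerSeries ℕ+ ℚ) (i j : ℕ+) :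
    cutJoinTerm (f + g) i j = cutJoinTerm f i j + cutJoinTerm g i j := by
  simp only [cutJoinTerm, map_add, mul_add, smul_add]
  abel

theorem cutJoinTerm_smul (c : ℚ) (f : MvPowerSeries ℕ+ ℚ) (i j : ℕ+) :
    cutJoinTerm (c • f) i j = c • cutJoinTerm f i j := by
  simp only [cutJoinTerm, Derivation.map_smul, mul_smul_comm, smul_add, smul_comm c]

theorem coeff_cutJoin (f : MvPowerSeries ℕ+ ℚ) (α : ℕ+ →₀ ℕ) :
    MvPowerSeries.coeff α (cutJoin f)
      = (1 / 2 : ℚ) * ∑ᶠ ij : ℕ+ × ℕ+, MvPowerSeries.coeff α (cutJoinTerm f ij.1 ij.2) := rfl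

/-- The cut-and-join operator as a linear map. -/
def cutJoinLin : MvPowerSeries ℕ+ ℚ →ₗ[ℚ] MvPowerSeries ℕ+ ℚ where
  toFun := cutJoin
  map_add' f g := by
    ext α
    rw [map_add, coeff_cutJoin, coeff_cutJoin, coeff_cutJoin, ← mul_add,
      ← finsum_add_distrib (cutJoinTerm_finite f α) (cutJoinTerm_finite g α)]
    simp only [cutJoinTerm_add, map_add]
  map_smul' c f := by
    ext α
    rw [RingHom.id_apply, map_smul, coeff_cutJoin, coeff_cutJoin, smul_eq_mul, mul_left_comm,
      ← smul_eq_mul c, smul_finsum]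
    simp only [cutJoinTerm_smul, map_smul]

theorem cutJoinLin_apply (f : MvPowerSeries ℕ+ ℚ) : cutJoinLin f = cutJoin f := rfl

theorem cutJoinLin_pow_apply (m : ℕ) (f : MvPowerSeries ℕ+ ℚ) :
    (cutJoinLin ^ m) f = cutJoin^[m] f := by
  rw [Module.End.pow_apply]
  rfl

/-- The operator is a finite sum on series in finitely many variables. -/
theorem cutJoin_eq_sum {f : MvPowerSeries ℕ+ ℚ} {N : ℕ+}
    (hf : ∀ k, N < k → MvPowerSeries.pderiv ℚ k f = 0) :
    cutJoin f = (1 / 2 : ℚ) • ∑ ij ∈ Finset.Iic N ×ˢ Finset.Iic N, cutJoinTerm f ij.1 ij.2 := by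
  ext α
  rw [coeff_cutJoin, map_smul, map_sum, smul_eq_mul, finsum_eq_sum_of_support_subset]
  rintro ⟨i, j⟩ hij
  by_contra hout
  refine hij ?_
  rw [Finset.mem_coe, Finset.mem_product, Finset.mem_Iic, Finset.mem_Iic, not_and_or, not_le,
    not_le] at hout
  have h1 : MvPowerSeries.pderiv ℚ (i + j) f = 0 := hf _ <| by
    rcases hout with h | h
    · exact h.trans (PNat.lt_add_right i j)
    · exact h.trans (PNat.lt_add_left j i)
  have h2 : MvPowerSeries.pderiv ℚ i (MvPowerSeries.pderiv ℚ j f) = 0 := by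
    rcases hout with h | h
    · have : MvPowerSeries.pderiv ℚ i (MvPowerSeries.pderiv ℚ j f)
          = MvPowerSeries.pderiv ℚ j (MvPowerSeries.pderiv ℚ i f) := by
        ext β
        simp only [MvPowerSeries.coeff_pderiv, Finsupp.add_apply, Finsupp.single_apply]
        rw [add_right_comm β]
        by_cases hij : i = j
        · subst hij
          rfl
        · rw [if_neg hij, if_neg (Ne.symm hij)]
          ring_nf
      rw [this, hf i h, map_zero]
    · rw [hf j h, map_zero]
  change MvPowerSeries.coeff α (cutJoinTerm f i j) = 0
  rw [cutJoinTerm, h1, h2]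
  simp

/-- The part of weight `d` of a power series. -/
def weightPart (d : ℤ) : MvPowerSeries ℕ+ ℚ →ₗ[ℚ] MvPowerSeries ℕ+ ℚ where
  toFun f α := if (pweight α : ℤ) = d then MvPowerSeries.coeff α f else 0
  map_add' f g := by
    ext α
    change (if (pweight α : ℤ) = d then MvPowerSeries.coeff α (f + g) else 0)
      = (if (pweight α : ℤ) = d then MvPowerSeries.coeff α f else 0)
        + (if (pweight α : ℤ) = d then MvPowerSeries.coeff α g else 0)
    split_ifs <;> simp
  map_smul' c f := by
    ext α
    change (if (pweight α : ℤ) = d then MvPowerSeries.coeff α (c • f) else 0)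
      = c * (if (pweight α : ℤ) = d then MvPowerSeries.coeff α f else 0)
    split_ifs <;> simp

theorem coeff_weightPart (d : ℤ) (f : MvPowerSeries ℕ+ ℚ) (α : ℕ+ →₀ ℕ) :
    MvPowerSeries.coeff α (weightPart d f)
      = if (pweight α : ℤ) = d then MvPowerSeries.coeff α f else 0 := rfl

theorem coeff_X_mul_of_eq_zero {R : Type*} [CommRing R] {k : ℕ+} {α : ℕ+ →₀ ℕ} (h : α k = 0)
    (g : MvPowerSeries ℕ+ R) : MvPowerSeries.coeff α (MvPowerSeries.X k * g) = 0 :=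
  MvPowerSeries.X_dvd_iff.mp (dvd_mul_right _ g) α h

theorem weightPart_X_mul (d : ℤ) (k : ℕ+) (g : MvPowerSeries ℕ+ ℚ) :
    weightPart d (MvPowerSeries.X k * g) = MvPowerSeries.X k * weightPart (d - k) g := by
  ext α
  rw [coeff_weightPart]
  by_cases h : α k = 0
  · rw [coeff_X_mul_of_eq_zero h, coeff_X_mul_of_eq_zero h, ite_self]
  · have hα : α = Finsupp.single k 1 + (α - Finsupp.single k 1) := by
      rw [add_tsub_cancel_of_le]
      rw [Finsupp.single_le_iff]
      omega
    rw [hα]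
    generalize α - Finsupp.single k 1 = β
    rw [MvPowerSeries.X, MvPowerSeries.coeff_add_monomial_mul,
      MvPowerSeries.coeff_add_monomial_mul, coeff_weightPart, map_add, pweight_single]
    simp only [one_mul]
    push_cast
    refine if_congr ?_ rfl rfl
    constructor <;> intro h <;> omega

theorem weightPart_pderiv (d : ℤ) (k : ℕ+) (g : MvPowerSeries ℕ+ ℚ) :
    weightPart d (MvPowerSeries.pderiv ℚ k g)
      = MvPowerSeries.pderiv ℚ k (weightPart (d + k) g) := by
  ext α
  rw [coeff_weightPart, MvPowerSeries.coeff_pderiv, MvPowerSeries.coeff_pderiv, coeff_weightPart,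
    ite_mul, zero_mul, map_add, pweight_single]
  push_cast
  refine if_congr ?_ rfl rfl
  constructor <;> intro h <;> omega

theorem weightPart_cutJoinTerm (d : ℤ) (f : MvPowerSeries ℕ+ ℚ) (i j : ℕ+) :
    weightPart d (cutJoinTerm f i j) = cutJoinTerm (weightPart d f) i j := by
  simp only [cutJoinTerm, map_add, map_smul, mul_assoc, weightPart_X_mul, weightPart_pderiv,
    PNat.add_coe, Nat.cast_add]
  rw [show d - ((i : ℕ) : ℤ) - ((j : ℕ) : ℤ) + (((i : ℕ) : ℤ) + ((j : ℕ) : ℤ)) = d by ring,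
    show d - (((i : ℕ) : ℤ) + ((j : ℕ) : ℤ)) + ((i : ℕ) : ℤ) + ((j : ℕ) : ℤ) = d by ring]

theorem weightPart_cutJoin (d : ℤ) (f : MvPowerSeries ℕ+ ℚ) :
    weightPart d (cutJoin f) = cutJoin (weightPart d f) := by
  ext α
  rw [coeff_weightPart, coeff_cutJoin, coeff_cutJoin]
  simp only [← weightPart_cutJoinTerm, coeff_weightPart]
  split_ifs <;> simp

theorem weightPart_cutJoin_iterate (d : ℤ) (m : ℕ) (f : MvPowerSeries ℕ+ ℚ) :
    weightPart d (cutJoin^[m] f) = cutJoin^[m] (weightPart d f) := by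
  induction m with
  | zero => rfl
  | succ m ih =>
    rw [Function.iterate_succ_apply', Function.iterate_succ_apply', weightPart_cutJoin, ih]

theorem pderiv_monomial_add (μ : ℕ+ →₀ ℕ) (k : ℕ+) :
    MvPowerSeries.pderiv ℚ k (MvPowerSeries.monomial (μ + Finsupp.single k 1) (1 : ℚ))
      = ((μ k : ℚ) + 1) • MvPowerSeries.monomial μ (1 : ℚ) := by
  rw [← MvPolynomial.coe_monomial, MvPowerSeries.pderiv_coe, MvPolynomial.pderiv_monomial,
    add_tsub_cancel_right, MvPolynomial.coe_monomial, ← map_smul]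
  congr 1
  simp

theorem pderiv_monomial_of_eq_zero {μ : ℕ+ →₀ ℕ} {k : ℕ+} (h : μ k = 0) (c : ℚ) :
    MvPowerSeries.pderiv ℚ k (MvPowerSeries.monomial μ c) = 0 := by
  rw [← MvPolynomial.coe_monomial, MvPowerSeries.pderiv_coe, MvPolynomial.pderiv_monomial, h]
  simp

theorem X_mul_monomial (μ : ℕ+ →₀ ℕ) (k : ℕ+) :
    MvPowerSeries.X k * MvPowerSeries.monomial μ (1 : ℚ)
      = MvPowerSeries.monomial (μ + Finsupp.single k 1) (1 : ℚ) := by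
  rw [MvPowerSeries.X, MvPowerSeries.monomial_mul_monomial, one_mul, add_comm]

theorem cut_monomial {μ ν : ℕ+ →₀ ℕ} {i j : ℕ+}
    (h : ν + Finsupp.single (i + j) 1 = μ + Finsupp.single i 1 + Finsupp.single j 1)
    (hμ : μ (i + j) ≠ 0) :
    MvPowerSeries.X i * MvPowerSeries.X j
        * MvPowerSeries.pderiv ℚ (i + j) (MvPowerSeries.monomial μ (1 : ℚ))
      = (μ (i + j) : ℚ) • MvPowerSeries.monomial ν (1 : ℚ) := by
  obtain ⟨μ, rfl⟩ : ∃ μ', μ = μ' + Finsupp.single (i + j) 1 :=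
    ⟨μ - Finsupp.single (i + j) 1, by
      rw [tsub_add_cancel_of_le]; rw [Finsupp.single_le_iff]; omega⟩
  have hν : ν = μ + Finsupp.single j 1 + Finsupp.single i 1 :=
    add_right_cancel (h.trans (by abel))
  rw [pderiv_monomial_add, mul_smul_comm, mul_assoc, X_mul_monomial, X_mul_monomial, hν]
  simp

theorem join_monomial {μ ν : ℕ+ →₀ ℕ} {i j : ℕ+}
    (h : ν + Finsupp.single i 1 + Finsupp.single j 1 = μ + Finsupp.single (i + j) 1)
    (hj : μ j ≠ 0) (hi : (μ - Finsupp.single j 1 : ℕ+ →₀ ℕ) i ≠ 0) :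
    MvPowerSeries.X (i + j) * MvPowerSeries.pderiv ℚ i (MvPowerSeries.pderiv ℚ j
        (MvPowerSeries.monomial μ (1 : ℚ)))
      = ((μ j : ℚ) * ((μ - Finsupp.single j 1 : ℕ+ →₀ ℕ) i : ℕ))
        • MvPowerSeries.monomial ν (1 : ℚ) := by
  obtain ⟨μ, rfl⟩ : ∃ μ', μ = μ' + Finsupp.single j 1 :=
    ⟨μ - Finsupp.single j 1, by
      rw [tsub_add_cancel_of_le]; rw [Finsupp.single_le_iff]; omega⟩
  rw [add_tsub_cancel_right] at hi ⊢
  obtain ⟨μ, rfl⟩ : ∃ μ', μ = μ' + Finsupp.single i 1 :=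
    ⟨μ - Finsupp.single i 1, by
      rw [tsub_add_cancel_of_le]; rw [Finsupp.single_le_iff]; omega⟩
  have hν : ν = μ + Finsupp.single (i + j) 1 := by
    refine add_right_cancel (b := Finsupp.single i 1 + Finsupp.single j 1) ?_
    rw [← add_assoc, h]
    abel
  rw [pderiv_monomial_add, Derivation.map_smul, pderiv_monomial_add, mul_smul_comm, mul_smul_comm,
    X_mul_monomial, smul_smul, hν]
  simp

theorem sum_offDiag_swap {X : Type*} [Fintype X] [DecidableEq X] {M : Type*} [AddCommMonoid M]
    (g : Perm X → M) :
    ∑ p ∈ (Finset.univ : Finset X).offDiag, g (swap p.1 p.2)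
      = 2 • ∑ t ∈ swapsIn Finset.univ, g t := by
  classical
  rw [← Finset.sum_fiberwise_of_maps_to (t := swapsIn Finset.univ)
    (g := fun p : X × X => swap p.1 p.2), Finset.smul_sum]
  · refine Finset.sum_congr rfl fun t ht => ?_
    obtain ⟨x, -, y, -, hxy, rfl⟩ := mem_swapsIn.mp ht
    have : (Finset.univ : Finset X).offDiag.filter (fun p => swap p.1 p.2 = swap x y)
        = {(x, y), (y, x)} := by
      ext ⟨a, b⟩
      simp only [Finset.mem_filter, Finset.mem_offDiag, Finset.mem_univ, true_and,
        Finset.mem_insert, Finset.mem_singleton, Prod.mk.injEq]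
      constructor
      · rintro ⟨hab, h⟩
        have h1 : swap x y a = b := by rw [← h, swap_apply_left]
        rw [swap_apply_def] at h1
        split_ifs at h1 with h2 h3
        · exact Or.inl ⟨h2, h1.symm⟩
        · exact Or.inr ⟨h3, h1.symm⟩
        · exact absurd h1 hab
      · rintro (⟨rfl, rfl⟩ | ⟨rfl, rfl⟩)
        · exact ⟨hxy, rfl⟩
        · exact ⟨hxy.symm, swap_comm _ _⟩
    rw [this, Finset.sum_pair (by simp [hxy]), swap_comm y x, two_smul]
  · intro p hp
    rw [Finset.mem_offDiag] at hp
    exact mem_swapsIn.mpr ⟨p.1, hp.1, p.2, hp.2.1, hp.2.2, rfl⟩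

/-- The combinatorial meaning of the cut-and-join operator: it describes the multiplication by all
transpositions in terms of cycle types. -/
theorem cutJoin_monomial {X : Type*} [Fintype X] [DecidableEq X] (σ : Perm X) :
    cutJoin (MvPowerSeries.monomial (cycOn σ Finset.univ) (1 : ℚ))
      = ∑ t ∈ swapsIn Finset.univ,
          MvPowerSeries.monomial (cycOn (t * σ) Finset.univ) (1 : ℚ) := by
  classical
  set μ := cycOn σ Finset.univ with hμ
  set per : X → ℕ+ := fun x => ⟨Function.minimalPeriod σ x, minimalPeriod_perm_pos σ x⟩ with hper
  have hcoe : ∀ x, (per x : ℕ) = Function.minimalPeriod σ x := fun x => rfl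
  set N : ℕ+ := Finset.univ.sup per ⊔ μ.support.sup id with hN
  have hperN : ∀ x, per x ≤ N := fun x => (Finset.le_sup (Finset.mem_univ x)).trans le_sup_left
  have hμN : ∀ k, N < k → μ k = 0 := by
    intro k hk
    by_contra h
    have : k ≤ N := (Finset.le_sup (f := id) (Finsupp.mem_support_iff.mpr h)).trans le_sup_right
    exact absurd hk (not_lt.mpr this)
  have hcount : ∀ k : ℕ+, (k : ℚ) * μ k = ((Finset.univ.filter fun x => per x = k).card : ℚ) := by
    intro k
    rw [← Nat.cast_mul, mul_cycOn fun _ _ => Finset.mem_univ _]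
    congr 2
    refine Finset.filter_congr fun x _ => ?_
    rw [← hcoe, PNat.coe_inj]
  set G : X → X → MvPowerSeries ℕ+ ℚ := fun x y =>
    MvPowerSeries.monomial (cycOn (swap x y * σ) Finset.univ) (1 : ℚ) with hG
  -- the cuts of a cycle of length `i + j` into cycles of lengths `i` and `j`: the transposition
  -- exchanges a point `x` of the cycle with the point `i` steps further
  have hcut : ∀ i j : ℕ+, ((i : ℚ) + (j : ℚ)) • (MvPowerSeries.X i * MvPowerSeries.X j
      * MvPowerSeries.pderiv ℚ (i + j) (MvPowerSeries.monomial μ (1 : ℚ)))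
      = ∑ x ∈ Finset.univ.filter (fun x => per x = i + j), G x (σ^[i] x) := by
    intro i j
    by_cases h0 : μ (i + j) = 0
    · rw [pderiv_monomial_of_eq_zero h0, mul_zero, smul_zero]
      have := hcount (i + j)
      rw [h0, Nat.cast_zero, mul_zero, eq_comm, Nat.cast_eq_zero, Finset.card_eq_zero] at this
      rw [this, Finset.sum_empty]
    · obtain ⟨ν, hν⟩ : ∃ ν : ℕ+ →₀ ℕ, ν + Finsupp.single (i + j) 1
          = μ + Finsupp.single i 1 + Finsupp.single j 1 := by
        obtain ⟨μ', h'⟩ : ∃ μ', μ = μ' + Finsupp.single (i + j) 1 :=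
          ⟨μ - Finsupp.single (i + j) 1, by
            rw [tsub_add_cancel_of_le]; rw [Finsupp.single_le_iff]; omega⟩
        exact ⟨μ' + Finsupp.single i 1 + Finsupp.single j 1, by rw [h']; abel⟩
      rw [cut_monomial hν h0, smul_smul]
      have h1 : ∀ x ∈ Finset.univ.filter (fun x => per x = i + j),
          G x (σ^[i] x) = MvPowerSeries.monomial ν (1 : ℚ) := by
        intro x hx
        have hx' : Function.minimalPeriod σ x = i + j := by
          rw [← hcoe, (Finset.mem_filter.mp hx).2, PNat.add_coe]
        have := cycOn_cut hx'
        rw [← hμ, ← hν] at this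
        rw [hG, ← add_right_cancel this]
      rw [Finset.sum_congr rfl h1, Finset.sum_const, ← Nat.cast_smul_eq_nsmul ℚ, ← hcount,
        PNat.add_coe, Nat.cast_add]
  -- the joins of a cycle of length `i` with another one of length `j`
  have hjoin : ∀ i j : ℕ+, ((i : ℚ) * (j : ℚ)) • (MvPowerSeries.X (i + j)
      * MvPowerSeries.pderiv ℚ i (MvPowerSeries.pderiv ℚ j (MvPowerSeries.monomial μ (1 : ℚ))))
      = ∑ y ∈ Finset.univ.filter (fun y => per y = j),
          ∑ x ∈ Finset.univ.filter (fun x => per x = i ∧ ¬ σ.SameCycle y x), G x y := by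
    intro i j
    have hcard : ∀ y, per y = j →
        ((Finset.univ.filter fun x => per x = i ∧ ¬ σ.SameCycle y x).card : ℚ)
          = i * ((μ - Finsupp.single j 1 : ℕ+ →₀ ℕ) i : ℕ) := by
      intro y hy
      have hμj : 1 ≤ μ j := by
        by_contra h
        have h2 := hcount j
        rw [show μ j = 0 by omega, Nat.cast_zero, mul_zero, eq_comm, Nat.cast_eq_zero,
          Finset.card_eq_zero, Finset.filter_eq_empty_iff] at h2
        exact h2 (Finset.mem_univ y) hy
      have h1 := Finset.card_filter_add_card_filter_not (s := Finset.univ.filter fun x => per x = i)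
        (fun x => σ.SameCycle y x)
      rw [Finset.filter_filter, Finset.filter_filter] at h1
      have h2 : ((Finset.univ.filter fun x => per x = i ∧ σ.SameCycle y x).card : ℚ)
          = i * (Finsupp.single j 1 i : ℕ) := by
        rw [Finsupp.single_apply]
        have hsame : ∀ x, σ.SameCycle y x → per x = j := by
          intro x hx
          rw [← PNat.coe_inj, hcoe, minimalPeriod_eq_of_sameCycle hx, ← hcoe, hy]
        split_ifs with hji
        · subst hji
          rw [Nat.cast_one, mul_one, ← hy, hcoe, ← card_filter_sameCycle]
          congr 2
          refine Finset.filter_congr fun x _ => ⟨fun h => h.2, fun h => ⟨?_, h⟩⟩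
          rw [hsame x h, hy]
        · rw [Nat.cast_zero, mul_zero, Nat.cast_eq_zero, Finset.card_eq_zero,
            Finset.filter_eq_empty_iff]
          rintro x _ ⟨h3, h4⟩
          exact hji ((hsame x h4).symm.trans h3)
      have h3 := congrArg (Nat.cast (R := ℚ)) h1
      rw [Nat.cast_add, ← hcount, h2] at h3
      rw [Finsupp.tsub_apply, Nat.cast_sub]
      · linarith
      · rw [Finsupp.single_apply]
        split_ifs with h
        · rwa [← h]
        · exact Nat.zero_le _
    by_cases hj0 : μ j = 0
    · rw [pderiv_monomial_of_eq_zero hj0, map_zero, mul_zero, smul_zero]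
      have := hcount j
      rw [hj0, Nat.cast_zero, mul_zero, eq_comm, Nat.cast_eq_zero, Finset.card_eq_zero] at this
      rw [this, Finset.sum_empty]
    · have hle : Finsupp.single j 1 ≤ μ := by
        rw [Finsupp.single_le_iff]; omega
      by_cases hi0 : (μ - Finsupp.single j 1 : ℕ+ →₀ ℕ) i = 0
      · have h1 : MvPowerSeries.pderiv ℚ i (MvPowerSeries.pderiv ℚ j
            (MvPowerSeries.monomial μ (1 : ℚ))) = 0 := by
          conv_lhs => rw [← tsub_add_cancel_of_le hle]
          rw [pderiv_monomial_add, Derivation.map_smul, pderiv_monomial_of_eq_zero hi0, smul_zero]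
        rw [h1, mul_zero, smul_zero, eq_comm]
        refine Finset.sum_eq_zero fun y hy => ?_
        have := hcard y (Finset.mem_filter.mp hy).2
        rw [hi0, Nat.cast_zero, mul_zero, Nat.cast_eq_zero, Finset.card_eq_zero] at this
        rw [this, Finset.sum_empty]
      · obtain ⟨ν, hν⟩ : ∃ ν : ℕ+ →₀ ℕ, ν + Finsupp.single i 1 + Finsupp.single j 1
            = μ + Finsupp.single (i + j) 1 := by
          obtain ⟨μ', h'⟩ : ∃ μ', μ - Finsupp.single j 1 = μ' + Finsupp.single i 1 :=
            ⟨μ - Finsupp.single j 1 - Finsupp.single i 1, by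
              rw [tsub_add_cancel_of_le]; rw [Finsupp.single_le_iff]; omega⟩
          refine ⟨μ' + Finsupp.single (i + j) 1, ?_⟩
          rw [← tsub_add_cancel_of_le hle, h']
          abel
        rw [join_monomial hν hj0 hi0, smul_smul]
        have h1 : ∀ y ∈ Finset.univ.filter (fun y => per y = j),
            ∑ x ∈ Finset.univ.filter (fun x => per x = i ∧ ¬ σ.SameCycle y x), G x y
              = ((i : ℚ) * ((μ - Finsupp.single j 1 : ℕ+ →₀ ℕ) i : ℕ))
                • MvPowerSeries.monomial ν (1 : ℚ) := by
          intro y hy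
          have hy' := (Finset.mem_filter.mp hy).2
          rw [← hcard y hy', Nat.cast_smul_eq_nsmul, ← Finset.sum_const]
          refine Finset.sum_congr rfl fun x hx => ?_
          rw [Finset.mem_filter] at hx
          have := cycOn_join (i := i) (j := j) (by rw [← hcoe, hx.2.1]) (by rw [← hcoe, hy'])
            (fun h => hx.2.2 h.symm)
          rw [← hμ, ← hν] at this
          rw [hG]
          simp only
          rw [add_right_cancel (add_right_cancel this)]
        rw [Finset.sum_congr rfl h1, Finset.sum_const, ← Nat.cast_smul_eq_nsmul ℚ, ← hcount,
          smul_smul]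
        congr 1
        ring
  rw [cutJoin_eq_sum (N := N) fun k hk => pderiv_monomial_of_eq_zero (hμN k hk) _]
  simp only [cutJoinTerm]
  rw [Finset.sum_add_distrib]
  have hS1 : ∑ ij ∈ Finset.Iic N ×ˢ Finset.Iic N, ((ij.1 : ℚ) + (ij.2 : ℚ)) •
      (MvPowerSeries.X ij.1 * MvPowerSeries.X ij.2
        * MvPowerSeries.pderiv ℚ (ij.1 + ij.2) (MvPowerSeries.monomial μ (1 : ℚ)))
      = ∑ p ∈ (Finset.univ : Finset X).offDiag.filter (fun p => σ.SameCycle p.1 p.2),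
          G p.1 p.2 := by
    rw [Finset.sum_congr rfl fun ij _ => hcut ij.1 ij.2]
    simp only [Finset.sum_filter]
    have hset : ((Finset.univ : Finset X).offDiag.filter fun p => σ.SameCycle p.1 p.2)
        = (Finset.univ ×ˢ Finset.univ).filter fun p => σ.SameCycle p.1 p.2 ∧ p.1 ≠ p.2 := by
      ext p
      simp [Finset.mem_offDiag, and_comm]
    rw [Finset.sum_comm, ← Finset.sum_filter, hset, Finset.sum_filter, Finset.sum_product]
    refine Finset.sum_congr rfl fun x _ => ?_
    rw [← Finset.sum_filter, ← Finset.sum_filter]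
    have hadd : ∀ i j : ℕ+, per x = i + j → Function.minimalPeriod σ x = i + j := by
      intro i j h
      rw [← hcoe, h, PNat.add_coe]
    refine Finset.sum_bij (fun ij _ => σ^[ij.1] x) ?_ ?_ ?_ ?_
    · rintro ⟨i, j⟩ hij
      have h1 := hadd i j (Finset.mem_filter.mp hij).2
      refine Finset.mem_filter.mpr ⟨Finset.mem_univ _, sameCycle_iterate σ x i, fun h => ?_⟩
      have := j.pos
      exact Function.not_isPeriodicPt_of_pos_of_lt_minimalPeriod (f := σ) (x := x) i.pos.ne'
        (show (i : ℕ) < _ by omega) h.symm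
    · rintro ⟨i, j⟩ hij ⟨i', j'⟩ hij' h
      have h1 := hadd i j (Finset.mem_filter.mp hij).2
      have h2 := hadd i' j' (Finset.mem_filter.mp hij').2
      have := j.pos
      have := j'.pos
      have h3 : (i : ℕ) = i' := (Function.iterate_eq_iterate_iff_of_lt_minimalPeriod
        (show (i : ℕ) < _ by omega) (show (i' : ℕ) < _ by omega)).mp h
      rw [Prod.mk.injEq, ← PNat.coe_inj, ← PNat.coe_inj]
      omega
    · intro y hy
      obtain ⟨-, hxy, hne⟩ := Finset.mem_filter.mp hy
      simp only at hxy hne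
      obtain ⟨n, hn, rfl⟩ := exists_iterate_of_sameCycle hxy
      have hn0 : 0 < n := by
        rcases Nat.eq_zero_or_pos n with rfl | h
        · exact absurd rfl hne
        · exact h
      obtain ⟨i, hi⟩ : ∃ i : ℕ+, (i : ℕ) = n := ⟨⟨n, hn0⟩, rfl⟩
      obtain ⟨j, hj⟩ : ∃ j : ℕ+, (j : ℕ) = Function.minimalPeriod σ x - n :=
        ⟨⟨_, Nat.sub_pos_of_lt hn⟩, rfl⟩
      have hsum : per x = i + j := by
        rw [← PNat.coe_inj, hcoe, PNat.add_coe]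
        omega
      refine ⟨(i, j), Finset.mem_filter.mpr ⟨Finset.mem_product.mpr
        ⟨Finset.mem_Iic.mpr ?_, Finset.mem_Iic.mpr ?_⟩, hsum⟩, by rw [← hi]⟩
      · exact ((PNat.lt_add_right i j).le.trans hsum.ge).trans (hperN x)
      · exact ((PNat.lt_add_left j i).le.trans hsum.ge).trans (hperN x)
    · rintro ⟨i, j⟩ _
      rfl
  have hS2 : ∑ ij ∈ Finset.Iic N ×ˢ Finset.Iic N, ((ij.1 : ℚ) * (ij.2 : ℚ)) •
      (MvPowerSeries.X (ij.1 + ij.2) * MvPowerSeries.pderiv ℚ ij.1 (MvPowerSeries.pderiv ℚ ij.2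
        (MvPowerSeries.monomial μ (1 : ℚ))))
      = ∑ p ∈ (Finset.univ : Finset X).offDiag.filter (fun p => ¬ σ.SameCycle p.1 p.2),
          G p.1 p.2 := by
    have hset : ((Finset.univ : Finset X).offDiag.filter fun p => ¬ σ.SameCycle p.1 p.2)
        = (Finset.univ ×ˢ Finset.univ).filter fun p => ¬ σ.SameCycle p.2 p.1 := by
      ext p
      simp only [Finset.mem_filter, Finset.mem_offDiag, Finset.mem_univ, true_and,
        Finset.mem_product, Perm.sameCycle_comm]
      exact ⟨fun h => h.2, fun h => ⟨fun he => h (by rw [he]), h⟩⟩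
    rw [Finset.sum_congr rfl fun ij _ => hjoin ij.1 ij.2, hset, Finset.sum_filter,
      Finset.sum_product_right (s := (Finset.univ : Finset X))]
    simp only [Finset.sum_filter]
    rw [Finset.sum_comm]
    refine Finset.sum_congr rfl fun y _ => ?_
    have h1 : ∀ ij : ℕ+ × ℕ+, (if per y = ij.2 then
        ∑ x, if per x = ij.1 ∧ ¬ σ.SameCycle y x then G x y else 0 else 0)
        = ∑ x, if ij = (per x, per y) then (if ¬ σ.SameCycle y x then G x y else 0) else 0 := by
      rintro ⟨i, j⟩
      by_cases hj : per y = j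
      · rw [if_pos hj]
        refine Finset.sum_congr rfl fun x _ => ?_
        by_cases hi : per x = i
        · simp [hi, hj]
        · simp [hi, Ne.symm hi]
      · rw [if_neg hj, eq_comm]
        refine Finset.sum_eq_zero fun x _ => if_neg ?_
        rw [Prod.mk.injEq]
        exact fun h => hj h.2.symm
    rw [Finset.sum_congr rfl fun ij _ => h1 ij, Finset.sum_comm]
    refine Finset.sum_congr rfl fun x _ => ?_
    rw [Finset.sum_ite_eq', if_pos]
    exact Finset.mem_product.mpr ⟨Finset.mem_Iic.mpr (hperN x), Finset.mem_Iic.mpr (hperN y)⟩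
  rw [hS1, hS2, Finset.sum_filter_add_sum_filter_not, sum_offDiag_swap
    (fun t => MvPowerSeries.monomial (cycOn (t * σ) Finset.univ) (1 : ℚ)),
    ← Nat.cast_smul_eq_nsmul ℚ, smul_smul]
  norm_num

end CutJoin

/-! ### The cut-and-join formula for the generating series -/

section CutJoinFormula

open Equiv

theorem cutJoin_iterate_monomial {X : Type*} [Fintype X] [DecidableEq X] (m : ℕ) :
    cutJoin^[m] (MvPowerSeries.monomial (cycOn (1 : Perm X) Finset.univ) (1 : ℚ))
      = wordSum (swapsIn Finset.univ) m fun w : List (Perm X) =>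
          MvPowerSeries.monomial (cycOn w.prod Finset.univ) (1 : ℚ) := by
  induction m with
  | zero => rw [wordSum_zero, List.prod_nil]; rfl
  | succ m ih =>
    rw [Function.iterate_succ_apply', ih, wordSum_succ, ← cutJoinLin_apply]
    simp only [wordSum]
    rw [map_sum, Finset.sum_comm]
    refine Finset.sum_congr rfl fun w _ => ?_
    rw [cutJoinLin_apply, cutJoin_monomial]
    simp only [List.prod_cons]

theorem weightPart_expSeries_X_one (d : ℕ) :
    weightPart d (expSeries (MvPowerSeries.X 1))
      = (1 / (d.factorial : ℚ)) • MvPowerSeries.monomial (Finsupp.single 1 d) (1 : ℚ) := by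
  classical
  ext α
  rw [coeff_weightPart, coeff_expSeries (MvPowerSeries.constantCoeff_X 1)
    (N := max α.degree d + 1) (by omega), map_smul, MvPowerSeries.coeff_monomial]
  simp only [MvPowerSeries.coeff_X_pow]
  by_cases h : α = Finsupp.single 1 d
  · subst h
    rw [pweight_single, if_pos (by simp), if_pos rfl,
      Finset.sum_eq_single_of_mem d (Finset.mem_range.mpr (by omega)), if_pos rfl]
    intro n _ hn
    rw [if_neg (fun h => hn (Finsupp.single_injective _ h).symm), smul_zero]
  · rw [if_neg h, smul_zero]
    split_ifs with hd
    · refine Finset.sum_eq_zero fun n _ => ?_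
      rw [if_neg, smul_zero]
      rintro rfl
      rw [pweight_single, PNat.one_coe, mul_one, Nat.cast_inj] at hd
      exact h (by rw [hd])
    · rfl

/-- Before connectedness is imposed, the words of transpositions of a set of sheets are counted by
the powers of the cut-and-join operator. -/
theorem coeff_expCutJoin (α : ℕ+ →₀ ℕ) :
    MvPowerSeries.coeff α (expCutJoin (expSeries (MvPowerSeries.X 1)))
      = (1 / ((pweight α).factorial : ℚ)) •
        discSeries α (Finset.univ : Finset (Fin (pweight α))) := by
  classical
  ext m
  rw [PowerSeries.coeff_smul, discSeries, coeff_egf]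
  change PowerSeries.coeff m (PowerSeries.mk fun m =>
    MvPowerSeries.coeff α (cutJoin^[m] (expSeries (MvPowerSeries.X 1))) / (m.factorial : ℚ)) = _
  have h1 : MvPowerSeries.coeff α (cutJoin^[m] (expSeries (MvPowerSeries.X 1)))
      = MvPowerSeries.coeff α (weightPart (pweight α)
        (cutJoin^[m] (expSeries (MvPowerSeries.X 1)))) := by
    rw [coeff_weightPart, if_pos rfl]
  have h2 := cutJoin_iterate_monomial (X := Fin (pweight α)) m
  rw [cycOn_one, Finset.card_univ, Fintype.card_fin] at h2
  rw [PowerSeries.coeff_mk, h1, weightPart_cutJoin_iterate, weightPart_expSeries_X_one,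
    ← cutJoinLin_pow_apply, map_smul, cutJoinLin_pow_apply, h2, map_smul, smul_eq_mul,
    mul_div_assoc]
  congr 2
  simp only [wordSum, map_sum, MvPowerSeries.coeff_monomial]
  refine Finset.sum_congr rfl fun w _ => if_congr eq_comm rfl rfl

theorem connSeries_eq_zero {X : Type*} [Fintype X] [DecidableEq X] {α : ℕ+ →₀ ℕ} {S : Finset X}
    (h : pweight α ≠ S.card) : connSeries α S = 0 := by
  classical
  ext m
  rw [connSeries, coeff_egf, wordSum_congr (G := fun _ => 0), wordSum, Finset.sum_const_zero,
    zero_div, map_zero]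
  intro w _ hw
  rw [if_neg]
  rintro ⟨rfl, -⟩
  exact h (pweight_cycOn fun x hx =>
    stable_prod (fun t ht x hx => apply_mem_of_mem_swapsIn (hw t ht) hx) hx)

/-- Removing the component of a marked point: the Euler operator turns the exponential formula into
a recursion. -/
theorem euler_expCutJoin :
    euler (fun k : ℕ+ => (k : ℕ)) (expCutJoin (expSeries (MvPowerSeries.X 1)))
      = euler (fun k : ℕ+ => (k : ℕ)) hurwitzSeries
        * expCutJoin (expSeries (MvPowerSeries.X 1)) := by
  classical
  ext1 α
  rw [coeff_euler, MvPowerSeries.coeff_mul, coeff_expCutJoin]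
  change pweight α • _ = _
  set d := pweight α with hd
  have h := card_smul_discSeries α (Finset.univ : Finset (Fin d))
  rw [Finset.card_univ, Fintype.card_fin] at h
  set F : ℕ → PowerSeries ℚ := fun k => k • ∑ p ∈ Finset.HasAntidiagonal.antidiagonal α,
    connSeries p.1 (Finset.univ : Finset (Fin k))
      * discSeries p.2 (Finset.univ : Finset (Fin (d - k))) with hF
  have h1 : ∀ T ∈ (Finset.univ : Finset (Fin d)).powerset, T.card •
      ∑ p ∈ Finset.HasAntidiagonal.antidiagonal α,
        connSeries p.1 T * discSeries p.2 (Finset.univ \ T)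
      = F T.card := by
    intro T _
    have hc : (Finset.univ \ T).card = d - T.card := by
      rw [Finset.card_sdiff_of_subset (Finset.subset_univ _), Finset.card_univ, Fintype.card_fin]
    refine congrArg _ (Finset.sum_congr rfl fun p _ => ?_)
    rw [connSeries_eq_fin p.1 T, discSeries_eq_fin p.2, hc]
  rw [Finset.sum_congr rfl h1, Finset.sum_powerset_apply_card F, Finset.card_univ,
    Fintype.card_fin] at h
  rw [smul_comm, h]
  simp only [hF, Finset.smul_sum]
  rw [Finset.sum_comm]
  refine Finset.sum_congr rfl fun p hp => ?_
  rw [Finset.HasAntidiagonal.mem_antidiagonal] at hp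
  have hw : pweight p.1 + pweight p.2 = d := by rw [← map_add, hp]
  rw [Finset.sum_eq_single_of_mem (pweight p.1) (Finset.mem_range.mpr (by omega))]
  · rw [coeff_euler, coeff_expCutJoin]
    change _ = (pweight p.1 • _) * _
    by_cases h0 : p.1 = 0
    · rw [h0, map_zero]
      simp
    · rw [coeff_hurwitzSeries h0, show d - pweight p.1 = pweight p.2 by omega]
      simp only [smul_mul_assoc, mul_smul_comm, ← Nat.cast_smul_eq_nsmul ℚ, smul_smul]
      congr 1
      rw [Nat.cast_choose ℚ (show pweight p.1 ≤ d by omega),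
        show d - pweight p.1 = pweight p.2 by omega]
      have := Nat.factorial_ne_zero d
      have := Nat.factorial_ne_zero (pweight p.1)
      have := Nat.factorial_ne_zero (pweight p.2)
      field_simp
  · intro k _ hk
    rw [connSeries_eq_zero (by rw [Finset.card_univ, Fintype.card_fin]; exact hk.symm)]
    simp

theorem constantCoeff_hurwitzSeries : MvPowerSeries.constantCoeff hurwitzSeries = 0 := by
  change hurwitzSeries 0 = 0
  rw [hurwitzSeries, if_pos rfl]

/-- Both sides have constant coefficient `1` and satisfy the same differential equation with respect
to the Euler operator. -/
theorem expSeries_hurwitzSeries :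
    expSeries hurwitzSeries = expCutJoin (expSeries (MvPowerSeries.X 1)) := by
  classical
  refine (eq_expSeries (w := fun k : ℕ+ => (k : ℕ)) (fun k => k.ne_zero)
    constantCoeff_hurwitzSeries euler_expCutJoin ?_).symm
  rw [← MvPowerSeries.coeff_zero_eq_constantCoeff_apply, coeff_expCutJoin]
  ext m
  rw [map_zero, discSeries, Nat.factorial_zero, Nat.cast_one, div_one, one_smul, coeff_egf,
    PowerSeries.coeff_one]
  cases m with
  | zero =>
    rw [wordSum_zero, List.prod_nil, cycOn_one, if_pos (by simp)]
    simp
  | succ m =>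
    rw [wordSum_succ, if_neg (Nat.succ_ne_zero m), Finset.sum_eq_zero, zero_div]
    intro t ht
    obtain ⟨x, -⟩ := mem_swapsIn.mp ht
    exact x.elim0

end CutJoinFormula

/-! ### The cut-and-join operator on polynomials -/

section Fock

/-- The polynomials in `p_1, p_2, …`. -/
abbrev Fock := MvPolynomial ℕ+ ℚ

/-- The variable `p_k`, with `p_0 = 0`. -/
def var (k : ℕ) : Fock := if h : 0 < k then MvPolynomial.X ⟨k, h⟩ else 0

theorem var_zero : var 0 = 0 := rfl

theorem var_coe (k : ℕ+) : var k = MvPolynomial.X k := dif_pos k.pos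

/-- The derivation `∑_j j p_{k+j} ∂/∂p_j`. For `k = 0` it is the Euler operator that multiplies a
monomial by its weight. -/
def shiftDer (k : ℕ) : Derivation ℚ Fock Fock :=
  MvPolynomial.mkDerivation ℚ fun j : ℕ+ => ((j : ℕ) : Fock) * var (k + j)

theorem shiftDer_var (k j : ℕ) : shiftDer k (var j) = (j : Fock) * var (k + j) := by
  rcases Nat.eq_zero_or_pos j with rfl | hj
  · rw [var_zero, map_zero, Nat.cast_zero, zero_mul]
  · obtain ⟨i, hi⟩ : ∃ i : ℕ+, (i : ℕ) = j := ⟨⟨j, hj⟩, rfl⟩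
    rw [← hi, var_coe, shiftDer, MvPolynomial.mkDerivation_X]

/-- The quadratic polynomial `∑_{i+j=k} p_i p_j`. -/
def quad (k : ℕ) : Fock := ∑ p ∈ Finset.HasAntidiagonal.antidiagonal k, var p.1 * var p.2

/-- The `(i, j)`-th summand of twice the cut-and-join operator, on polynomials. -/
def fockTerm (f : Fock) (i j : ℕ+) : Fock :=
  (((i : ℕ) : Fock) + ((j : ℕ) : Fock)) *
      (MvPolynomial.X i * MvPolynomial.X j * MvPolynomial.pderiv (i + j) f)
    + (((i : ℕ) : Fock) * ((j : ℕ) : Fock)) *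
      (MvPolynomial.X (i + j) * MvPolynomial.pderiv i (MvPolynomial.pderiv j f))

theorem pderiv_comm (i j : ℕ+) (f : Fock) :
    MvPolynomial.pderiv i (MvPolynomial.pderiv j f)
      = MvPolynomial.pderiv j (MvPolynomial.pderiv i f) := by
  have h : ⁅(MvPolynomial.pderiv i : Derivation ℚ Fock Fock),
      (MvPolynomial.pderiv j : Derivation ℚ Fock Fock)⁆ = 0 := by
    refine MvPolynomial.derivation_ext fun k => ?_
    rw [Derivation.commutator_apply, MvPolynomial.pderiv_X, MvPolynomial.pderiv_X]
    simp only [Pi.single_apply]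
    split_ifs <;> simp
  have h' := congrArg (fun D : Derivation ℚ Fock Fock => D f) h
  rw [Derivation.commutator_apply, Derivation.zero_apply] at h'
  exact sub_eq_zero.mp h'

theorem exists_bound (f : Fock) :
    ∃ N₀ : ℕ+, ∀ N, N₀ ≤ N → ∀ k, N < k → MvPolynomial.pderiv k f = 0 := by
  refine ⟨f.vars.sup id, fun N hN k hk => MvPolynomial.pderiv_eq_zero_of_notMem_vars fun h => ?_⟩
  have : k ≤ f.vars.sup id := Finset.le_sup (f := id) h
  exact absurd hk (not_lt.mpr (this.trans hN))

theorem support_fockTerm_subset {f : Fock} {N : ℕ+}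
    (hf : ∀ k, N < k → MvPolynomial.pderiv k f = 0) :
    (Function.support fun ij : ℕ+ × ℕ+ => fockTerm f ij.1 ij.2)
      ⊆ ((Finset.Iic N ×ˢ Finset.Iic N : Finset (ℕ+ × ℕ+)) : Set (ℕ+ × ℕ+)) := by
  rintro ⟨i, j⟩ hij
  by_contra hout
  refine hij ?_
  rw [Finset.mem_coe, Finset.mem_product, Finset.mem_Iic, Finset.mem_Iic, not_and_or, not_le,
    not_le] at hout
  have h1 : MvPolynomial.pderiv (i + j) f = 0 := hf _ <| by
    rcases hout with h | h
    · exact h.trans (PNat.lt_add_right i j)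
    · exact h.trans (PNat.lt_add_left j i)
  have h2 : MvPolynomial.pderiv i (MvPolynomial.pderiv j f) = 0 := by
    rcases hout with h | h
    · rw [pderiv_comm, hf i h, map_zero]
    · rw [hf j h, map_zero]
  change fockTerm f i j = 0
  rw [fockTerm, h1, h2]
  simp

/-- Twice the cut-and-join operator on polynomials, which has integral coefficients. -/
def cutJoinFock : Fock →ₗ[ℚ] Fock where
  toFun f := ∑ᶠ ij : ℕ+ × ℕ+, fockTerm f ij.1 ij.2
  map_add' f g := by
    obtain ⟨N, hN⟩ := exists_bound f
    obtain ⟨N', hN'⟩ := exists_bound g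
    rw [← finsum_add_distrib
      ((Finset.finite_toSet _).subset (support_fockTerm_subset (hN N le_rfl)))
      ((Finset.finite_toSet _).subset (support_fockTerm_subset (hN' N' le_rfl)))]
    refine finsum_congr fun ij => ?_
    simp only [fockTerm, map_add]
    ring
  map_smul' c f := by
    rw [RingHom.id_apply, smul_finsum]
    refine finsum_congr fun ij => ?_
    simp only [fockTerm, Derivation.map_smul, mul_smul_comm, smul_add]

theorem cutJoinFock_eq_sum {f : Fock} {N : ℕ+}
    (hf : ∀ k, N < k → MvPolynomial.pderiv k f = 0) :
    cutJoinFock f = ∑ ij ∈ Finset.Iic N ×ˢ Finset.Iic N, fockTerm f ij.1 ij.2 :=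
  finsum_eq_sum_of_support_subset _ (support_fockTerm_subset hf)

theorem coe_natCast (n : ℕ) : ((n : Fock) : MvPowerSeries ℕ+ ℚ) = n :=
  map_natCast MvPolynomial.coeToMvPowerSeries.ringHom n

theorem cutJoin_coe (f : Fock) :
    cutJoin (f : MvPowerSeries ℕ+ ℚ) = (1 / 2 : ℚ) • (cutJoinFock f : MvPowerSeries ℕ+ ℚ) := by
  obtain ⟨N, hN⟩ := exists_bound f
  have h := hN N le_rfl
  rw [cutJoinFock_eq_sum h, cutJoin_eq_sum (N := N)]
  · refine congrArg _ (Eq.trans (Finset.sum_congr rfl fun ij _ => ?_)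
      (map_sum MvPolynomial.coeToMvPowerSeries.ringHom _ _).symm)
    rw [MvPolynomial.coeToMvPowerSeries.ringHom_apply, cutJoinTerm, fockTerm,
      MvPowerSeries.pderiv_coe, MvPowerSeries.pderiv_coe, MvPowerSeries.pderiv_coe]
    push_cast
    rw [MvPowerSeries.smul_eq_C_mul, MvPowerSeries.smul_eq_C_mul]
    simp [coe_natCast]
  · intro k hk
    rw [MvPowerSeries.pderiv_coe, h k hk, MvPolynomial.coe_zero]

theorem cutJoin_iterate_coe (m : ℕ) (f : Fock) :
    cutJoin^[m] (f : MvPowerSeries ℕ+ ℚ)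
      = ((1 / 2 : ℚ) ^ m) • ((cutJoinFock ^ m) f : MvPowerSeries ℕ+ ℚ) := by
  induction m with
  | zero => simp
  | succ m ih =>
    rw [Function.iterate_succ_apply', ih, ← cutJoinLin_apply, map_smul, cutJoinLin_apply,
      cutJoin_coe, smul_smul, pow_succ (1 / 2 : ℚ), pow_succ' cutJoinFock, Module.End.mul_apply]

theorem cutJoinFock_one : cutJoinFock 1 = 0 := by
  rw [cutJoinFock_eq_sum (N := 1) fun k _ => Derivation.map_one_eq_zero _]
  refine Finset.sum_eq_zero fun ij _ => ?_
  rw [fockTerm, Derivation.map_one_eq_zero, Derivation.map_one_eq_zero, map_zero]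
  simp

theorem derivation_sum_apply {ι : Type*} (s : Finset ι) (D : ι → Derivation ℚ Fock Fock)
    (f : Fock) : (∑ i ∈ s, D i) f = ∑ i ∈ s, D i f := by
  have h := map_sum (Derivation.coeFnAddMonoidHom (R := ℚ) (A := Fock) (M := Fock)) D s
  exact (congrFun h f).trans (Finset.sum_apply _ _ _)

theorem shiftDer_eq_sum {f : Fock} {N : ℕ+} (hf : ∀ k, N < k → k ∉ f.vars) (k : ℕ) :
    shiftDer k f = ∑ j ∈ Finset.Iic N,
      ((j : ℕ) : Fock) * (var (k + j) * MvPolynomial.pderiv j f) := by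
  have h := MvPolynomial.derivation_eq_of_forall_mem_vars (D₁ := shiftDer k)
    (D₂ := ∑ j ∈ Finset.Iic N, (((j : ℕ) : Fock) * var (k + j)) • MvPolynomial.pderiv j)
    (f := f) fun i hi => by
      have hiN : i ≤ N := not_lt.mp fun h => hf i h hi
      rw [← var_coe, shiftDer_var, var_coe, derivation_sum_apply,
        Finset.sum_eq_single_of_mem i (Finset.mem_Iic.mpr hiN)]
      · rw [Derivation.smul_apply, MvPolynomial.pderiv_X_self, smul_eq_mul, mul_one]
      · intro j _ hj
        rw [Derivation.smul_apply, MvPolynomial.pderiv_X_of_ne hj.symm, smul_zero]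
  rw [h, derivation_sum_apply]
  simp only [Derivation.smul_apply, smul_eq_mul, mul_assoc]

theorem quad_eq_sum {k N : ℕ+} (hk : k ≤ N) :
    quad k = ∑ ij ∈ Finset.Iic N ×ˢ Finset.Iic N,
      if ij.1 + ij.2 = k then (MvPolynomial.X ij.1 * MvPolynomial.X ij.2 : Fock) else 0 := by
  rw [← Finset.sum_filter, quad]
  symm
  refine Finset.sum_bij_ne_zero (fun ij _ _ => ((ij.1 : ℕ), (ij.2 : ℕ))) ?_ ?_ ?_ ?_
  · intro ij h _
    rw [Finset.HasAntidiagonal.mem_antidiagonal, ← (Finset.mem_filter.mp h).2, PNat.add_coe]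
  · intro ij _ _ ij' _ _ h
    rw [Prod.mk.injEq, PNat.coe_inj, PNat.coe_inj] at h
    exact Prod.ext h.1 h.2
  · rintro ⟨i, j⟩ h h0
    have hi : 0 < i := Nat.pos_of_ne_zero fun hi => h0 (by rw [hi, var_zero, zero_mul])
    have hj : 0 < j := Nat.pos_of_ne_zero fun hj => h0 (by rw [hj, var_zero, mul_zero])
    obtain ⟨i, rfl⟩ : ∃ i' : ℕ+, (i' : ℕ) = i := ⟨⟨i, hi⟩, rfl⟩
    obtain ⟨j, rfl⟩ : ∃ j' : ℕ+, (j' : ℕ) = j := ⟨⟨j, hj⟩, rfl⟩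
    have hij : i + j = k := by
      rw [← PNat.coe_inj, PNat.add_coe]
      exact Finset.HasAntidiagonal.mem_antidiagonal.mp h
    refine ⟨(i, j), Finset.mem_filter.mpr ⟨Finset.mem_product.mpr
      ⟨Finset.mem_Iic.mpr ?_, Finset.mem_Iic.mpr ?_⟩, hij⟩, ?_, rfl⟩
    · exact (PNat.lt_add_right i j).le.trans (hij.le.trans hk)
    · exact (PNat.lt_add_left j i).le.trans (hij.le.trans hk)
    · rw [← var_coe, ← var_coe]
      exact h0
  · intro ij _ _
    rw [var_coe, var_coe]

/-- The commutator of the cut-and-join operator with multiplication by `p_k`. -/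
theorem cutJoinFock_var_mul (k : ℕ) (f : Fock) :
    cutJoinFock (var k * f)
      = var k * cutJoinFock f + (k : Fock) * (quad k * f + 2 * shiftDer k f) := by
  rcases Nat.eq_zero_or_pos k with rfl | hk
  · rw [var_zero, Nat.cast_zero, zero_mul, zero_mul, zero_mul, map_zero, add_zero]
  obtain ⟨k, rfl⟩ : ∃ k' : ℕ+, (k' : ℕ) = k := ⟨⟨k, hk⟩, rfl⟩
  set N : ℕ+ := (f.vars.sup id) ⊔ k with hN
  have hkN : k ≤ N := le_sup_right
  have hv : ∀ i, N < i → i ∉ f.vars := fun i hi h =>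
    absurd hi (not_lt.mpr ((Finset.le_sup (f := id) h).trans le_sup_left))
  have hf : ∀ i, N < i → MvPolynomial.pderiv i f = 0 := fun i hi =>
    MvPolynomial.pderiv_eq_zero_of_notMem_vars (hv i hi)
  have hX : ∀ i, MvPolynomial.pderiv i (MvPolynomial.X k * f)
      = MvPolynomial.X k * MvPolynomial.pderiv i f + if i = k then f else 0 := by
    intro i
    rw [Derivation.leibniz, MvPolynomial.pderiv_X, Pi.single_apply, smul_eq_mul, smul_eq_mul]
    by_cases h : i = k
    · rw [if_pos h, if_pos h.symm, mul_one]
    · rw [if_neg h, if_neg (Ne.symm h), mul_zero]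
  have hXf : ∀ i, N < i → MvPolynomial.pderiv i (MvPolynomial.X k * f) = 0 := by
    intro i hi
    rw [hX, hf i hi, mul_zero, zero_add, if_neg]
    rintro rfl
    exact absurd hi (not_lt.mpr hkN)
  have hterm : ∀ i j : ℕ+, fockTerm (MvPolynomial.X k * f) i j
      = MvPolynomial.X k * fockTerm f i j
        + ((k : ℕ) : Fock) * ((if i + j = k then MvPolynomial.X i * MvPolynomial.X j else 0) * f)
        + ((if i = k then ((k : ℕ) : Fock) * (((j : ℕ) : Fock)
            * (var (k + j) * MvPolynomial.pderiv j f)) else 0)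
          + (if j = k then ((k : ℕ) : Fock) * (((i : ℕ) : Fock)
            * (var (k + i) * MvPolynomial.pderiv i f)) else 0)) := by
    intro i j
    have h1 : MvPolynomial.pderiv i (MvPolynomial.pderiv j (MvPolynomial.X k * f))
        = MvPolynomial.X k * MvPolynomial.pderiv i (MvPolynomial.pderiv j f)
          + (if i = k then MvPolynomial.pderiv j f else 0)
          + (if j = k then MvPolynomial.pderiv i f else 0) := by
      rw [hX, map_add, Derivation.leibniz, MvPolynomial.pderiv_X, Pi.single_apply, smul_eq_mul,
        smul_eq_mul]
      by_cases h : i = k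
      · rw [if_pos h, if_pos h.symm, mul_one, apply_ite (MvPolynomial.pderiv i), map_zero]
      · rw [if_neg h, if_neg (Ne.symm h), mul_zero, apply_ite (MvPolynomial.pderiv i), map_zero]
    rw [fockTerm, fockTerm, h1, hX]
    have h2 : (((i : ℕ) : Fock) + ((j : ℕ) : Fock)) * (if i + j = k then f else 0)
        = ((k : ℕ) : Fock) * (if i + j = k then f else 0) := by
      split_ifs with h
      · rw [← h, PNat.add_coe, Nat.cast_add]
      · rw [mul_zero, mul_zero]
    have h3 : (((i : ℕ) : Fock) * ((j : ℕ) : Fock)) * (MvPolynomial.X (i + j)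
        * if i = k then MvPolynomial.pderiv j f else 0)
        = if i = k then ((k : ℕ) : Fock) * (((j : ℕ) : Fock)
            * (var (k + j) * MvPolynomial.pderiv j f)) else 0 := by
      split_ifs with h
      · rw [← h, ← PNat.add_coe, var_coe]
        ring
      · rw [mul_zero, mul_zero]
    have h4 : (((i : ℕ) : Fock) * ((j : ℕ) : Fock)) * (MvPolynomial.X (i + j)
        * if j = k then MvPolynomial.pderiv i f else 0)
        = if j = k then ((k : ℕ) : Fock) * (((i : ℕ) : Fock)
            * (var (k + i) * MvPolynomial.pderiv i f)) else 0 := by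
      split_ifs with h
      · rw [← h, ← PNat.add_coe, var_coe, add_comm i j]
        ring
      · rw [mul_zero, mul_zero]
    have h5 : ((if i + j = k then MvPolynomial.X i * MvPolynomial.X j else 0 : Fock)) * f
        = MvPolynomial.X i * MvPolynomial.X j * if i + j = k then f else 0 := by
      split_ifs <;> simp
    rw [h5]
    linear_combination (MvPolynomial.X i * MvPolynomial.X j) * h2 + h3 + h4
  have hmem : k ∈ Finset.Iic N := Finset.mem_Iic.mpr hkN
  have hA : ∑ ij ∈ Finset.Iic N ×ˢ Finset.Iic N, (if ij.1 = k then ((k : ℕ) : Fock)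
      * (((ij.2 : ℕ) : Fock) * (var (k + ij.2) * MvPolynomial.pderiv ij.2 f)) else 0)
      = (k : ℕ) * shiftDer k f := by
    rw [shiftDer_eq_sum hv, Finset.sum_product_right, Finset.mul_sum]
    simp only [Finset.sum_ite_eq', hmem, if_true]
  have hB : ∑ ij ∈ Finset.Iic N ×ˢ Finset.Iic N, (if ij.2 = k then ((k : ℕ) : Fock)
      * (((ij.1 : ℕ) : Fock) * (var (k + ij.1) * MvPolynomial.pderiv ij.1 f)) else 0)
      = (k : ℕ) * shiftDer k f := by
    rw [shiftDer_eq_sum hv, Finset.sum_product, Finset.mul_sum]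
    simp only [Finset.sum_ite_eq', hmem, if_true]
  rw [var_coe, cutJoinFock_eq_sum hXf, cutJoinFock_eq_sum hf, Finset.sum_congr rfl fun ij _ =>
    hterm ij.1 ij.2, Finset.sum_add_distrib, Finset.sum_add_distrib, Finset.sum_add_distrib,
    ← Finset.mul_sum, ← Finset.mul_sum, ← Finset.sum_mul, ← quad_eq_sum hkN, hA, hB]
  ring

end Fock

/-! ### Derivatives of complete homogeneous polynomials -/

section DerivationCompleteHom

variable {A : Type*} [CommRing A] [Algebra ℚ A]

/-- The chain rule for `exp (∑ x_k z^k / k)`. -/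
theorem derivation_completeHom {S : Type*} [CommRing S] [Algebra S A] (D : Derivation S A A)
    (x : ℕ+ → A) (n : ℕ) :
    D (completeHom x n) = ∑ p ∈ Finset.HasAntidiagonal.antidiagonal n,
      (if h : 0 < p.1 then (1 / (p.1 : ℚ)) • D (x ⟨p.1, h⟩) else 0) * completeHom x p.2 := by
  set d : PowerSeries A → PowerSeries A := fun f =>
    PowerSeries.mk fun n => D (PowerSeries.coeff n f)
    with hd
  have hcoeff : ∀ f n, PowerSeries.coeff n (d f) = D (PowerSeries.coeff n f) := fun f n => by
    rw [hd, PowerSeries.coeff_mk]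
  have hmul : ∀ f g, d (f * g) = d f * g + f * d g := by
    intro f g
    ext n
    simp only [hcoeff, map_add, PowerSeries.coeff_mul, map_sum, Derivation.leibniz, smul_eq_mul]
    rw [← Finset.sum_add_distrib]
    exact Finset.sum_congr rfl fun p _ => by ring
  have htheta : ∀ f, theta (d f) = d (theta f) := by
    intro f
    ext n
    rw [coeff_theta, hcoeff, hcoeff, coeff_theta, Derivation.leibniz, Derivation.map_natCast,
      smul_zero, add_zero, smul_eq_mul]
  have hY : theta (d (completeSeries x)) = powerSumSeries x * d (completeSeries x)
      + d (powerSumSeries x) * completeSeries x := by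
    rw [htheta, theta_completeSeries, hmul, add_comm]
  have hZ : theta (d (potential x) * completeSeries x)
      = powerSumSeries x * (d (potential x) * completeSeries x)
        + d (powerSumSeries x) * completeSeries x := by
    rw [Derivation.leibniz, theta_completeSeries, htheta, theta_potential, smul_eq_mul, smul_eq_mul]
    ring
  have h0 : PowerSeries.constantCoeff (powerSumSeries x) = 0 := by
    rw [← PowerSeries.coeff_zero_eq_constantCoeff_apply, powerSumSeries, PowerSeries.coeff_mk]
    simp
  have h1 : PowerSeries.constantCoeff (d (completeSeries x) - d (potential x) * completeSeries x)
      = 0 := by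
    rw [map_sub, map_mul, ← PowerSeries.coeff_zero_eq_constantCoeff_apply,
      ← PowerSeries.coeff_zero_eq_constantCoeff_apply, hcoeff, hcoeff, completeSeries, potential,
      PowerSeries.coeff_mk, PowerSeries.coeff_mk, completeHom_zero]
    simp
  have key : d (completeSeries x) - d (potential x) * completeSeries x = 0 := by
    refine eq_of_euler_eq (σ := Unit) (w := fun _ => 1) (by simp) (G := powerSumSeries x) h0 ?_ ?_
      (h1.trans (map_zero _).symm)
    · change theta _ = _
      rw [map_sub, hY, hZ]
      ring
    · rw [map_zero, mul_zero]
  have h2 := congrArg (PowerSeries.coeff n) (sub_eq_zero.mp key)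
  rw [hcoeff, completeSeries, PowerSeries.coeff_mk, PowerSeries.coeff_mul] at h2
  rw [h2]
  refine Finset.sum_congr rfl fun p _ => ?_
  rw [hcoeff, potential, PowerSeries.coeff_mk, PowerSeries.coeff_mk]
  congr 1
  split_ifs with h
  · rw [map_rat_smul]
  · rw [map_zero]

/-- The complete homogeneous polynomials are homogeneous. -/
theorem derivation_completeHom_of_homogeneous {S : Type*} [CommRing S] [Algebra S A]
    (D : Derivation S A A) {x : ℕ+ → A} (hx : ∀ k : ℕ+, D (x k) = ((k : ℕ) : A) * x k) (n : ℕ) :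
    D (completeHom x n) = (n : A) * completeHom x n := by
  rw [derivation_completeHom, completeHom_newton]
  refine Finset.sum_congr rfl fun p _ => ?_
  congr 1
  split_ifs with h
  · obtain ⟨j, hj⟩ : ∃ j : ℕ+, j = ⟨p.1, h⟩ := ⟨_, rfl⟩
    have hj' : p.1 = j := by rw [hj]; rfl
    rw [← hj, hj', hx, ← nsmul_eq_mul, ← Nat.cast_smul_eq_nsmul ℚ, smul_smul,
      one_div_mul_cancel (by positivity), one_smul]
  · rfl

end DerivationCompleteHom

/-! ### Vertex operators -/

section Vertex

/-- The polynomial `h_n(ε p)` for an integer `n`; it vanishes for negative `n`. -/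
def completeFock (ε n : ℤ) : Fock :=
  if 0 ≤ n then completeHom (fun k : ℕ+ => (ε : Fock) * MvPolynomial.X k) n.toNat else 0

variable (ε : ℤ)

theorem completeFock_natCast (n : ℕ) :
    completeFock ε n = completeHom (fun k : ℕ+ => (ε : Fock) * MvPolynomial.X k) n := by
  rw [completeFock, if_pos (Int.natCast_nonneg n), Int.toNat_natCast]

theorem completeFock_of_neg {n : ℤ} (hn : n < 0) : completeFock ε n = 0 :=
  if_neg (not_le.mpr hn)

theorem sum_antidiagonal_mul_completeFock (φ : ℕ → Fock) {n N : ℕ} (hN : n ≤ N) :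
    ∑ p ∈ Finset.HasAntidiagonal.antidiagonal n, φ p.1
        * completeHom (fun k : ℕ+ => (ε : Fock) * MvPolynomial.X k) p.2
      = ∑ i ∈ Finset.range (N + 1), φ i * completeFock ε (n - i) := by
  rw [Finset.Nat.sum_antidiagonal_eq_sum_range_succ_mk]
  rw [← Finset.sum_subset (Finset.range_subset_range.mpr (Nat.succ_le_succ hN))]
  · refine Finset.sum_congr rfl fun i hi => ?_
    rw [Finset.mem_range] at hi
    rw [← completeFock_natCast, Nat.cast_sub (by omega)]
  · intro i _ hi
    rw [Finset.mem_range] at hi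
    rw [completeFock_of_neg ε (by omega), mul_zero]

theorem smul_var (i : ℕ) : (if h : 0 < i then (ε : Fock) * MvPolynomial.X ⟨i, h⟩ else 0)
    = (ε : Fock) * var i := by
  rw [var]
  split_ifs <;> simp

theorem completeFock_newton {n : ℤ} {N : ℕ} (hN : n ≤ N) :
    (n : Fock) * completeFock ε n
      = ε * ∑ i ∈ Finset.range (N + 1), var i * completeFock ε (n - i) := by
  rcases lt_or_ge n 0 with hn | hn
  · rw [completeFock_of_neg ε hn, Finset.sum_eq_zero fun i _ => by
      rw [completeFock_of_neg ε (by omega), mul_zero], mul_zero, mul_zero]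
  · obtain ⟨n, rfl⟩ := Int.eq_ofNat_of_zero_le hn
    rw [completeFock_natCast, Int.cast_natCast, completeHom_newton]
    simp only [smul_var]
    rw [sum_antidiagonal_mul_completeFock ε (fun i => (ε : Fock) * var i) (N := N) (by omega),
      Finset.mul_sum]
    exact Finset.sum_congr rfl fun i _ => by rw [mul_assoc]

theorem shiftDer_completeHom (k n : ℕ) :
    shiftDer k (completeHom (fun k : ℕ+ => (ε : Fock) * MvPolynomial.X k) n)
      = ∑ p ∈ Finset.HasAntidiagonal.antidiagonal n,
        ((ε : Fock) * if 0 < p.1 then var (k + p.1) else 0)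
          * completeHom (fun k : ℕ+ => (ε : Fock) * MvPolynomial.X k) p.2 := by
  rw [derivation_completeHom]
  refine Finset.sum_congr rfl fun p _ => ?_
  congr 1
  split_ifs with h
  · obtain ⟨j, hj⟩ : ∃ j : ℕ+, j = ⟨p.1, h⟩ := ⟨_, rfl⟩
    have hj' : p.1 = j := by rw [hj]; rfl
    rw [← hj, hj', ← zsmul_eq_mul, ← zsmul_eq_mul, map_zsmul, ← var_coe, shiftDer_var, smul_comm,
      ← nsmul_eq_mul, ← Nat.cast_smul_eq_nsmul ℚ, smul_smul, one_div_mul_cancel (by positivity),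
      one_smul]
  · rw [mul_zero]

theorem shiftDer_completeFock (k : ℕ) {n : ℤ} {N : ℕ} (hN : n ≤ N) :
    shiftDer k (completeFock ε n)
      = ε * ∑ j ∈ Finset.range N, var (k + 1 + j) * completeFock ε (n - 1 - j) := by
  rcases lt_or_ge n 0 with hn | hn
  · rw [completeFock_of_neg ε hn, Finset.sum_eq_zero fun i _ => by
      rw [completeFock_of_neg ε (by omega), mul_zero], mul_zero, map_zero]
  · obtain ⟨n, rfl⟩ := Int.eq_ofNat_of_zero_le hn
    rw [completeFock_natCast, shiftDer_completeHom, sum_antidiagonal_mul_completeFock ε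
      (fun i => (ε : Fock) * if 0 < i then var (k + i) else 0) (N := N) (by omega),
      Finset.sum_range_succ', if_neg (lt_irrefl 0), mul_zero, zero_mul, add_zero, Finset.mul_sum]
    refine Finset.sum_congr rfl fun i _ => ?_
    rw [if_pos (Nat.succ_pos i), mul_assoc, show k + 1 + i = k + (i + 1) by ring]
    congr 3
    push_cast
    ring

/-- Newton's identity, split into the variables up to `p_k` and the later ones. -/
theorem shiftDer_add_completeFock (k : ℕ) (n : ℤ) :
    shiftDer k (completeFock ε n)
        + ε * ∑ i ∈ Finset.range (k + 1), var i * completeFock ε (n + k - i)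
      = ((n + k : ℤ) : Fock) * completeFock ε (n + k) := by
  rw [completeFock_newton ε (N := k + n.toNat) (by push_cast; omega),
    show k + n.toNat + 1 = k + 1 + n.toNat by ring, Finset.sum_range_add _ (k + 1),
    shiftDer_completeFock ε k (N := n.toNat) (by omega)]
  have h : ∀ j : ℕ, n + k - ((k + 1 + j : ℕ) : ℤ) = n - 1 - j := fun j => by
    push_cast
    ring
  simp only [h]
  ring

theorem shiftDer_zero_completeFock (n : ℤ) :
    shiftDer 0 (completeFock ε n) = (n : Fock) * completeFock ε n := by
  have h := shiftDer_add_completeFock ε 0 n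
  rw [Finset.sum_range_one, var_zero, zero_mul, mul_zero, add_zero] at h
  simpa using h

theorem sum_antidiagonal_assoc {M : Type*} [AddCommMonoid M] (f : ℕ → ℕ → ℕ → M) (n : ℕ) :
    ∑ p ∈ Finset.HasAntidiagonal.antidiagonal n,
        ∑ q ∈ Finset.HasAntidiagonal.antidiagonal p.2, f p.1 q.1 q.2
      = ∑ p ∈ Finset.HasAntidiagonal.antidiagonal n,
        ∑ q ∈ Finset.HasAntidiagonal.antidiagonal p.1, f q.1 q.2 p.2 := by
  rw [Finset.sum_sigma', Finset.sum_sigma']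
  refine Finset.sum_bij' (fun x _ => ⟨(x.1.1 + x.2.1, x.2.2), (x.1.1, x.2.1)⟩)
    (fun x _ => ⟨(x.2.1, x.2.2 + x.1.2), (x.2.2, x.1.2)⟩) ?_ ?_ ?_ ?_ ?_
  · rintro ⟨⟨a, b⟩, ⟨c, d⟩⟩ h
    simp only [Finset.mem_sigma, Finset.HasAntidiagonal.mem_antidiagonal] at h ⊢
    exact ⟨by omega, trivial⟩
  · rintro ⟨⟨a, b⟩, ⟨c, d⟩⟩ h
    simp only [Finset.mem_sigma, Finset.HasAntidiagonal.mem_antidiagonal] at h ⊢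
    exact ⟨by omega, trivial⟩
  · rintro ⟨⟨a, b⟩, ⟨c, d⟩⟩ h
    simp only [Finset.mem_sigma, Finset.HasAntidiagonal.mem_antidiagonal] at h
    obtain ⟨-, rfl⟩ := h
    rfl
  · rintro ⟨⟨a, b⟩, ⟨c, d⟩⟩ h
    simp only [Finset.mem_sigma, Finset.HasAntidiagonal.mem_antidiagonal] at h
    obtain ⟨-, rfl⟩ := h
    rfl
  · rintro ⟨⟨a, b⟩, ⟨c, d⟩⟩ h
    rfl

theorem sum_antidiagonal_fst_of_pos (b : ℕ) :
    ∑ q ∈ Finset.HasAntidiagonal.antidiagonal b,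
      2 * (q.1 : Fock) * (if 0 < q.2 then 1 else 0) = (b : Fock) * (b - 1) := by
  rw [Finset.Nat.sum_antidiagonal_eq_sum_range_succ_mk, Finset.sum_range_succ, Nat.sub_self,
    if_neg (lt_irrefl 0), mul_zero, add_zero]
  have h : ∀ i ∈ Finset.range b, 2 * (i : Fock) * (if 0 < b - i then 1 else 0)
      = (i : Fock) * 2 := by
    intro i hi
    rw [if_pos (Nat.sub_pos_of_lt (Finset.mem_range.mp hi)), mul_one, mul_comm]
  rw [Finset.sum_congr rfl h, ← Finset.sum_mul]
  have h2 := congrArg (Nat.cast (R := Fock)) (Finset.sum_range_id_mul_two b)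
  cases b with
  | zero => simp
  | succ b =>
    push_cast at h2 ⊢
    rw [h2]
    simp

variable {ε} in
/-- The complete homogeneous polynomials are eigenvectors of the cut-and-join operator: their
generating series `exp (ε ∑ p_k z^k / k)` satisfies a differential equation in `z`. -/
theorem cutJoinFock_completeHom (hε : ε * ε = 1) (n : ℕ) :
    cutJoinFock (completeHom (fun k : ℕ+ => (ε : Fock) * MvPolynomial.X k) n)
      = ε * ((n : Fock) * (n - 1))
        * completeHom (fun k : ℕ+ => (ε : Fock) * MvPolynomial.X k) n := by
  have hε' : (ε : Fock) * ε = 1 := by exact_mod_cast congrArg (Int.cast (R := Fock)) hε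
  set h : ℕ → Fock := completeHom (fun k : ℕ+ => (ε : Fock) * MvPolynomial.X k) with hh
  have newton : ∀ n : ℕ, (n : Fock) * h n
      = ∑ p ∈ Finset.HasAntidiagonal.antidiagonal n, (ε : Fock) * var p.1 * h p.2 := by
    intro n
    rw [hh, completeHom_newton]
    simp only [smul_var]
  induction n using Nat.strong_induction_on with
  | _ n ih =>
    rcases Nat.eq_zero_or_pos n with rfl | hn
    · rw [hh, completeHom_zero, cutJoinFock_one]
      simp
    refine eq_of_natCast_mul_eq hn.ne' ?_
    have h1 : (n : Fock) * cutJoinFock (h n) = cutJoinFock ((n : Fock) * h n) := by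
      rw [← nsmul_eq_mul, ← nsmul_eq_mul, map_nsmul]
    have h2 : ∀ p ∈ Finset.HasAntidiagonal.antidiagonal n,
        cutJoinFock ((ε : Fock) * var p.1 * h p.2)
          = var p.1 * h p.2 * ((p.2 : Fock) * (p.2 - 1))
            + ε * ((p.1 : Fock) * quad p.1 * h p.2)
            + ε * (2 * (p.1 : Fock) * shiftDer p.1 (h p.2)) := by
      intro p hp
      rw [Finset.HasAntidiagonal.mem_antidiagonal] at hp
      rw [mul_assoc, ← zsmul_eq_mul, map_zsmul, zsmul_eq_mul, cutJoinFock_var_mul]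
      rcases Nat.eq_zero_or_pos p.1 with h0 | h0
      · rw [h0, var_zero, Nat.cast_zero]
        ring
      · rw [ih p.2 (by omega)]
        linear_combination (var p.1 * (p.2 : Fock) * (p.2 - 1) * h p.2) * hε'
    have h3 : ∑ p ∈ Finset.HasAntidiagonal.antidiagonal n, (p.1 : Fock) * quad p.1 * h p.2
        = ∑ p ∈ Finset.HasAntidiagonal.antidiagonal n,
          2 * ε * (p.1 : Fock) * p.2 * (var p.1 * h p.2) := by
      have e1 : ∀ p ∈ Finset.HasAntidiagonal.antidiagonal n, (p.1 : Fock) * quad p.1 * h p.2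
          = ∑ q ∈ Finset.HasAntidiagonal.antidiagonal p.1,
            2 * ((q.1 : Fock) * var q.1 * (var q.2 * h p.2)) := by
        intro p _
        have e2 : ∑ q ∈ Finset.HasAntidiagonal.antidiagonal p.1, (q.1 : Fock) * (var q.1 * var q.2)
            = ∑ q ∈ Finset.HasAntidiagonal.antidiagonal p.1,
              (q.2 : Fock) * (var q.1 * var q.2) := by
          rw [← Finset.Nat.sum_antidiagonal_swap]
          exact Finset.sum_congr rfl fun q _ => by
            rw [Prod.fst_swap, Prod.snd_swap, mul_comm (var q.2)]
        have e3 : (p.1 : Fock) * quad p.1 = ∑ q ∈ Finset.HasAntidiagonal.antidiagonal p.1,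
              (q.1 : Fock) * (var q.1 * var q.2)
            + ∑ q ∈ Finset.HasAntidiagonal.antidiagonal p.1,
              (q.2 : Fock) * (var q.1 * var q.2) := by
          rw [quad, Finset.mul_sum, ← Finset.sum_add_distrib]
          refine Finset.sum_congr rfl fun q hq => ?_
          rw [← Finset.HasAntidiagonal.mem_antidiagonal.mp hq, Nat.cast_add, add_mul]
        rw [e3, ← e2, add_mul, Finset.sum_mul, ← Finset.sum_add_distrib]
        exact Finset.sum_congr rfl fun q _ => by ring
      rw [Finset.sum_congr rfl e1, ← sum_antidiagonal_assoc
        fun a b c => 2 * ((a : Fock) * var a * (var b * h c))]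
      refine Finset.sum_congr rfl fun p _ => ?_
      rw [← Finset.mul_sum, ← Finset.mul_sum]
      have e4 : ∑ q ∈ Finset.HasAntidiagonal.antidiagonal p.2, var q.1 * h q.2
          = ε * ((p.2 : Fock) * h p.2) := by
        rw [newton, Finset.mul_sum]
        exact Finset.sum_congr rfl fun q _ => by
          rw [mul_assoc, ← mul_assoc (ε : Fock) ε, hε', one_mul]
      rw [e4]
      ring
    have h4 : ∑ p ∈ Finset.HasAntidiagonal.antidiagonal n,
        2 * (p.1 : Fock) * shiftDer p.1 (h p.2)
        = ∑ p ∈ Finset.HasAntidiagonal.antidiagonal n,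
          ε * ((p.1 : Fock) * (p.1 - 1)) * (var p.1 * h p.2) := by
      have e1 : ∀ p ∈ Finset.HasAntidiagonal.antidiagonal n,
          2 * (p.1 : Fock) * shiftDer p.1 (h p.2)
          = ∑ q ∈ Finset.HasAntidiagonal.antidiagonal p.2,
            2 * (p.1 : Fock) * (if 0 < q.1 then 1 else 0) * (ε * (var (p.1 + q.1) * h q.2)) := by
        intro p _
        rw [hh, shiftDer_completeHom, Finset.mul_sum]
        refine Finset.sum_congr rfl fun q _ => ?_
        split_ifs <;> ring
      rw [Finset.sum_congr rfl e1, sum_antidiagonal_assoc fun a b c =>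
        2 * (a : Fock) * (if 0 < b then 1 else 0) * (ε * (var (a + b) * h c))]
      refine Finset.sum_congr rfl fun p _ => ?_
      have e2 : ∀ q ∈ Finset.HasAntidiagonal.antidiagonal p.1,
          2 * (q.1 : Fock) * (if 0 < q.2 then 1 else 0) * (ε * (var (q.1 + q.2) * h p.2))
          = 2 * (q.1 : Fock) * (if 0 < q.2 then 1 else 0) * (ε * (var p.1 * h p.2)) := by
        intro q hq
        rw [Finset.HasAntidiagonal.mem_antidiagonal.mp hq]
      rw [Finset.sum_congr rfl e2, ← Finset.sum_mul, sum_antidiagonal_fst_of_pos]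
      ring
    rw [h1, newton, map_sum, Finset.sum_congr rfl h2, Finset.sum_add_distrib,
      Finset.sum_add_distrib, ← Finset.mul_sum, ← Finset.mul_sum, h3, h4, Finset.mul_sum,
      Finset.mul_sum, ← Finset.sum_add_distrib, ← Finset.sum_add_distrib,
      show (n : Fock) * (ε * ((n : Fock) * (n - 1)) * h n)
        = ε * ((n : Fock) * (n - 1)) * ((n : Fock) * h n) by ring, newton, Finset.mul_sum]
    refine Finset.sum_congr rfl fun p hp => ?_
    rw [← Finset.HasAntidiagonal.mem_antidiagonal.mp hp]
    push_cast
    linear_combination (var p.1 * h p.2 * (2 * p.1 * p.2 + p.1 * (p.1 - 1)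
      - ((p.1 + p.2) * (p.1 + p.2 - 1)))) * hε'

variable {ε} in
theorem cutJoinFock_completeFock (hε : ε * ε = 1) (n : ℤ) :
    cutJoinFock (completeFock ε n) = ε * ((n : Fock) * (n - 1)) * completeFock ε n := by
  rcases lt_or_ge n 0 with hn | hn
  · rw [completeFock_of_neg ε hn, map_zero, mul_zero]
  · obtain ⟨n, rfl⟩ := Int.eq_ofNat_of_zero_le hn
    rw [completeFock_natCast, cutJoinFock_completeHom hε, Int.cast_natCast]

end Vertex

/-! ### Commutation of vertex operators with the cut-and-join operator -/

section VertexOperators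

variable (ε : ℤ)

/-- The substitution `p_k ↦ p_k - ε u^k`. -/
def shiftHom : Fock →ₐ[ℚ] Polynomial Fock :=
  MvPolynomial.aeval fun k : ℕ+ =>
    Polynomial.C (MvPolynomial.X k) - (ε : Polynomial Fock) * Polynomial.X ^ (k : ℕ)

theorem shiftHom_var {k : ℕ} (hk : 0 < k) :
    shiftHom ε (var k) = Polynomial.C (var k) - (ε : Polynomial Fock) * Polynomial.X ^ k := by
  obtain ⟨i, rfl⟩ : ∃ i : ℕ+, (i : ℕ) = k := ⟨⟨k, hk⟩, rfl⟩
  rw [var_coe, shiftHom, MvPolynomial.aeval_X]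

/-- The coefficient of `u^{-n}` in the product of `∑_i h_i(ε p) u^{-i}` with a polynomial in `u`. -/
def completePairing (n : ℤ) : Polynomial Fock →ₗ[Fock] Fock :=
  Polynomial.lsum fun j => LinearMap.mulRight Fock (completeFock ε (n + j))

theorem completePairing_monomial (n : ℤ) (j : ℕ) (a : Fock) :
    completePairing ε n (Polynomial.monomial j a) = a * completeFock ε (n + j) := by
  rw [completePairing, Polynomial.lsum_apply, Polynomial.sum_monomial_index]
  · rfl
  · exact map_zero _

theorem completePairing_C_mul (n : ℤ) (a : Fock) (P : Polynomial Fock) :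
    completePairing ε n (Polynomial.C a * P) = a * completePairing ε n P := by
  rw [← Polynomial.smul_eq_C_mul, map_smul, smul_eq_mul]

theorem completePairing_X_pow_mul (n : ℤ) (k : ℕ) (P : Polynomial Fock) :
    completePairing ε n (Polynomial.X ^ k * P) = completePairing ε (n + k) P := by
  induction P using Polynomial.induction_on' with
  | add P Q hP hQ => rw [mul_add, map_add, map_add, hP, hQ]
  | monomial j a =>
    rw [Polynomial.X_pow_mul_monomial, completePairing_monomial, completePairing_monomial]
    congr 2
    push_cast
    ring

/-- The coefficient of `z^n` in the vertex operator
`exp (ε ∑ p_k z^k / k) exp (-ε ∑ z^{-k} ∂/∂p_k)`. -/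
def vertexOp (n : ℤ) : Fock →ₗ[ℚ] Fock :=
  (completePairing ε n).restrictScalars ℚ ∘ₗ (shiftHom ε).toLinearMap

theorem vertexOp_apply (n : ℤ) (f : Fock) :
    vertexOp ε n f = completePairing ε n (shiftHom ε f) := rfl

theorem vertexOp_one (n : ℤ) : vertexOp ε n 1 = completeFock ε n := by
  rw [vertexOp_apply, map_one, ← Polynomial.monomial_zero_one, completePairing_monomial, one_mul,
    Nat.cast_zero, add_zero]

theorem vertexOp_var_mul (n : ℤ) {k : ℕ} (hk : 0 < k) (f : Fock) :
    vertexOp ε n (var k * f) = var k * vertexOp ε n f - ε * vertexOp ε (n + k) f := by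
  rw [vertexOp_apply, map_mul, shiftHom_var ε hk, sub_mul, map_sub, completePairing_C_mul,
    mul_assoc, ← zsmul_eq_mul, map_zsmul, completePairing_X_pow_mul, zsmul_eq_mul]
  rfl

theorem fock_induction {P : Fock → Prop} (h1 : P 1) (hs : ∀ (c : ℚ) f, P f → P (c • f))
    (ha : ∀ f g, P f → P g → P (f + g)) (hv : ∀ k f, 0 < k → P f → P (var k * f)) (f : Fock) :
    P f := by
  induction f using MvPolynomial.induction_on with
  | C a =>
    have h := hs a 1 h1
    rwa [MvPolynomial.smul_eq_C_mul, mul_one] at h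
  | add f g hf hg => exact ha f g hf hg
  | mul_X f k hf =>
    rw [mul_comm, ← var_coe]
    exact hv k f k.pos hf

variable {ε} in
theorem vertexOp_quad (hε : ε * ε = 1) (n : ℤ) {k : ℕ} (hk : 0 < k) :
    vertexOp ε n (quad k) = quad k * completeFock ε n
      - 2 * ε * ∑ i ∈ Finset.range (k + 1), var i * completeFock ε (n + k - i)
      + ((k : Fock) - 1) * completeFock ε (n + k) + 2 * ε * (var k * completeFock ε n) := by
  have hε' : (ε : Fock) * ε = 1 := by exact_mod_cast congrArg (Int.cast (R := Fock)) hε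
  -- the conditional terms make up for `p_0 = 0`, which breaks the commutation rule of `vertexOp`
  -- with multiplication by `p_k` for `k = 0`
  have hterm : ∀ p ∈ Finset.HasAntidiagonal.antidiagonal k, vertexOp ε n (var p.1 * var p.2)
      = var p.1 * var p.2 * completeFock ε n
        - ε * (var p.2 * completeFock ε (n + k - p.2))
        - ε * (var p.1 * completeFock ε (n + k - p.1)) + completeFock ε (n + k)
        - (if p.1 = 0 then completeFock ε (n + k) - ε * (var k * completeFock ε n) else 0)
        - (if p.2 = 0 then completeFock ε (n + k) - ε * (var k * completeFock ε n) else 0) := by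
    rintro ⟨i, j⟩ hp
    have hij : i + j = k := Finset.HasAntidiagonal.mem_antidiagonal.mp hp
    simp only
    rcases Nat.eq_zero_or_pos i with rfl | hi
    · rw [zero_add] at hij
      subst hij
      rw [if_pos rfl, if_neg hk.ne', var_zero, zero_mul, map_zero,
        show n + (j : ℤ) - j = n by ring]
      ring
    · rcases Nat.eq_zero_or_pos j with rfl | hj
      · rw [add_zero] at hij
        subst hij
        rw [if_pos rfl, if_neg hk.ne', var_zero, mul_zero, map_zero,
          show n + (i : ℤ) - i = n by ring]
        ring
      · have h2 : vertexOp ε n (var j) = var j * completeFock ε n - ε * completeFock ε (n + j) := by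
          rw [← vertexOp_one, ← vertexOp_one, ← vertexOp_var_mul ε n hj, mul_one]
        have h3 : vertexOp ε (n + i) (var j)
            = var j * completeFock ε (n + i) - ε * completeFock ε (n + i + j) := by
          rw [← vertexOp_one, ← vertexOp_one, ← vertexOp_var_mul ε _ hj, mul_one]
        rw [if_neg hi.ne', if_neg hj.ne', vertexOp_var_mul ε n hi, h2, h3, ← hij,
          show n + ((i + j : ℕ) : ℤ) - j = n + i by push_cast; ring,
          show n + ((i + j : ℕ) : ℤ) - i = n + j by push_cast; ring,
          show n + ((i + j : ℕ) : ℤ) = n + i + j by push_cast; ring]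
        linear_combination completeFock ε (n + i + j) * hε'
  have hswap : ∑ p ∈ Finset.HasAntidiagonal.antidiagonal k, var p.2 * completeFock ε (n + k - p.2)
      = ∑ p ∈ Finset.HasAntidiagonal.antidiagonal k, var p.1 * completeFock ε (n + k - p.1) :=
    Finset.Nat.sum_antidiagonal_swap (f := fun p : ℕ × ℕ => var p.1 * completeFock ε (n + k - p.1))
  have hrange : ∑ p ∈ Finset.HasAntidiagonal.antidiagonal k,
      var p.1 * completeFock ε (n + k - p.1)
      = ∑ i ∈ Finset.range (k + 1), var i * completeFock ε (n + k - i) :=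
    Finset.Nat.sum_antidiagonal_eq_sum_range_succ_mk _ _
  have hfst : ∀ t : Fock, ∑ p ∈ Finset.HasAntidiagonal.antidiagonal k,
      (if p.1 = 0 then t else 0) = t := by
    intro t
    rw [Finset.Nat.sum_antidiagonal_eq_sum_range_succ_mk, Finset.sum_ite_eq' _ 0 fun _ => t,
      if_pos (Finset.mem_range.mpr (Nat.succ_pos k))]
  have hsnd : ∀ t : Fock, ∑ p ∈ Finset.HasAntidiagonal.antidiagonal k,
      (if p.2 = 0 then t else 0) = t := fun t =>
    (Finset.Nat.sum_antidiagonal_swap (f := fun p : ℕ × ℕ => if p.1 = 0 then t else 0)).trans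
      (hfst t)
  rw [quad, map_sum, Finset.sum_congr rfl hterm, Finset.sum_sub_distrib, Finset.sum_sub_distrib,
    Finset.sum_add_distrib, Finset.sum_sub_distrib, Finset.sum_sub_distrib, hfst, hsnd,
    ← Finset.mul_sum, ← Finset.mul_sum, hswap, hrange, ← Finset.sum_mul, Finset.sum_const,
    Finset.Nat.card_antidiagonal, nsmul_eq_mul]
  push_cast
  ring

variable {ε} in
/-- The commutator of a vertex operator with `∑_{i+j=k} p_i p_j + 2 ∑_j j p_{k+j} ∂/∂p_j`, which is
twice the commutator of the cut-and-join operator with multiplication by `p_k / k`. -/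
theorem vertexOp_commutator (hε : ε * ε = 1) {k : ℕ} (hk : 0 < k) (f : Fock) : ∀ n : ℤ,
    quad k * vertexOp ε n f + 2 * shiftDer k (vertexOp ε n f)
        - vertexOp ε n (quad k * f + 2 * shiftDer k f) + 2 * ε * (var k * vertexOp ε n f)
      = (2 * n + k + 1) * vertexOp ε (n + k) f := by
  have hε' : (ε : Fock) * ε = 1 := by exact_mod_cast congrArg (Int.cast (R := Fock)) hε
  have h2 : ∀ n g, vertexOp ε n (2 * g) = 2 * vertexOp ε n g := fun n g => by
    rw [two_mul, map_add, two_mul]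
  have hz : ∀ (n : ℤ) (m : ℤ) g, vertexOp ε n ((m : Fock) * g) = m * vertexOp ε n g :=
    fun n m g => by rw [← zsmul_eq_mul, map_zsmul, zsmul_eq_mul]
  have hD : ∀ (m : ℤ) g, shiftDer k ((m : Fock) * g) = m * shiftDer k g :=
    fun m g => by rw [← zsmul_eq_mul, map_zsmul, zsmul_eq_mul]
  induction f using fock_induction with
  | h1 =>
    intro n
    have h := shiftDer_add_completeFock ε k n
    rw [Derivation.map_one_eq_zero, mul_zero, add_zero, mul_one, vertexOp_quad hε n hk,
      vertexOp_one, vertexOp_one]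
    push_cast at h
    linear_combination 2 * h
  | hs c f hf =>
    intro n
    have h := hf n
    simp only [Derivation.map_smul, map_smul, mul_smul_comm, ← smul_add, ← smul_sub, h]
  | ha f g hf hg =>
    intro n
    have e1 := hf n
    have e2 := hg n
    simp only [map_add, mul_add] at e1 e2 ⊢
    linear_combination e1 + e2
  | hv l f hl hf =>
    intro n
    have e1 := hf n
    have e2 := hf (n + l)
    have e3 : quad k * (var l * f) + 2 * shiftDer k (var l * f)
        = var l * (quad k * f + 2 * shiftDer k f) + 2 * ((l : ℤ) * (var (k + l) * f)) := by
      rw [Derivation.leibniz, shiftDer_var, smul_eq_mul, smul_eq_mul]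
      push_cast
      ring
    rw [e3, map_add, h2, hz, vertexOp_var_mul ε n hl, vertexOp_var_mul ε n hl,
      vertexOp_var_mul ε n (k := k + l) (by omega), vertexOp_var_mul ε (n + k) hl, map_sub, hD,
      Derivation.leibniz, shiftDer_var, smul_eq_mul, smul_eq_mul]
    rw [show n + ((k + l : ℕ) : ℤ) = n + l + k by push_cast; ring,
      show n + (k : ℤ) + l = n + l + k by ring]
    push_cast at e1 e2 ⊢
    linear_combination var l * e1 - ε * e2

variable {ε} in
/-- The cut-and-join operator commutes with a vertex operator up to the Euler operator and a scalar.
Up to the sign `ε`, the scalar is invariant under `n ↦ -1 - n`. -/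
theorem vertexOp_cutJoinFock (hε : ε * ε = 1) (f : Fock) : ∀ n : ℤ,
    cutJoinFock (vertexOp ε n f) + 2 * ε * shiftDer 0 (vertexOp ε n f)
        - vertexOp ε n (cutJoinFock f)
      = ε * ((n : Fock) * (n + 1)) * vertexOp ε n f := by
  have hε' : (ε : Fock) * ε = 1 := by exact_mod_cast congrArg (Int.cast (R := Fock)) hε
  have hz : ∀ (n : ℤ) (m : ℕ) g, vertexOp ε n ((m : Fock) * g) = m * vertexOp ε n g :=
    fun n m g => by rw [← nsmul_eq_mul, map_nsmul, nsmul_eq_mul]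
  have hD : ∀ (m : ℤ) g, shiftDer 0 ((m : Fock) * g) = m * shiftDer 0 g :=
    fun m g => by rw [← zsmul_eq_mul, map_zsmul, zsmul_eq_mul]
  have hM : ∀ (m : ℤ) g, cutJoinFock ((m : Fock) * g) = m * cutJoinFock g :=
    fun m g => by rw [← zsmul_eq_mul, map_zsmul, zsmul_eq_mul]
  induction f using fock_induction with
  | h1 =>
    intro n
    rw [vertexOp_one, cutJoinFock_one, map_zero, cutJoinFock_completeFock hε,
      shiftDer_zero_completeFock]
    ring
  | hs c f hf =>
    intro n
    have h := hf n
    simp only [Derivation.map_smul, map_smul, mul_smul_comm, ← smul_add, ← smul_sub, h]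
  | ha f g hf hg =>
    intro n
    have e1 := hf n
    have e2 := hg n
    simp only [map_add, mul_add] at e1 e2 ⊢
    linear_combination e1 + e2
  | hv k f hk hf =>
    intro n
    have e1 := hf n
    have e2 := hf (n + k)
    have e3 := vertexOp_commutator hε hk f n
    rw [cutJoinFock_var_mul, map_add, hz, vertexOp_var_mul ε n hk, vertexOp_var_mul ε n hk, map_sub,
      cutJoinFock_var_mul, hM, map_sub, hD, Derivation.leibniz, shiftDer_var, zero_add,
      smul_eq_mul, smul_eq_mul]
    push_cast at e1 e2 e3 ⊢
    linear_combination var k * e1 - ε * e2 + k * e3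
      - (k * (2 * n + k + 1) * vertexOp ε (n + k) f) * hε'

end VertexOperators

/-! ### The bilinear form of the Hirota equations -/

section Bilinear

open scoped TensorProduct

/-- The polynomials in two copies of the variables. -/
abbrev Fock2 := MvPolynomial TwoCopies ℚ

/-- The operator `∑_n ψ_n ⊗ ψ*_{-1-n}` made of the two kinds of vertex operators, truncated to
`-N ≤ n < N`. -/
def vertexPairing (N : ℕ) : Module.End ℚ (Fock ⊗[ℚ] Fock) :=
  ∑ n ∈ Finset.Ico (-(N : ℤ)) N, TensorProduct.map (vertexOp 1 n) (vertexOp (-1) (-1 - n))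

theorem vertexPairing_tmul (N : ℕ) (f g : Fock) :
    vertexPairing N (f ⊗ₜ g)
      = ∑ n ∈ Finset.Ico (-(N : ℤ)) N, vertexOp 1 n f ⊗ₜ[ℚ] vertexOp (-1) (-1 - n) g := by
  rw [vertexPairing, LinearMap.sum_apply]
  simp only [TensorProduct.map_tmul]

/-- The Euler operator that multiplies a monomial by its weight, as a linear map. -/
def eulerFock : Module.End ℚ Fock := (shiftDer 0).toLinearMap

theorem eulerFock_apply (f : Fock) : eulerFock f = shiftDer 0 f := rfl

/-- The infinitesimal symmetry: the vertex operators intertwine the diagonal action of the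
cut-and-join operator with an action on the tensor square. The scalars `± n (n + 1)` that appear
in the two factors cancel because `n (n + 1)` is invariant under `n ↦ -1 - n`. -/
theorem semiconjBy_vertexPairing (N : ℕ) :
    SemiconjBy (vertexPairing N)
      (TensorProduct.map cutJoinFock LinearMap.id + TensorProduct.map LinearMap.id cutJoinFock)
      (TensorProduct.map (cutJoinFock + 2 • eulerFock) LinearMap.id
        + TensorProduct.map LinearMap.id (cutJoinFock - 2 • eulerFock)) := by
  refine TensorProduct.ext' fun f g => ?_
  simp only [Module.End.mul_apply, LinearMap.add_apply, map_add, TensorProduct.map_tmul,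
    LinearMap.id_apply, vertexPairing_tmul, map_sum]
  rw [← Finset.sum_add_distrib]
  refine Finset.sum_congr rfl fun n _ => ?_
  have h1 : cutJoinFock (vertexOp 1 n f) + (2 • eulerFock) (vertexOp 1 n f)
      = vertexOp 1 n (cutJoinFock f) + (n * (n + 1) : ℤ) • vertexOp 1 n f := by
    have h := vertexOp_cutJoinFock (ε := 1) (by norm_num) f n
    rw [LinearMap.smul_apply, eulerFock_apply, zsmul_eq_mul, nsmul_eq_mul]
    push_cast at h ⊢
    linear_combination h
  have h2 : (cutJoinFock - 2 • eulerFock) (vertexOp (-1) (-1 - n) g)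
      = vertexOp (-1) (-1 - n) (cutJoinFock g)
        - (n * (n + 1) : ℤ) • vertexOp (-1) (-1 - n) g := by
    have h := vertexOp_cutJoinFock (ε := -1) (by norm_num) g (-1 - n)
    rw [LinearMap.sub_apply, LinearMap.smul_apply, eulerFock_apply, zsmul_eq_mul, nsmul_eq_mul]
    push_cast at h ⊢
    linear_combination h
  rw [h1, h2, TensorProduct.add_tmul, TensorProduct.tmul_sub, TensorProduct.smul_tmul]
  abel

theorem vertexPairing_sum_eq_zero {N : ℕ} {v : Fock ⊗[ℚ] Fock} (hv : vertexPairing N v = 0)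
    (m : ℕ) : vertexPairing N (∑ p ∈ Finset.HasAntidiagonal.antidiagonal m,
      m.choose p.1 • TensorProduct.map (cutJoinFock ^ p.1) (cutJoinFock ^ p.2) v) = 0 := by
  have hc : Commute (TensorProduct.map cutJoinFock (LinearMap.id : Module.End ℚ Fock))
      (TensorProduct.map (LinearMap.id : Module.End ℚ Fock) cutJoinFock) := by
    refine TensorProduct.ext' fun f g => ?_
    simp only [Module.End.mul_apply, TensorProduct.map_tmul, LinearMap.id_apply]
  have h1 := congrArg (fun L : Module.End ℚ (Fock ⊗[ℚ] Fock) => L v)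
    ((semiconjBy_vertexPairing N).pow_right m).eq
  rw [hc.add_pow'] at h1
  simp only [Module.End.mul_apply, hv, map_zero] at h1
  rw [← h1]
  congr 1
  rw [LinearMap.sum_apply]
  refine Finset.sum_congr rfl fun p _ => ?_
  rw [LinearMap.smul_apply, TensorProduct.map_pow, TensorProduct.map_pow, ← TensorProduct.map_mul]
  rw [← Module.End.one_eq_id, one_pow, one_pow, mul_one, one_mul]

/-- The polynomials in `p` among those in `p` and `p'`. -/
def inlFock : Fock →+* Fock2 := (MvPolynomial.rename Sum.inl : Fock →ₐ[ℚ] Fock2).toRingHom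

/-- The polynomials in `p'` among those in `p` and `p'`. -/
def inrFock : Fock →+* Fock2 := (MvPolynomial.rename Sum.inr : Fock →ₐ[ℚ] Fock2).toRingHom

theorem inlFock_X (k : ℕ+) : inlFock (MvPolynomial.X k) = MvPolynomial.X (Sum.inl k) :=
  MvPolynomial.rename_X _ _

theorem inrFock_X (k : ℕ+) : inrFock (MvPolynomial.X k) = MvPolynomial.X (Sum.inr k) :=
  MvPolynomial.rename_X _ _

theorem tensorEquivSum_tmul (f g : Fock) :
    MvPolynomial.tensorEquivSum ℚ ℕ+ ℕ+ ℚ (f ⊗ₜ g) = inlFock f * inrFock g := by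
  have h1 : ((MvPolynomial.tensorEquivSum ℚ ℕ+ ℕ+ ℚ).toAlgHom.comp
      (Algebra.TensorProduct.includeLeft : Fock →ₐ[ℚ] Fock ⊗[ℚ] Fock))
      = MvPolynomial.rename Sum.inl := by
    refine MvPolynomial.algHom_ext fun k => ?_
    rw [MvPolynomial.rename_X]
    exact MvPolynomial.tensorEquivSum_X_tmul_one k
  have h2 : ((MvPolynomial.tensorEquivSum ℚ ℕ+ ℕ+ ℚ).toAlgHom.comp
      (Algebra.TensorProduct.includeRight : Fock →ₐ[ℚ] Fock ⊗[ℚ] Fock))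
      = MvPolynomial.rename Sum.inr := by
    refine MvPolynomial.algHom_ext fun k => ?_
    rw [MvPolynomial.rename_X]
    exact MvPolynomial.tensorEquivSum_one_tmul_X k
  have h3 : f ⊗ₜ[ℚ] g = (f ⊗ₜ 1) * (1 ⊗ₜ g) := by
    rw [Algebra.TensorProduct.tmul_mul_tmul, mul_one, one_mul]
  rw [h3, map_mul]
  exact congrArg₂ _ (congrArg (fun φ : Fock →ₐ[ℚ] Fock2 => φ f) h1)
    (congrArg (fun φ : Fock →ₐ[ℚ] Fock2 => φ g) h2)

/-- The coefficient `h_{j-1}(p - p')` of `u^{-j}` in the exponential factor of the Hirota equations,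
where `z = u⁻¹`. -/
def residueCoeff : ℕ → Fock2
  | 0 => 0
  | j + 1 => completeHom (fun k : ℕ+ =>
      (MvPolynomial.X (Sum.inl k) - MvPolynomial.X (Sum.inr k) : Fock2)) j

/-- The residue `∑_j h_j(p - p') [u^{j+1}] G` of a polynomial `G` in `p`, `p'` and `u`. -/
def residue : Polynomial Fock2 →ₗ[Fock2] Fock2 :=
  Polynomial.lsum fun j => LinearMap.mulRight Fock2 (residueCoeff j)

theorem residue_monomial (j : ℕ) (a : Fock2) :
    residue (Polynomial.monomial j a) = a * residueCoeff j := by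
  rw [residue, Polynomial.lsum_apply, Polynomial.sum_monomial_index]
  · rfl
  · exact map_zero _

theorem residue_C (a : Fock2) : residue (Polynomial.C a) = 0 := by
  rw [← Polynomial.monomial_zero_left, residue_monomial, residueCoeff, mul_zero]

theorem inlFock_completeFock (n : ℕ) : inlFock (completeFock 1 n)
    = completeHom (fun k : ℕ+ => (MvPolynomial.X (Sum.inl k) : Fock2)) n := by
  rw [completeFock_natCast, map_completeHom]
  congr 1
  funext k
  rw [map_mul, map_intCast, inlFock_X, Int.cast_one, one_mul]

theorem inrFock_completeFock (n : ℕ) : inrFock (completeFock (-1) n)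
    = completeHom (fun k : ℕ+ => (-MvPolynomial.X (Sum.inr k) : Fock2)) n := by
  rw [completeFock_natCast, map_completeHom]
  congr 1
  funext k
  rw [map_mul, map_intCast, inrFock_X, Int.cast_neg, Int.cast_one, neg_one_mul]

theorem sum_completeFock_mul {N s t : ℕ} (hs : s ≤ N) (ht : t ≤ N) :
    ∑ n ∈ Finset.Ico (-(N : ℤ)) N,
      inlFock (completeFock 1 (n + s)) * inrFock (completeFock (-1) (-1 - n + t))
      = residueCoeff (s + t) := by
  rcases hst : s + t with _ | j
  · refine Finset.sum_eq_zero fun n _ => ?_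
    rcases lt_or_ge n 0 with hn | hn
    · rw [completeFock_of_neg 1 (by omega), map_zero, zero_mul]
    · rw [completeFock_of_neg (-1) (by omega), map_zero, mul_zero]
  · have hsub : (fun k : ℕ+ => (MvPolynomial.X (Sum.inl k) - MvPolynomial.X (Sum.inr k) : Fock2))
        = (fun k : ℕ+ => (MvPolynomial.X (Sum.inl k) : Fock2))
          + fun k : ℕ+ => (-MvPolynomial.X (Sum.inr k) : Fock2) := by
      funext k
      rw [Pi.add_apply, sub_eq_add_neg]
    rw [residueCoeff, hsub, completeHom_add]
    symm
    refine Finset.sum_of_injOn (fun p => (p.1 : ℤ) - s) ?_ ?_ ?_ ?_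
    · rintro ⟨a, b⟩ h ⟨a', b'⟩ h' e
      rw [Finset.mem_coe, Finset.HasAntidiagonal.mem_antidiagonal] at h h'
      simp only at h h' e
      rw [Prod.mk.injEq]
      omega
    · rintro ⟨a, b⟩ h
      rw [Finset.mem_coe, Finset.HasAntidiagonal.mem_antidiagonal] at h
      simp only at h
      rw [Finset.mem_coe, Finset.mem_Ico]
      constructor <;> simp only <;> omega
    · intro n _ hn
      by_contra h0
      have h1 : 0 ≤ n + s := by
        by_contra h
        exact h0 (by rw [completeFock_of_neg 1 (not_le.mp h), map_zero, zero_mul])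
      have h2 : 0 ≤ -1 - n + t := by
        by_contra h
        exact h0 (by rw [completeFock_of_neg (-1) (not_le.mp h), map_zero, mul_zero])
      refine hn ⟨((n + s).toNat, (-1 - n + t).toNat), ?_, ?_⟩
      · rw [Finset.mem_coe, Finset.HasAntidiagonal.mem_antidiagonal]
        simp only
        omega
      · simp only
        omega
    · rintro ⟨a, b⟩ h
      rw [Finset.HasAntidiagonal.mem_antidiagonal] at h
      simp only at h ⊢
      rw [show (a : ℤ) - s + s = (a : ℕ) by ring, show -1 - ((a : ℤ) - s) + t = (b : ℕ) by omega,
        inlFock_completeFock, inrFock_completeFock]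

theorem completePairing_eq_sum (ε n : ℤ) {P : Polynomial Fock} {N : ℕ} (hP : P.natDegree ≤ N) :
    completePairing ε n P
      = ∑ s ∈ Finset.range (N + 1), P.coeff s * completeFock ε (n + s) := by
  conv_lhs => rw [P.as_sum_range' (N + 1) (Nat.lt_succ_of_le hP)]
  rw [map_sum]
  simp only [completePairing_monomial]

/-- The substitution `p_k ↦ p_k - u^k`. -/
def shiftLeft : Fock →+* Polynomial Fock2 :=
  (Polynomial.mapRingHom inlFock).comp (shiftHom 1).toRingHom

/-- The substitution `p_k ↦ p'_k + u^k`. -/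
def shiftRight : Fock →+* Polynomial Fock2 :=
  (Polynomial.mapRingHom inrFock).comp (shiftHom (-1)).toRingHom

theorem shiftLeft_X (k : ℕ+) : shiftLeft (MvPolynomial.X k)
    = Polynomial.C (MvPolynomial.X (Sum.inl k)) - Polynomial.X ^ (k : ℕ) := by
  change Polynomial.map inlFock (shiftHom 1 (MvPolynomial.X k)) = _
  rw [← var_coe, shiftHom_var 1 k.pos, var_coe]
  simp [inlFock_X]

theorem shiftRight_X (k : ℕ+) : shiftRight (MvPolynomial.X k)
    = Polynomial.C (MvPolynomial.X (Sum.inr k)) + Polynomial.X ^ (k : ℕ) := by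
  change Polynomial.map inrFock (shiftHom (-1) (MvPolynomial.X k)) = _
  rw [← var_coe, shiftHom_var (-1) k.pos, var_coe]
  simp [inrFock_X]

/-- The Hirota residue in terms of vertex operators. -/
theorem tensorEquivSum_vertexPairing {f g : Fock} {N : ℕ} (hf : (shiftHom 1 f).natDegree ≤ N)
    (hg : (shiftHom (-1) g).natDegree ≤ N) :
    MvPolynomial.tensorEquivSum ℚ ℕ+ ℕ+ ℚ (vertexPairing N (f ⊗ₜ g))
      = residue (shiftLeft f * shiftRight g) := by
  have hL : shiftLeft f = ∑ s ∈ Finset.range (N + 1),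
      Polynomial.monomial s (inlFock ((shiftHom 1 f).coeff s)) := by
    change Polynomial.map inlFock (shiftHom 1 f) = _
    conv_lhs => rw [(shiftHom 1 f).as_sum_range' (N + 1) (Nat.lt_succ_of_le hf)]
    rw [Polynomial.map_sum]
    simp only [Polynomial.map_monomial]
  have hR : shiftRight g = ∑ s ∈ Finset.range (N + 1),
      Polynomial.monomial s (inrFock ((shiftHom (-1) g).coeff s)) := by
    change Polynomial.map inrFock (shiftHom (-1) g) = _
    conv_lhs => rw [(shiftHom (-1) g).as_sum_range' (N + 1) (Nat.lt_succ_of_le hg)]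
    rw [Polynomial.map_sum]
    simp only [Polynomial.map_monomial]
  rw [vertexPairing_tmul, map_sum, hL, hR, Finset.sum_mul_sum, map_sum]
  simp only [map_sum, tensorEquivSum_tmul, vertexOp_apply, completePairing_eq_sum _ _ hf,
    completePairing_eq_sum _ _ hg, Finset.sum_mul_sum, Polynomial.monomial_mul_monomial,
    residue_monomial, map_mul]
  rw [Finset.sum_comm]
  refine Finset.sum_congr rfl fun s hs => ?_
  rw [Finset.sum_comm]
  refine Finset.sum_congr rfl fun t ht => ?_
  rw [← sum_completeFock_mul (Nat.lt_succ_iff.mp (Finset.mem_range.mp hs))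
    (Nat.lt_succ_iff.mp (Finset.mem_range.mp ht)), Finset.mul_sum]
  exact Finset.sum_congr rfl fun n _ => by ring

theorem natDegree_shiftHom_monomial (ε : ℤ) (α : ℕ+ →₀ ℕ) :
    (shiftHom ε (MvPolynomial.monomial α 1)).natDegree ≤ pweight α := by
  rw [shiftHom, MvPolynomial.aeval_monomial, map_one, one_mul, pweight_apply, Finsupp.prod,
    Finsupp.sum]
  refine (Polynomial.natDegree_prod_le _ _).trans (Finset.sum_le_sum fun k _ => ?_)
  refine Polynomial.natDegree_pow_le_of_le _ ?_
  refine (Polynomial.natDegree_sub_le _ _).trans (max_le ?_ ?_)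
  · rw [Polynomial.natDegree_C]
    exact Nat.zero_le _
  · rw [← Polynomial.C_eq_intCast]
    exact Polynomial.natDegree_C_mul_X_pow_le _ _

/-- The part of weight `d` of `e^{p_1}`. -/
def expPart (d : ℕ) : Fock := MvPolynomial.monomial (Finsupp.single 1 d) (1 / (d.factorial : ℚ))

theorem expPart_eq (d : ℕ) : expPart d
    = (1 / (d.factorial : ℚ)) • MvPolynomial.monomial (Finsupp.single 1 d) (1 : ℚ) := by
  rw [expPart, MvPolynomial.smul_monomial, smul_eq_mul, mul_one]

theorem natDegree_shiftHom_expPart (ε : ℤ) (d : ℕ) : (shiftHom ε (expPart d)).natDegree ≤ d := by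
  rw [expPart_eq, map_smul]
  refine (Polynomial.natDegree_smul_le _ _).trans ((natDegree_shiftHom_monomial ε _).trans ?_)
  rw [pweight_single, PNat.one_coe, mul_one]

/-- The function `e^{p_1}` satisfies the Hirota equations: `e^{p_1 - u} e^{p'_1 + u}` does not
depend on `u`. -/
theorem vertexPairing_expPart {N D : ℕ} (hN : D ≤ N) :
    vertexPairing N (∑ p ∈ Finset.HasAntidiagonal.antidiagonal D,
      expPart p.1 ⊗ₜ[ℚ] expPart p.2) = 0 := by
  refine (MvPolynomial.tensorEquivSum ℚ ℕ+ ℕ+ ℚ).injective ?_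
  rw [map_zero, map_sum, map_sum]
  have h : ∀ p ∈ Finset.HasAntidiagonal.antidiagonal D,
      MvPolynomial.tensorEquivSum ℚ ℕ+ ℕ+ ℚ (vertexPairing N (expPart p.1 ⊗ₜ[ℚ] expPart p.2))
      = residue ((1 / (D.factorial : ℚ)) • (D.choose p.1 •
        (shiftLeft (MvPolynomial.X 1) ^ p.1 * shiftRight (MvPolynomial.X 1) ^ p.2))) := by
    intro p hp
    have hp' := Finset.HasAntidiagonal.mem_antidiagonal.mp hp
    rw [tensorEquivSum_vertexPairing ((natDegree_shiftHom_expPart 1 _).trans (by omega))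
      ((natDegree_shiftHom_expPart (-1) _).trans (by omega)), ← map_pow, ← map_pow,
      MvPolynomial.X_pow_eq_monomial, MvPolynomial.X_pow_eq_monomial, expPart_eq, expPart_eq,
      map_rat_smul, map_rat_smul, smul_mul_smul_comm, ← Nat.cast_smul_eq_nsmul ℚ, smul_smul]
    congr 2
    rw [Nat.choose_eq_factorial_div_factorial (show p.1 ≤ D by omega),
      Nat.cast_div (Nat.factorial_mul_factorial_dvd_factorial (by omega)) (by positivity),
      show D - p.1 = p.2 by omega]
    have := Nat.factorial_ne_zero D
    push_cast
    field_simp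
  rw [Finset.sum_congr rfl h, ← map_sum, ← Finset.smul_sum, ← (Commute.all _ _).add_pow',
    shiftLeft_X, shiftRight_X, sub_add_add_cancel, ← map_add, ← map_pow]
  have hC : (1 / (D.factorial : ℚ)) • Polynomial.C ((MvPolynomial.X (Sum.inl 1)
      + MvPolynomial.X (Sum.inr 1) : Fock2) ^ D)
      = Polynomial.C ((1 / (D.factorial : ℚ)) • (MvPolynomial.X (Sum.inl 1)
      + MvPolynomial.X (Sum.inr 1) : Fock2) ^ D) := (Polynomial.smul_C _ _)
  rw [hC, residue_C]

end Bilinear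

/-! ### Quasihomogeneous power series -/

section Homogeneous

variable {σ : Type*} {R : Type*} [CommRing R]

/-- A power series is quasihomogeneous of degree `n` if it is an eigenvector of the Euler
operator. -/
def IsHomog (w : σ → ℕ) (n : ℕ) (f : MvPowerSeries σ R) : Prop :=
  euler w f = (n : MvPowerSeries σ R) * f

theorem IsHomog.X (w : σ → ℕ) (i : σ) : IsHomog w (w i)
    (MvPowerSeries.X i : MvPowerSeries σ R) := by
  classical
  ext α
  rw [coeff_euler, ← nsmul_eq_mul, map_nsmul, MvPowerSeries.coeff_X]
  split_ifs with h
  · rw [h, Finsupp.weight_single, one_smul]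
  · rw [smul_zero, smul_zero]

theorem IsHomog.add {w : σ → ℕ} {n : ℕ} {f g : MvPowerSeries σ R} (hf : IsHomog w n f)
    (hg : IsHomog w n g) : IsHomog w n (f + g) := by
  rw [IsHomog, map_add, hf, hg, mul_add]

theorem IsHomog.sub {w : σ → ℕ} {n : ℕ} {f g : MvPowerSeries σ R} (hf : IsHomog w n f)
    (hg : IsHomog w n g) : IsHomog w n (f - g) := by
  rw [IsHomog, map_sub, hf, hg, mul_sub]

theorem IsHomog.one (w : σ → ℕ) : IsHomog w 0 (1 : MvPowerSeries σ R) := by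
  rw [IsHomog, Derivation.map_one_eq_zero, Nat.cast_zero, zero_mul]

theorem IsHomog.mul {w : σ → ℕ} {m n : ℕ} {f g : MvPowerSeries σ R} (hf : IsHomog w m f)
    (hg : IsHomog w n g) : IsHomog w (m + n) (f * g) := by
  rw [IsHomog] at hf hg ⊢
  rw [Derivation.leibniz, hf, hg, smul_eq_mul, smul_eq_mul, Nat.cast_add]
  ring

theorem IsHomog.pow {w : σ → ℕ} {n : ℕ} {f : MvPowerSeries σ R} (hf : IsHomog w n f) (e : ℕ) :
    IsHomog w (e * n) (f ^ e) := by
  induction e with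
  | zero =>
    rw [pow_zero, zero_mul]
    exact IsHomog.one w
  | succ e ih =>
    rw [pow_succ, add_mul, one_mul]
    exact ih.mul hf

theorem IsHomog.prod {w : σ → ℕ} {ι : Type*} (s : Finset ι) {n : ι → ℕ}
    {f : ι → MvPowerSeries σ R} (hf : ∀ i, IsHomog w (n i) (f i)) :
    IsHomog w (∑ i ∈ s, n i) (∏ i ∈ s, f i) := by
  classical
  induction s using Finset.induction_on with
  | empty =>
    rw [Finset.sum_empty, Finset.prod_empty]
    exact IsHomog.one w
  | insert i s hi ih =>
    rw [Finset.sum_insert hi, Finset.prod_insert hi]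
    exact (hf i).mul ih

theorem IsHomog.finsupp_prod {w : σ → ℕ} {a : ℕ+ → MvPowerSeries σ R}
    (ha : ∀ k : ℕ+, IsHomog w k (a k)) (α : ℕ+ →₀ ℕ) :
    IsHomog w (pweight α) (α.prod fun k e => a k ^ e) := by
  rw [pweight_apply, Finsupp.sum, Finsupp.prod]
  exact IsHomog.prod _ fun k => (ha k).pow (α k)

variable [Algebra ℚ R]

theorem IsHomog.coeff_eq_zero {w : σ → ℕ} {n : ℕ} {f : MvPowerSeries σ R} (hf : IsHomog w n f)
    {α : σ →₀ ℕ} (hα : Finsupp.weight w α ≠ n) : MvPowerSeries.coeff α f = 0 := by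
  have h := congrArg (MvPowerSeries.coeff α) hf
  rw [coeff_euler, ← nsmul_eq_mul, map_nsmul, ← Nat.cast_smul_eq_nsmul ℚ,
    ← Nat.cast_smul_eq_nsmul ℚ, ← sub_eq_zero, ← sub_smul] at h
  have hne : ((Finsupp.weight w α : ℕ) : ℚ) - n ≠ 0 := sub_ne_zero.mpr (Nat.cast_injective.ne hα)
  have h2 := congrArg (fun t => (((Finsupp.weight w α : ℕ) : ℚ) - n)⁻¹ • t) h
  simpa only [smul_smul, inv_mul_cancel₀ hne, one_smul, smul_zero] using h2

theorem IsHomog.completeHom {w : σ → ℕ} {x : ℕ+ → MvPowerSeries σ R}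
    (hx : ∀ k : ℕ+, IsHomog w k (x k)) (n : ℕ) : IsHomog w n (completeHom x n) :=
  derivation_completeHom_of_homogeneous (A := MvPowerSeries σ R) (S := R) (euler w) hx n

/-- A family of quasihomogeneous series of degrees `1, 2, …` may be substituted into power
series. -/
theorem hasSubst_of_isHomog {w : σ → ℕ} {a : ℕ+ → MvPowerSeries σ R}
    (ha : ∀ k : ℕ+, IsHomog w k (a k)) : MvPowerSeries.HasSubst a where
  const_coeff k := by
    rw [← MvPowerSeries.coeff_zero_eq_constantCoeff_apply, (ha k).coeff_eq_zero]
    · exact IsNilpotent.zero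
    · rw [map_zero]
      exact k.ne_zero.symm
  coeff_zero d := by
    refine Set.Subsingleton.finite fun k hk l hl => ?_
    have h : ∀ k : ℕ+, MvPowerSeries.coeff d (a k) ≠ 0 → Finsupp.weight w d = k := fun k hk => by
      by_contra h
      exact hk ((ha k).coeff_eq_zero h)
    rw [← PNat.coe_inj, ← h k hk, ← h l hl]

theorem finite_pweight_le (D : ℕ) : {α : ℕ+ →₀ ℕ | pweight α ≤ D}.Finite := by
  refine (Set.finite_Iic (∑ k ∈ Finset.Iic D.succPNat, Finsupp.single k D)).subset fun α hα => ?_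
  rw [Set.mem_Iic]
  intro k
  have hα' : pweight α ≤ D := hα
  have h1 : α k * k ≤ D := by
    refine le_trans ?_ hα'
    rw [← Finsupp.single_add_erase k α, map_add, pweight_single]
    simp
  rw [Finsupp.finsetSum_apply]
  rcases Nat.eq_zero_or_pos (α k) with h | h
  · rw [h]
    exact Nat.zero_le _
  · have hk : k ∈ Finset.Iic D.succPNat := by
      rw [Finset.mem_Iic, ← PNat.coe_le_coe, Nat.succPNat_coe]
      nlinarith
    refine le_trans ?_ (Finset.single_le_sum (fun _ _ => Nat.zero_le _) hk)
    rw [Finsupp.single_eq_same]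
    nlinarith [k.pos]

/-- The monomials in `p_1, p_2, …` of weight at most `D`. -/
def monomialsLE (D : ℕ) : Finset (ℕ+ →₀ ℕ) := (finite_pweight_le D).toFinset

theorem mem_monomialsLE {D : ℕ} {α : ℕ+ →₀ ℕ} : α ∈ monomialsLE D ↔ pweight α ≤ D :=
  (finite_pweight_le D).mem_toFinset

theorem coeff_subst_of_isHomog {w : σ → ℕ} {a : ℕ+ → MvPowerSeries σ R}
    (ha : ∀ k : ℕ+, IsHomog w k (a k)) (f : MvPowerSeries ℕ+ R) {δ : σ →₀ ℕ} {D : ℕ}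
    (hδ : Finsupp.weight w δ ≤ D) :
    MvPowerSeries.coeff δ (MvPowerSeries.subst a f) = ∑ α ∈ monomialsLE D,
      MvPowerSeries.coeff α f * MvPowerSeries.coeff δ (α.prod fun k e => a k ^ e) := by
  rw [MvPowerSeries.coeff_subst (hasSubst_of_isHomog ha)]
  refine finsum_eq_sum_of_support_subset _ fun α hα => ?_
  rw [Finset.mem_coe, mem_monomialsLE]
  by_contra h
  refine hα ?_
  change MvPowerSeries.coeff α f • _ = 0
  rw [(IsHomog.finsupp_prod ha α).coeff_eq_zero (by omega), smul_zero]

/-- The pairs of monomials of total weight `D`. -/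
def monomialPairs (D : ℕ) : Finset ((ℕ+ →₀ ℕ) × (ℕ+ →₀ ℕ)) :=
  (monomialsLE D ×ˢ monomialsLE D).filter fun p => pweight p.1 + pweight p.2 = D

theorem coeff_subst_mul_subst {w : σ → ℕ} {a b : ℕ+ → MvPowerSeries σ R}
    (ha : ∀ k : ℕ+, IsHomog w k (a k)) (hb : ∀ k : ℕ+, IsHomog w k (b k))
    (f g : MvPowerSeries ℕ+ R) {δ : σ →₀ ℕ} {D : ℕ} (hδ : Finsupp.weight w δ = D) :
    MvPowerSeries.coeff δ (MvPowerSeries.subst a f * MvPowerSeries.subst b g)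
      = ∑ p ∈ monomialPairs D, MvPowerSeries.coeff p.1 f * MvPowerSeries.coeff p.2 g *
        MvPowerSeries.coeff δ ((p.1.prod fun k e => a k ^ e) * p.2.prod fun k e => b k ^ e) := by
  classical
  simp only [MvPowerSeries.coeff_mul, Finset.mul_sum]
  rw [Finset.sum_comm]
  refine Finset.sum_congr rfl fun q hq => ?_
  have hw : Finsupp.weight w q.1 + Finsupp.weight w q.2 = D := by
    rw [← map_add, Finset.HasAntidiagonal.mem_antidiagonal.mp hq, hδ]
  rw [coeff_subst_of_isHomog ha f (show _ ≤ D by omega),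
    coeff_subst_of_isHomog hb g (show _ ≤ D by omega), Finset.sum_mul_sum, ← Finset.sum_product',
    monomialPairs, Finset.sum_filter]
  refine Finset.sum_congr rfl fun p _ => ?_
  split_ifs with h
  · ring
  · by_cases h1 : Finsupp.weight w q.1 = pweight p.1
    · rw [(IsHomog.finsupp_prod hb p.2).coeff_eq_zero (by omega)]
      ring
    · rw [(IsHomog.finsupp_prod ha p.1).coeff_eq_zero h1]
      ring

end Homogeneous

/-! ### The coefficients of the Hirota equations -/

section Hirota

variable {R : Type*} [CommRing R]

/-- The weights of the variables `p_k` and `p'_k`. -/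
def weightTwo (v : TwoCopies) : ℕ := (Sum.elim id id v : ℕ+)

/-- The weights of the variables `p_k`, `p'_k` and `u`. -/
def weightOpt (o : Option TwoCopies) : ℕ := o.elim 1 weightTwo

theorem wt_eq (γ : TwoCopies →₀ ℕ) : wt γ = Finsupp.weight weightTwo γ := rfl

theorem weight_embDomain_some (γ : TwoCopies →₀ ℕ) (n : ℕ) :
    Finsupp.weight weightOpt (γ.embDomain Function.Embedding.some + Finsupp.single none n)
      = wt γ + n := by
  rw [map_add, Finsupp.weight_single, show weightOpt none = 1 from rfl, smul_eq_mul, mul_one, wt_eq,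
    Finsupp.weight_apply, Finsupp.weight_apply, Finsupp.sum_embDomain]
  rfl

theorem isHomog_shift_left (k : ℕ+) : IsHomog weightOpt k
    (MvPowerSeries.X (some (Sum.inl k)) - MvPowerSeries.X none ^ (k : ℕ) :
      MvPowerSeries (Option TwoCopies) R) := by
  have h := (IsHomog.X (R := R) weightOpt none).pow k
  rw [show weightOpt none = 1 from rfl, mul_one] at h
  exact (IsHomog.X (R := R) weightOpt (some (Sum.inl k))).sub h

theorem isHomog_shift_right (k : ℕ+) : IsHomog weightOpt k
    (MvPowerSeries.X (some (Sum.inr k)) + MvPowerSeries.X none ^ (k : ℕ) :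
      MvPowerSeries (Option TwoCopies) R) := by
  have h := (IsHomog.X (R := R) weightOpt none).pow k
  rw [show weightOpt none = 1 from rfl, mul_one] at h
  exact (IsHomog.X (R := R) weightOpt (some (Sum.inr k))).add h

variable (R) in
/-- The product of the monomials `α` and `β` in `p - [u]` and `p' + [u]`. -/
def shiftedMonomials (α β : ℕ+ →₀ ℕ) : MvPowerSeries (Option TwoCopies) R :=
  (α.prod fun k e => (MvPowerSeries.X (some (Sum.inl k)) - MvPowerSeries.X none ^ (k : ℕ)) ^ e)
    * β.prod fun k e => (MvPowerSeries.X (some (Sum.inr k)) + MvPowerSeries.X none ^ (k : ℕ)) ^ e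

theorem coeff_uCoeff (n : ℕ) (A : MvPowerSeries (Option TwoCopies) R) (γ : TwoCopies →₀ ℕ) :
    MvPowerSeries.coeff γ (uCoeff n A)
      = MvPowerSeries.coeff (γ.embDomain Function.Embedding.some + Finsupp.single none n) A := rfl

variable [Algebra ℚ R]

theorem isHomog_completeHom_sub (n : ℕ) : IsHomog weightTwo n (completeHom (fun k : ℕ+ =>
    (MvPowerSeries.X (Sum.inl k) - MvPowerSeries.X (Sum.inr k) : MvPowerSeries TwoCopies R)) n) :=
  IsHomog.completeHom (fun k => (IsHomog.X (R := R) weightTwo (Sum.inl k)).sub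
    (IsHomog.X (R := R) weightTwo (Sum.inr k))) n

variable (R) in
/-- The Hirota residue of a pair of monomials, at the monomial `γ`. -/
def hirotaCoeff (γ : TwoCopies →₀ ℕ) (α β : ℕ+ →₀ ℕ) : R :=
  ∑ j ∈ Finset.range (wt γ + 1), MvPowerSeries.coeff γ
    (completeHom (fun k : ℕ+ =>
        (MvPowerSeries.X (Sum.inl k) - MvPowerSeries.X (Sum.inr k) : MvPowerSeries TwoCopies R)) j
      * uCoeff (j + 1) (shiftedMonomials R α β))

theorem coeff_bilinearResidue (τ : MvPowerSeries ℕ+ R) (γ : TwoCopies →₀ ℕ) :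
    MvPowerSeries.coeff γ (bilinearResidue τ) = ∑ p ∈ monomialPairs (wt γ + 1),
      MvPowerSeries.coeff p.1 τ * MvPowerSeries.coeff p.2 τ * hirotaCoeff R γ p.1 p.2 := by
  classical
  change ∑ j ∈ Finset.range (wt γ + 1), MvPowerSeries.coeff γ
    (completeHom (fun k : ℕ+ =>
        (MvPowerSeries.X (Sum.inl k) - MvPowerSeries.X (Sum.inr k) : MvPowerSeries TwoCopies R)) j
      * uCoeff (j + 1) (shiftedProduct τ)) = _
  simp only [hirotaCoeff, Finset.mul_sum]
  rw [Finset.sum_comm]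
  refine Finset.sum_congr rfl fun j _ => ?_
  simp only [MvPowerSeries.coeff_mul, Finset.mul_sum]
  rw [Finset.sum_comm]
  refine Finset.sum_congr rfl fun q hq => ?_
  by_cases hj : Finsupp.weight weightTwo q.1 = j
  · have hw : wt q.2 + (j + 1) = wt γ + 1 := by
      rw [← hj, wt_eq, wt_eq, ← Finset.HasAntidiagonal.mem_antidiagonal.mp hq, map_add]
      ring
    rw [coeff_uCoeff, shiftedProduct, coeff_subst_mul_subst isHomog_shift_left isHomog_shift_right
      τ τ ((weight_embDomain_some q.2 (j + 1)).trans hw), Finset.mul_sum]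
    refine Finset.sum_congr rfl fun p _ => ?_
    rw [coeff_uCoeff, shiftedMonomials]
    ring
  · simp only [(isHomog_completeHom_sub (R := R) j).coeff_eq_zero hj, zero_mul, mul_zero,
      Finset.sum_const_zero]

variable (R) in
/-- Polynomials in `p`, `p'` with rational coefficients as power series over `R`. -/
def coeTwo : Fock2 →+* MvPowerSeries TwoCopies R :=
  (MvPowerSeries.map (algebraMap ℚ R)).comp MvPolynomial.coeToMvPowerSeries.ringHom

theorem coeff_coeTwo (f : Fock2) (γ : TwoCopies →₀ ℕ) :
    MvPowerSeries.coeff γ (coeTwo R f) = algebraMap ℚ R (MvPolynomial.coeff γ f) := rfl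

theorem coeTwo_X (v : TwoCopies) : coeTwo R (MvPolynomial.X v) = MvPowerSeries.X v := by
  change MvPowerSeries.map (algebraMap ℚ R)
    ((MvPolynomial.X v : Fock2) : MvPowerSeries TwoCopies ℚ) = _
  rw [MvPolynomial.coe_X, MvPowerSeries.map_X]

variable (R) in
/-- Polynomials in `p`, `p'` and `u` with rational coefficients as power series over `R`. -/
def coeOpt : Polynomial Fock2 →+* MvPowerSeries (Option TwoCopies) R :=
  ((MvPowerSeries.map (algebraMap ℚ R)).comp MvPolynomial.coeToMvPowerSeries.ringHom).comp
    (MvPolynomial.optionEquivLeft ℚ TwoCopies).symm.toRingHom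

theorem coeOpt_apply (G : Polynomial Fock2) : coeOpt R G = MvPowerSeries.map (algebraMap ℚ R)
    (((MvPolynomial.optionEquivLeft ℚ TwoCopies).symm G : MvPolynomial (Option TwoCopies) ℚ) :
      MvPowerSeries (Option TwoCopies) ℚ) := rfl

theorem coeOpt_C_X (v : TwoCopies) :
    coeOpt R (Polynomial.C (MvPolynomial.X v)) = MvPowerSeries.X (some v) := by
  rw [coeOpt_apply, MvPolynomial.optionEquivLeft_symm_C_X, MvPolynomial.coe_X, MvPowerSeries.map_X]

theorem coeOpt_X : coeOpt R Polynomial.X = MvPowerSeries.X none := by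
  rw [coeOpt_apply, MvPolynomial.optionEquivLeft_symm_X, MvPolynomial.coe_X, MvPowerSeries.map_X]

theorem uCoeff_coeOpt (n : ℕ) (G : Polynomial Fock2) :
    uCoeff n (coeOpt R G) = coeTwo R (G.coeff n) := by
  classical
  ext γ
  rw [coeff_uCoeff, coeff_coeTwo, coeOpt_apply, MvPowerSeries.coeff_map, MvPolynomial.coeff_coe]
  congr 1
  have h := MvPolynomial.optionEquivLeft_coeff_coeff (R := ℚ)
    ((MvPolynomial.optionEquivLeft ℚ TwoCopies).symm G) n γ
  rw [AlgEquiv.apply_symm_apply] at h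
  rw [h]
  congr 1
  ext o
  cases o with
  | none =>
    rw [Finsupp.optionElim_apply_none, Finsupp.add_apply, Finsupp.single_eq_same,
      Finsupp.embDomain_of_notMem_range _ _ _ (by simp), zero_add]
  | some v =>
    rw [Finsupp.optionElim_apply_some, Finsupp.add_apply, Finsupp.single_eq_of_ne (by simp),
      add_zero]
    exact Finsupp.embDomain_apply_self Function.Embedding.some γ v

theorem shiftedMonomials_eq (α β : ℕ+ →₀ ℕ) : shiftedMonomials R α β
    = coeOpt R
      (shiftLeft (MvPolynomial.monomial α 1) * shiftRight (MvPolynomial.monomial β 1)) := by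
  rw [MvPolynomial.monomial_eq, MvPolynomial.monomial_eq, map_one, one_mul, one_mul,
    shiftedMonomials, map_mul, Finsupp.prod, Finsupp.prod, Finsupp.prod, Finsupp.prod, map_prod,
    map_prod, map_prod, map_prod]
  simp only [map_pow, shiftLeft_X, shiftRight_X, map_sub, map_add, coeOpt_C_X, coeOpt_X]

theorem coeTwo_residueCoeff (j : ℕ) : coeTwo R (residueCoeff (j + 1))
    = completeHom (fun k : ℕ+ =>
        (MvPowerSeries.X (Sum.inl k) - MvPowerSeries.X (Sum.inr k) : MvPowerSeries TwoCopies R))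
        j := by
  rw [residueCoeff, map_completeHom]
  simp only [map_sub, coeTwo_X]

theorem coeff_residueCoeff_mul {γ : TwoCopies →₀ ℕ} {j : ℕ} (hj : wt γ < j) (Q : Fock2) :
    MvPolynomial.coeff γ (residueCoeff (j + 1) * Q) = 0 := by
  classical
  have h : MvPowerSeries.coeff γ (coeTwo ℚ (residueCoeff (j + 1) * Q)) = 0 := by
    rw [map_mul, coeTwo_residueCoeff, MvPowerSeries.coeff_mul]
    refine Finset.sum_eq_zero fun q hq => ?_
    have hw : wt q.1 + wt q.2 = wt γ := by
      rw [wt_eq, wt_eq, wt_eq, ← map_add, Finset.HasAntidiagonal.mem_antidiagonal.mp hq]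
    rw [wt_eq q.1] at hw
    rw [(isHomog_completeHom_sub (R := ℚ) j).coeff_eq_zero (by omega), zero_mul]
  exact h

theorem coeff_residue (G : Polynomial Fock2) (γ : TwoCopies →₀ ℕ) :
    MvPolynomial.coeff γ (residue G) = ∑ j ∈ Finset.range (wt γ + 1),
      MvPolynomial.coeff γ (residueCoeff (j + 1) * G.coeff (j + 1)) := by
  set M := max G.natDegree (wt γ + 1) with hM
  have h1 : residue G = ∑ j ∈ Finset.range (M + 1), G.coeff j * residueCoeff j := by
    conv_lhs => rw [G.as_sum_range' (M + 1) (by omega)]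
    rw [map_sum]
    simp only [residue_monomial]
  rw [h1, Finset.sum_range_succ', residueCoeff, mul_zero, add_zero, MvPolynomial.coeff_sum,
    ← Finset.sum_subset (Finset.range_subset_range.mpr (show wt γ + 1 ≤ M by omega))]
  · exact Finset.sum_congr rfl fun j _ => by rw [mul_comm]
  · intro j _ hj
    rw [Finset.mem_range] at hj
    rw [mul_comm, coeff_residueCoeff_mul (by omega)]

theorem hirotaCoeff_eq (γ : TwoCopies →₀ ℕ) (α β : ℕ+ →₀ ℕ) : hirotaCoeff R γ α β
    = algebraMap ℚ R (MvPolynomial.coeff γ (residue (shiftLeft (MvPolynomial.monomial α 1)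
      * shiftRight (MvPolynomial.monomial β 1)))) := by
  rw [coeff_residue, map_sum, hirotaCoeff]
  refine Finset.sum_congr rfl fun j _ => ?_
  rw [shiftedMonomials_eq, uCoeff_coeOpt, ← coeTwo_residueCoeff, ← map_mul, coeff_coeTwo]

end Hirota

/-! ### The evolution of the vacuum solution -/

section Evolution

open scoped TensorProduct

theorem coe_expPart (d : ℕ) :
    ((expPart d : Fock) : MvPowerSeries ℕ+ ℚ) = weightPart d (expSeries (MvPowerSeries.X 1)) := by
  rw [weightPart_expSeries_X_one, expPart, MvPolynomial.coe_monomial, ← map_smul, smul_eq_mul,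
    mul_one]

theorem coeff_cutJoinFock_pow_expPart (i d : ℕ) (α : ℕ+ →₀ ℕ) :
    (1 / 2 : ℚ) ^ i * MvPolynomial.coeff α ((cutJoinFock ^ i) (expPart d))
      = if pweight α = d then
        MvPowerSeries.coeff α (cutJoin^[i] (expSeries (MvPowerSeries.X 1))) else 0 := by
  rw [← MvPolynomial.coeff_coe, ← smul_eq_mul, ← map_smul, ← cutJoin_iterate_coe, coe_expPart,
    ← weightPart_cutJoin_iterate, coeff_weightPart]
  simp only [Nat.cast_inj]

theorem cutJoinFock_pow_expPart (i : ℕ) {d D : ℕ} (hd : d ≤ D) :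
    (1 / 2 : ℚ) ^ i • (cutJoinFock ^ i) (expPart d)
      = ∑ α ∈ (monomialsLE D).filter (fun α => pweight α = d),
        MvPowerSeries.coeff α (cutJoin^[i] (expSeries (MvPowerSeries.X 1)))
          • MvPolynomial.monomial α (1 : ℚ) := by
  classical
  ext β
  rw [MvPolynomial.coeff_smul, smul_eq_mul, coeff_cutJoinFock_pow_expPart, MvPolynomial.coeff_sum]
  simp only [MvPolynomial.coeff_smul, MvPolynomial.coeff_monomial, smul_eq_mul, mul_ite, mul_one,
    mul_zero]
  rw [Finset.sum_ite_eq']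
  refine if_congr ?_ rfl rfl
  rw [Finset.mem_filter, mem_monomialsLE]
  exact ⟨fun h => ⟨by omega, h⟩, fun h => h.2⟩

theorem sum_monomialPairs (D i j : ℕ) :
    ∑ p ∈ monomialPairs D,
        (MvPowerSeries.coeff p.1 (cutJoin^[i] (expSeries (MvPowerSeries.X 1)))
          * MvPowerSeries.coeff p.2 (cutJoin^[j] (expSeries (MvPowerSeries.X 1))))
        • (MvPolynomial.monomial p.1 (1 : ℚ) ⊗ₜ[ℚ] MvPolynomial.monomial p.2 (1 : ℚ))
      = (1 / 2 : ℚ) ^ (i + j) • TensorProduct.map (cutJoinFock ^ i) (cutJoinFock ^ j)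
        (∑ d ∈ Finset.HasAntidiagonal.antidiagonal D, expPart d.1 ⊗ₜ[ℚ] expPart d.2) := by
  classical
  rw [map_sum, Finset.smul_sum, ← Finset.sum_fiberwise_of_maps_to
    (t := Finset.HasAntidiagonal.antidiagonal D) (g := fun p => (pweight p.1, pweight p.2))]
  · refine Finset.sum_congr rfl fun d hd => ?_
    have hd' := Finset.HasAntidiagonal.mem_antidiagonal.mp hd
    rw [TensorProduct.map_tmul, pow_add, ← TensorProduct.smul_tmul_smul,
      cutJoinFock_pow_expPart i (show d.1 ≤ D by omega),
      cutJoinFock_pow_expPart j (show d.2 ≤ D by omega), TensorProduct.sum_tmul]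
    simp only [TensorProduct.tmul_sum, TensorProduct.smul_tmul_smul]
    rw [← Finset.sum_product']
    refine Finset.sum_congr ?_ fun p _ => rfl
    ext p
    simp only [monomialPairs, Finset.mem_filter, Finset.mem_product, mem_monomialsLE,
      Prod.ext_iff]
    constructor
    · rintro ⟨⟨⟨h1, h2⟩, -⟩, h3, h4⟩
      exact ⟨⟨h1, h3⟩, h2, h4⟩
    · rintro ⟨⟨h1, h3⟩, h2, h4⟩
      exact ⟨⟨⟨h1, h2⟩, by omega⟩, h3, h4⟩
  · intro p hp
    rw [Finset.HasAntidiagonal.mem_antidiagonal]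
    exact (Finset.mem_filter.mp hp).2

/-- A coefficient of the residue is a linear functional of the components of `e^{β M₀} e^{p₁}` of
bounded degree, which `vertexPairing` annihilates. -/
theorem bilinearResidue_expCutJoin :
    bilinearResidue (expCutJoin (expSeries (MvPowerSeries.X 1))) = 0 := by
  classical
  ext γ m
  rw [coeff_bilinearResidue, map_zero, map_zero, map_sum]
  set D := wt γ + 1 with hD
  set E : MvPowerSeries ℕ+ ℚ := expSeries (MvPowerSeries.X 1) with hE
  -- the residue as a linear functional on the tensor square
  set L : Fock ⊗[ℚ] Fock →ₗ[ℚ] ℚ := MvPolynomial.lcoeff ℚ γ ∘ₗ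
    (MvPolynomial.tensorEquivSum ℚ ℕ+ ℕ+ ℚ).toLinearMap ∘ₗ vertexPairing D with hL
  have hLv : ∀ v, vertexPairing D v = 0 → L v = 0 := by
    intro v hv
    rw [hL, LinearMap.comp_apply, LinearMap.comp_apply, hv, map_zero, map_zero]
  have hcoeff : ∀ p ∈ monomialPairs D, PowerSeries.coeff m
      (MvPowerSeries.coeff p.1 (expCutJoin E) * MvPowerSeries.coeff p.2 (expCutJoin E)
        * hirotaCoeff (PowerSeries ℚ) γ p.1 p.2)
      = ∑ q ∈ Finset.HasAntidiagonal.antidiagonal m,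
        (1 / ((q.1.factorial : ℚ) * q.2.factorial)) *
        L ((MvPowerSeries.coeff p.1 (cutJoin^[q.1] E) * MvPowerSeries.coeff p.2 (cutJoin^[q.2] E))
          • (MvPolynomial.monomial p.1 (1 : ℚ) ⊗ₜ[ℚ] MvPolynomial.monomial p.2 (1 : ℚ))) := by
    intro p hp
    obtain ⟨hp1, hp2⟩ := Finset.mem_product.mp (Finset.mem_filter.mp hp).1
    have hK : L (MvPolynomial.monomial p.1 (1 : ℚ) ⊗ₜ[ℚ] MvPolynomial.monomial p.2 (1 : ℚ))
        = MvPolynomial.coeff γ (residue (shiftLeft (MvPolynomial.monomial p.1 1)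
          * shiftRight (MvPolynomial.monomial p.2 1))) := by
      rw [← tensorEquivSum_vertexPairing
        ((natDegree_shiftHom_monomial 1 p.1).trans (mem_monomialsLE.mp hp1))
        ((natDegree_shiftHom_monomial (-1) p.2).trans (mem_monomialsLE.mp hp2))]
      rfl
    rw [hirotaCoeff_eq, ← hK, mul_comm _ (algebraMap ℚ (PowerSeries ℚ) _), ← Algebra.smul_def,
      map_smul, PowerSeries.coeff_mul, smul_eq_mul, Finset.mul_sum]
    refine Finset.sum_congr rfl fun q _ => ?_
    have hτ : ∀ (α : ℕ+ →₀ ℕ) (i : ℕ), PowerSeries.coeff i (MvPowerSeries.coeff α (expCutJoin E))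
        = MvPowerSeries.coeff α (cutJoin^[i] E) / (i.factorial : ℚ) := by
      intro α i
      change PowerSeries.coeff i (PowerSeries.mk fun m =>
        MvPowerSeries.coeff α (cutJoin^[m] E) / (m.factorial : ℚ)) = _
      rw [PowerSeries.coeff_mk]
    rw [hτ, hτ, map_smul, smul_eq_mul]
    ring
  rw [Finset.sum_congr rfl hcoeff, Finset.sum_comm]
  have hpairs := sum_monomialPairs D
  rw [← hE] at hpairs
  simp only [← Finset.mul_sum, ← map_sum, hpairs]
  have hfac : ∀ q ∈ Finset.HasAntidiagonal.antidiagonal m,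
      1 / ((q.1.factorial : ℚ) * q.2.factorial) * L ((1 / 2 : ℚ) ^ (q.1 + q.2) •
        TensorProduct.map (cutJoinFock ^ q.1) (cutJoinFock ^ q.2)
        (∑ d ∈ Finset.HasAntidiagonal.antidiagonal D, expPart d.1 ⊗ₜ[ℚ] expPart d.2))
      = ((1 / 2 : ℚ) ^ m / m.factorial) * L (m.choose q.1 •
        TensorProduct.map (cutJoinFock ^ q.1) (cutJoinFock ^ q.2)
        (∑ d ∈ Finset.HasAntidiagonal.antidiagonal D, expPart d.1 ⊗ₜ[ℚ] expPart d.2)) := by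
    intro q hq
    have hq' := Finset.HasAntidiagonal.mem_antidiagonal.mp hq
    rw [hq', map_smul, map_nsmul, smul_eq_mul, nsmul_eq_mul,
      Nat.cast_choose ℚ (show q.1 ≤ m by omega), show m - q.1 = q.2 by omega]
    have := Nat.factorial_ne_zero m
    field_simp
  rw [Finset.sum_congr rfl hfac, ← Finset.mul_sum, ← map_sum,
    hLv _ (vertexPairing_sum_eq_zero (vertexPairing_expPart le_rfl) m), mul_zero]

theorem isKPSolution_hurwitzSeries : IsKPSolution hurwitzSeries := by
  rw [IsKPSolution, constantCoeff_hurwitzSeries, map_zero, sub_zero, expSeries_hurwitzSeries,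
    bilinearResidue_expCutJoin]

end Evolution

end KPHurwitz

end

theorem theorem2 :
    KPHurwitz.expSeries KPHurwitz.hurwitzSeries =
        KPHurwitz.expCutJoin (KPHurwitz.expSeries (MvPowerSeries.X 1)) ∧
      KPHurwitz.IsKPSolution KPHurwitz.hurwitzSeries :=
  ⟨KPHurwitz.expSeries_hurwitzSeries, KPHurwitz.isKPSolution_hurwitzSeries⟩
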